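/- **Theorem 6.1 (Multiplication formula).** Let $(U_k)_{k\ge 0}$ be i.i.d. random variables, uniformly distributed on $[-1,1]$, and let $Y_t=\sum_{k\ge 0}\mathbf 1_{[2k+1+U_k,\infty)}(t)$, $t\in\mathbb R_+=[0,\infty)$. For $n\ge 0$ let $$\Delta_n=\bigcup_{k_1,\dots,k_n\ge 0\ \text{pairwise distinct}}[2k_1,2k_1+2]\times\cdots\times[2k_n,2k_n+2],$$ and let $\hat L^2(\mathbb R_+^n)$ be the space of symmetric functions in $L^2(\mathbb R_+^n)$ that vanish outside $\Delta_n$ (almost everywhere). For $f_n\in L^1(\mathbb R_+^n)\cap\hat L^2(\mathbb R_+^n)$ the multiple stochastic integral with respect to $d(Y_t-t/2)$ is $$I_n(f_n)=\sum_{r=0}^n\frac{(-1)^{n-r}}{2^{n-r}}\binom nr\sum_{k_1,\dots,k_r\ge 0\ \text{pairwise distinct}}\int_{\mathbb R_+^{n-r}}f_n(2k_1+1+U_{k_1},\dots,2k_r+1+U_{k_r},y_1,\dots,y_{n-r})\,dy_1\cdots dy_{n-r},$$ (so $I_0(c)=c$), and $I_n$ is extended by $L^2$-continuity to $\hat L^2(\mathbb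 R_+^n)$, with values in $L^2(\Omega)$. For a symmetric $h\in L^2(\mathbb R_+^p)$ that need not vanish outside $\Delta_p$, $I_p(h)$ stands for $I_p(h\mathbf 1_{\Delta_p})$. Let $n,m\ge 0$, and let $f_n\in\hat L^2(\mathbb R_+^n)$ and $g_m\in\hat L^2(\mathbb R_+^m)$ be canonical, i.e. $\int_{2k}^{2k+2}f_n(t,*)\,dt=0$ for all $k\in\mathbb N=\{0,1,\dots\}$ and almost every $*\in\mathbb R_+^{n-1}$, and likewise for $g_m$ (no condition if $n=0$, resp. $m=0$). For $0\le i\le k\le m\wedge n$ put $$f_n\star_k^i g_m(\gamma_1,\dots,\gamma_{k-i},t_1,\dots,t_{n-k},s_1,\dots,s_{m-k})=\frac1{2^i}\int_{[0,\infty)^i}f_n(z_1,\dots,z_i,\gamma_1,\dots,\gamma_{k-i},t_1,\dots,t_{n-k})\,g_m(z_1,\dots,z_i,\gamma_1,\dots,\gamma_{k-i},s_1,\dots,s_{m-k})\,dz_1\cdots dz_i,$$ and let $f_n\,\widetilde\star_k^i\,g_m$ be its symmetrisation in its $m+n-k-i$ variables (the average over all permutations of the variables). Assume that $f_n\star_k^i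 g_m\in L^2(\mathbb R_+^{m+n-k-i})$ for all $0\le i\le k\le m\wedge n$. Then all the multiple integrals below are well defined and, almost surely, $$I_n(f_n)\,I_m(g_m)=\sum_{k=0}^{m\wedge n}k!\binom mk\binom nk\sum_{i=0}^k\binom ki\,I_{m+n-k-i}\big(f_n\,\widetilde\star_k^i\,g_m\big).$$ -/

import Mathlib

open MeasureTheory ProbabilityTheory Filter Topology
open scoped ENNReal Nat

noncomputable section

namespace UniformChaos

/-- Lebesgue measure on `ℝ₊ⁿ = [0,∞)ⁿ`, as a measure on `Fin n → ℝ`.  For `n = 0` it is the unit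
mass at the only point of `ℝ⁰`. -/
def leb (n : ℕ) : Measure (Fin n → ℝ) :=
  Measure.pi fun _ : Fin n => (volume : Measure ℝ).restrict (Set.Ici 0)

/-- The `U k`, `k = 0, 1, 2, …`, are independent random variables, each uniformly distributed
on the interval `[-1, 1]`. -/
structure IsIIDUniform {Ω : Type*} [MeasurableSpace Ω] (P : Measure Ω) (U : ℕ → Ω → ℝ) :
    Prop where
  measurable : ∀ k, Measurable (U k)
  uniform : ∀ k, pdf.IsUniform (U k) (Set.Icc (-1) 1) P volume
  indep : iIndepFun U P

/-- The jump times `2k + 1 + U_k` of the point process `Y_t = ∑ₖ 1_{[2k+1+U_k, ∞)}(t)`. -/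
def jumpTime {Ω : Type*} (U : ℕ → Ω → ℝ) (k : ℕ) (ω : Ω) : ℝ := 2 * (k : ℝ) + 1 + U k ω

/-- `Δₙ`: the union of the boxes `[2k₁, 2k₁+2] × ⋯ × [2kₙ, 2kₙ+2]` over pairwise distinct
`k₁, …, kₙ ≥ 0`. -/
def offDiag (n : ℕ) : Set (Fin n → ℝ) :=
  {x | ∃ κ : Fin n → ℕ, Function.Injective κ ∧
    ∀ j, x j ∈ Set.Icc (2 * (κ j : ℝ)) (2 * (κ j : ℝ) + 2)}

/-- The space `L̂²(ℝ₊ⁿ)` of symmetric square integrable functions vanishing outside of `Δₙ`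
(functions being considered up to null sets). -/
structure MemHatL2 (n : ℕ) (f : (Fin n → ℝ) → ℝ) : Prop where
  memLp : MemLp f 2 (leb n)
  symmetric : ∀ σ : Equiv.Perm (Fin n), ∀ᵐ x ∂leb n, f (fun j => x (σ j)) = f x
  vanish : ∀ᵐ x ∂leb n, x ∉ offDiag n → f x = 0

/-- Canonical functions: `∫_{2k}^{2k+2} f(t, *) dt = 0` for every `k ∈ ℕ` and almost every `*`;
there is no condition on constants (`n = 0`). -/
def IsCanonical : (n : ℕ) → ((Fin n → ℝ) → ℝ) → Prop
  | 0, _ => True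
  | n + 1, f => ∀ k : ℕ, ∀ᵐ x ∂leb n,
      ∫ t in (2 * (k : ℝ))..(2 * (k : ℝ) + 2), f (Fin.cons t x : Fin (n + 1) → ℝ) = 0

/-- The multiple stochastic integral of `f ∈ L¹ ∩ L̂²(ℝ₊ⁿ)`, given by the explicit formula
`∑ᵣ (-1)ⁿ⁻ʳ/2ⁿ⁻ʳ C(n,r) ∑_{k₁,…,kᵣ distinct} ∫ f(2k₁+1+U_{k₁}, …, 2kᵣ+1+U_{kᵣ}, y) dy`,
with `y` ranging over `ℝ₊ⁿ⁻ʳ`. -/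
def elemIntegral {Ω : Type*} (U : ℕ → Ω → ℝ) (n : ℕ) (f : (Fin n → ℝ) → ℝ) (ω : Ω) : ℝ :=
  ∑ r ∈ Finset.range (n + 1),
    (-1 : ℝ) ^ (n - r) / 2 ^ (n - r) * (n.choose r : ℝ) *
      ∑' κ : Fin r ↪ ℕ, ∫ y : Fin (n - r) → ℝ,
        f (fun j : Fin n =>
          if h : (j : ℕ) < r then jumpTime U (κ ⟨j, h⟩) ω
          else y ⟨(j : ℕ) - r, by omega⟩) ∂leb (n - r)

/-- `Z ∈ L²(Ω)` is the value at `f` of the extension by `L²`-continuity of the multiple stochastic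
integral from `L¹ ∩ L̂²(ℝ₊ⁿ)` to its `L²`-closure `L̂²(ℝ₊ⁿ)`: `f` can be approximated by elements
`h` of `L¹ ∩ L̂²`, and the integrals of `h` tend to `Z` in `L²(Ω)` as `h` tends to `f`. -/
structure IsMultipleIntegral {Ω : Type*} [MeasurableSpace Ω] (P : Measure Ω) (U : ℕ → Ω → ℝ)
    (n : ℕ) (f : (Fin n → ℝ) → ℝ) (Z : Ω → ℝ) : Prop where
  memLp : MemLp Z 2 P
  approx : ∀ δ : ℝ≥0∞, 0 < δ → ∃ h : (Fin n → ℝ) → ℝ, MemHatL2 n h ∧ Integrable h (leb n) ∧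
    eLpNorm (h - f) 2 (leb n) ≤ δ
  tendsto : ∀ ε : ℝ≥0∞, 0 < ε → ∃ δ : ℝ≥0∞, 0 < δ ∧
    ∀ h : (Fin n → ℝ) → ℝ, MemHatL2 n h → Integrable h (leb n) →
      eLpNorm (h - f) 2 (leb n) ≤ δ → eLpNorm (elemIntegral U n h - Z) 2 P ≤ ε

open Classical in
/-- The multiple stochastic integral `Iₙ(f)` of `f ∈ L̂²(ℝ₊ⁿ)`, a square integrable random variable
(determined up to almost sure equality). -/
def multipleIntegral {Ω : Type*} [MeasurableSpace Ω] (P : Measure Ω) (U : ℕ → Ω → ℝ)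
    (n : ℕ) (f : (Fin n → ℝ) → ℝ) : Ω → ℝ :=
  if h : ∃ Z, IsMultipleIntegral P U n f Z then h.choose else 0

/-- The coordinate of `x` with (zero-based) index `j`; the value `0` for `j ≥ N` is never used
below. -/
def coord {N : ℕ} (x : Fin N → ℝ) (j : ℕ) : ℝ := if h : j < N then x ⟨j, h⟩ else 0

/-- The contraction `f ⋆ₖⁱ g` for `0 ≤ i ≤ k ≤ m ∧ n`.  The variable `x` is
`(γ₁,…,γ_{k-i}, t₁,…,t_{n-k}, s₁,…,s_{m-k})`, and the value is
`2⁻ⁱ ∫ f(z, γ, t) g(z, γ, s) dz` with `z` ranging over `[0,∞)ⁱ`. -/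
def contraction (n m k i : ℕ) (f : (Fin n → ℝ) → ℝ) (g : (Fin m → ℝ) → ℝ)
    (x : Fin (m + n - k - i) → ℝ) : ℝ :=
  1 / 2 ^ i * ∫ z : Fin i → ℝ,
    f (fun j : Fin n => if (j : ℕ) < i then coord z j else coord x (j - i)) *
    g (fun j : Fin m =>
      if (j : ℕ) < i then coord z j
      else if (j : ℕ) < k then coord x (j - i)
      else coord x ((n - i) + (j - k))) ∂leb i

/-- The symmetrisation of a function of `N` variables. -/
def symmetrisation (N : ℕ) (h : (Fin N → ℝ) → ℝ) (x : Fin N → ℝ) : ℝ :=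
  1 / (N ! : ℝ) * ∑ σ : Equiv.Perm (Fin N), h (fun j => x (σ j))

/-- The kernel of the integral of order `m + n - k - i`: the symmetrised contraction of `f` and
`g`, restricted to `Δ_{m+n-k-i}` so that it belongs to the domain of the multiple integral. -/
def productKernel (n m k i : ℕ) (f : (Fin n → ℝ) → ℝ) (g : (Fin m → ℝ) → ℝ) :
    (Fin (m + n - k - i) → ℝ) → ℝ :=
  (offDiag (m + n - k - i)).indicator
    (symmetrisation (m + n - k - i) (contraction n m k i f g))

end UniformChaos

end

noncomputable section

namespace UniformChaos

/-! Everything is transported to the space of sequences of jump times, whose law `pathLaw` is the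
product of the uniform laws on the boxes [2k, 2k+2]. For a set B of n indices, `sect f B` is f at
the coordinates in B. Lebesgue measure is a sum over boxes of 2ⁿ times products of uniform laws
(`leb_eq_sum`), so the explicit formula can be sorted by occupied boxes. It becomes I_n(f) = n! ∑_B
`boxTerm f B`, where inclusion–exclusion makes the term of B centred in every coordinate of B
(`hasSum_pathIntegral`). Terms of different B are orthogonal, hence the series converges in L² with
norm at most n! 2ⁿ ‖f‖, and its sum is the continuous extension
(`isMultipleIntegral_of_isPathLimit`). For canonical f the compensation is void: the term of B is
`sect f B` itself (`boxTerm_ae_eq_sect`).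

The formula is proved weakly. Products ψ_S of bounded centred functions of the coordinates in S
determine an integrable variable (`ae_eq_zero_of_testFn`), so it suffices to compare pairings with
them; no convergence of the double series of products is then needed. A multiple integral pairs with
ψ_S only through its term B = S. The expectation of `sect f A` · `sect g B` · ψ_S vanishes when some
coordinate occurs in only one of the three factors (`pairing_eq_zero`). Hence A = Z ∪ V and B = Z ∪
W with Z disjoint from S and V ∪ W = S, and summing over Z gives `totalPairing`.

On the other side, integrating z₁,…,z_i out of a contraction is summing over the shared set Z, |Z| =
i (`integral_contraction_mul_testFn`), while the γ variables are the coordinates in V ∩ W, |V ∩ W| =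
k − i. Symmetrisation makes (V, W) run over all pairs of the right sizes covering S, each met
(k−i)!(n−k)!(m−k)! times (`sum_perm_map`). A pair with nonzero contribution determines i and k, and
the coefficient times all multiplicities is always n! m! (`sum_sorted_pairs`). -/

instance (n : ℕ) : SigmaFinite (leb n) := by
  unfold leb; infer_instance

/-! ### The law of the jump times on path space -/

/-- The uniform distribution on the box `[2k, 2k+2]`, the law of the jump time of index `k`. -/
def boxLaw (k : ℕ) : Measure ℝ :=
  (2 : ℝ≥0∞)⁻¹ • (volume : Measure ℝ).restrict (Set.Icc (2 * (k : ℝ)) (2 * (k : ℝ) + 2))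

instance (k : ℕ) : IsProbabilityMeasure (boxLaw k) := by
  constructor
  rw [boxLaw, Measure.smul_apply, Measure.restrict_apply_univ, Real.volume_Icc]
  have : 2 * (k : ℝ) + 2 - 2 * k = 2 := by ring
  rw [this, smul_eq_mul, ENNReal.ofReal_ofNat]
  exact ENNReal.inv_mul_cancel (by norm_num) (by norm_num)

/-- The law of the sequence of all jump times. -/
def pathLaw : Measure (ℕ → ℝ) := Measure.infinitePi boxLaw

instance : IsProbabilityMeasure pathLaw := by
  unfold pathLaw; infer_instance

lemma two_smul_boxLaw (k : ℕ) :
    (2 : ℝ≥0∞) • boxLaw k =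
      (volume : Measure ℝ).restrict (Set.Icc (2 * (k : ℝ)) (2 * (k : ℝ) + 2)) := by
  rw [boxLaw, smul_smul, ENNReal.mul_inv_cancel (by norm_num) (by norm_num), one_smul]

lemma map_jumpTime {Ω : Type*} [MeasurableSpace Ω] {P : Measure Ω}
    {U : ℕ → Ω → ℝ} (hU : IsIIDUniform P U) (k : ℕ) : P.map (jumpTime U k) = boxLaw k := by
  have h1 : jumpTime U k = (fun x : ℝ => (2 * (k : ℝ) + 1) + x) ∘ U k := rfl
  have hu : P.map (U k) = ProbabilityTheory.cond volume (Set.Icc (-1 : ℝ) 1) := hU.uniform k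
  rw [h1, ← Measure.map_map (by fun_prop) (hU.measurable k), hu, ProbabilityTheory.cond,
    Measure.map_smul, boxLaw]
  have h2 : (volume : Measure ℝ) (Set.Icc (-1) 1) = 2 := by
    rw [Real.volume_Icc]; norm_num
  have h3 : (fun x : ℝ => (2 * (k : ℝ) + 1) + x) ⁻¹' (Set.Icc (2 * (k : ℝ)) (2 * (k : ℝ) + 2)) =
      Set.Icc (-1) 1 := by
    ext x
    simp only [Set.mem_preimage, Set.mem_Icc]
    constructor <;> rintro ⟨h, h'⟩ <;> constructor <;> linarith
  rw [h2, ← h3]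
  congr 1
  exact ((measurePreserving_add_left volume (2 * (k : ℝ) + 1)).restrict_preimage
    measurableSet_Icc).map_eq

lemma measurePreserving_jumpTime {Ω : Type*} [MeasurableSpace Ω] {P : Measure Ω}
    [IsProbabilityMeasure P]
    {U : ℕ → Ω → ℝ} (hU : IsIIDUniform P U) :
    MeasurePreserving (fun ω k => jumpTime U k ω) P pathLaw := by
  have hm : ∀ k, Measurable (jumpTime U k) := fun k => by
    unfold jumpTime; exact (hU.measurable k).const_add _
  refine ⟨measurable_pi_iff.2 hm, ?_⟩
  have hi : iIndepFun (jumpTime U) P :=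
    hU.indep.comp (fun k x => 2 * (k : ℝ) + 1 + x) (fun k => by fun_prop)
  rw [(iIndepFun_iff_map_fun_eq_infinitePi_map hm).1 hi, pathLaw]
  simp_rw [map_jumpTime hU]

/-- Resampling the coordinates in a finite set does not change the law. -/
lemma measurePreserving_piecewise (A : Finset ℕ) :
    MeasurePreserving (fun p : (ℕ → ℝ) × (ℕ → ℝ) => A.piecewise p.2 p.1)
      (pathLaw.prod pathLaw) pathLaw := by
  have hm : Measurable (fun p : (ℕ → ℝ) × (ℕ → ℝ) => A.piecewise p.2 p.1) := by
    refine measurable_pi_iff.2 fun k => ?_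
    by_cases hk : k ∈ A
    · simp only [Finset.piecewise, hk, if_true]; fun_prop
    · simp only [Finset.piecewise, hk, if_false]; fun_prop
  refine ⟨hm, Measure.eq_infinitePi _ fun s t ht => ?_⟩
  have hms : ∀ u : Finset ℕ, MeasurableSet (Set.pi (u : Set ℕ) t) := fun u =>
    MeasurableSet.pi u.countable_toSet fun i _ => ht i
  rw [Measure.map_apply hm (hms s)]
  -- A cylinder constrains the old path on `s \ A` and the fresh one on `s ∩ A`.
  have : (fun p : (ℕ → ℝ) × (ℕ → ℝ) => A.piecewise p.2 p.1) ⁻¹' (Set.pi (s : Set ℕ) t) =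
      (Set.pi ((s \ A : Finset ℕ) : Set ℕ) t) ×ˢ (Set.pi ((s ∩ A : Finset ℕ) : Set ℕ) t) := by
    ext ⟨x, y⟩
    simp only [Set.mem_preimage, Set.mem_pi, Set.mem_prod, Finset.coe_sdiff, Set.mem_sdiff,
      Finset.mem_coe, Finset.coe_inter, Set.mem_inter_iff, Finset.piecewise]
    constructor
    · intro h
      refine ⟨fun i hi => ?_, fun i hi => ?_⟩
      · simpa [hi.2] using h i hi.1
      · simpa [hi.2] using h i hi.1
    · rintro ⟨h1, h2⟩ i hi
      by_cases hA : i ∈ A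
      · simpa [hA] using h2 i ⟨hi, hA⟩
      · simpa [hA] using h1 i ⟨hi, hA⟩
  rw [this, Measure.prod_prod, pathLaw, Measure.infinitePi_pi _ fun i _ => ht i,
    Measure.infinitePi_pi _ fun i _ => ht i, mul_comm, Finset.prod_inter_mul_prod_sdiff]

lemma measurePreserving_comp {n : ℕ} {κ : Fin n → ℕ} (hκ : Function.Injective κ) :
    MeasurePreserving (fun (x : ℕ → ℝ) (j : Fin n) => x (κ j)) pathLaw
      (Measure.pi fun j => boxLaw (κ j)) := by
  refine ⟨by fun_prop, ?_⟩
  rw [pathLaw, Measure.map_infinitePi_infinitePi_of_inj hκ, Measure.infinitePi_eq_pi]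

/-! ### Mixed variables, and Lebesgue measure as a sum over boxes -/

/-- A path combined with finitely many extra variables. -/
def mix {n i : ℕ} (e : Fin n → Fin i ⊕ ℕ) (z : Fin i → ℝ) (x : ℕ → ℝ) (j : Fin n) : ℝ :=
  Sum.elim z x (e j)

/-- The indices of the boxes occupied by `mix e z x` for `z` in the box with index `ζ`. -/
def mixIdx {n i : ℕ} (e : Fin n → Fin i ⊕ ℕ) (ζ : Fin i → ℕ) (j : Fin n) : ℕ :=
  Sum.elim ζ id (e j)

lemma measurable_mix {n i : ℕ} (e : Fin n → Fin i ⊕ ℕ) :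
    Measurable (fun p : (Fin i → ℝ) × (ℕ → ℝ) => mix e p.1 p.2) := by
  refine measurable_pi_iff.2 fun j => ?_
  unfold mix
  rcases e j with a | b
  · simp only [Sum.elim_inl]; fun_prop
  · simp only [Sum.elim_inr]; fun_prop

/-- The extra variables and the path together form one independent family indexed by `Fin i ⊕ ℕ`; an
injective `e` selects distinct members of it. -/
lemma measurePreserving_mix {n i : ℕ} {e : Fin n → Fin i ⊕ ℕ} (he : Function.Injective e)
    (ζ : Fin i → ℕ) :
    MeasurePreserving (fun p : (Fin i → ℝ) × (ℕ → ℝ) => mix e p.1 p.2)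
      ((Measure.pi fun a => boxLaw (ζ a)).prod pathLaw)
      (Measure.pi fun j => boxLaw (mixIdx e ζ j)) := by
  set ν : Fin i ⊕ ℕ → Measure ℝ := fun c => boxLaw (Sum.elim ζ id c) with hν
  have hm : Measurable (fun (p : (Fin i → ℝ) × (ℕ → ℝ)) (c : Fin i ⊕ ℕ) =>
      Sum.elim p.1 p.2 c) := by
    refine measurable_pi_iff.2 fun c => ?_
    rcases c with a | b
    · simp only [Sum.elim_inl]; fun_prop
    · simp only [Sum.elim_inr]; fun_prop
  have key : ((Measure.pi fun a => boxLaw (ζ a)).prod pathLaw).map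
      (fun p c => Sum.elim p.1 p.2 c) = Measure.infinitePi ν := by
    refine Measure.eq_infinitePi _ fun s t ht => ?_
    rw [Measure.map_apply hm (MeasurableSet.pi s.countable_toSet fun i _ => ht i)]
    have : (fun (p : (Fin i → ℝ) × (ℕ → ℝ)) (c : Fin i ⊕ ℕ) => Sum.elim p.1 p.2 c) ⁻¹'
        (Set.pi (s : Set (Fin i ⊕ ℕ)) t) =
        (Set.pi (s.toLeft : Set (Fin i)) fun a => t (Sum.inl a)) ×ˢ
          (Set.pi (s.toRight : Set ℕ) fun b => t (Sum.inr b)) := by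
      ext ⟨x, y⟩
      simp [Set.mem_pi]
    rw [this, Measure.prod_prod, ← Measure.infinitePi_eq_pi, pathLaw,
      Measure.infinitePi_pi _ fun i _ => ht _, Measure.infinitePi_pi _ fun i _ => ht _]
    conv_rhs => rw [← Finset.toLeft_disjSum_toRight (u := s), Finset.prod_disjSum]
    rfl
  refine ⟨measurable_mix e, ?_⟩
  have h2 : (fun p : (Fin i → ℝ) × (ℕ → ℝ) => mix e p.1 p.2) =
      (fun (x : Fin i ⊕ ℕ → ℝ) (j : Fin n) => x (e j)) ∘
        (fun (p : (Fin i → ℝ) × (ℕ → ℝ)) (c : Fin i ⊕ ℕ) => Sum.elim p.1 p.2 c) := rfl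
  rw [h2, ← Measure.map_map (by fun_prop) hm, key, Measure.map_infinitePi_infinitePi_of_inj he,
    Measure.infinitePi_eq_pi]
  rfl

/-- Neighbouring closed boxes meet only at even points. Away from these, the box containing a point
is unique. -/
lemma ae_leb_nonneg_not_even (n : ℕ) :
    ∀ᵐ x ∂leb n, ∀ j, 0 ≤ x j ∧ ∀ k : ℕ, x j ≠ 2 * (k : ℝ) := by
  rw [ae_all_iff]
  intro j
  have h : ∀ᵐ t ∂((volume : Measure ℝ).restrict (Set.Ici 0)),
      0 ≤ t ∧ ∀ k : ℕ, t ≠ 2 * (k : ℝ) := by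
    refine (ae_restrict_mem measurableSet_Ici).and (ae_all_iff.2 fun k => ?_)
    exact ae_restrict_of_ae (Measure.ae_ne volume _)
  exact (Measure.tendsto_eval_ae_ae (μ := fun _ : Fin n =>
    (volume : Measure ℝ).restrict (Set.Ici 0)) (i := j)).eventually h

/-- The half-open boxes tile the orthant, and each side of length 2 contributes a factor 2 relative
to the uniform law. -/
lemma leb_eq_sum (n : ℕ) :
    leb n = Measure.sum fun κ : Fin n → ℕ =>
      (2 ^ n : ℝ≥0∞) • Measure.pi fun j => boxLaw (κ j) := by
  set B : (Fin n → ℕ) → Set (Fin n → ℝ) := fun κ =>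
    Set.pi Set.univ fun j => Set.Ico (2 * (κ j : ℝ)) (2 * (κ j : ℝ) + 2) with hB
  have hBm : ∀ κ, MeasurableSet (B κ) := fun κ =>
    MeasurableSet.univ_pi fun j => measurableSet_Ico
  have hdisj : Pairwise (Function.onFun Disjoint B) := by
    intro κ κ' hne
    rw [Function.onFun, Set.disjoint_left]
    intro x hx hx'
    refine hne (funext fun j => ?_)
    have h1 := hx j trivial
    have h2 := hx' j trivial
    simp only [Set.mem_Ico] at h1 h2
    have h3 : (κ j : ℝ) < κ' j + 1 := by linarith
    have h4 : (κ' j : ℝ) < κ j + 1 := by linarith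
    norm_cast at h3 h4
    omega
  have hcover : ∀ᵐ x ∂leb n, x ∈ ⋃ κ, B κ := by
    filter_upwards [ae_leb_nonneg_not_even n] with x hx
    refine Set.mem_iUnion.2 ⟨fun j => ⌊x j / 2⌋₊, fun j _ => ?_⟩
    have h0 : 0 ≤ x j / 2 := by have := (hx j).1; positivity
    have h1 := Nat.floor_le h0
    have h2 := Nat.lt_floor_add_one (x j / 2)
    simp only [Set.mem_Ico]
    constructor <;> linarith
  rw [← Measure.restrict_eq_self_of_ae_mem hcover, Measure.restrict_iUnion hdisj hBm]
  congr 1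
  funext κ
  rw [leb, hB, Measure.restrict_pi_pi]
  symm
  have hbox : ∀ k : ℕ, ((volume : Measure ℝ).restrict (Set.Ici 0)).restrict
      (Set.Ico (2 * (k : ℝ)) (2 * (k : ℝ) + 2)) = (2 : ℝ≥0∞) • boxLaw k := by
    intro k
    rw [two_smul_boxLaw, Measure.restrict_restrict measurableSet_Ico,
      Set.inter_eq_left.2, restrict_Ico_eq_restrict_Icc]
    intro t ht
    have := ht.1
    have hk : (0 : ℝ) ≤ k := Nat.cast_nonneg k
    simp only [Set.mem_Ici]; linarith
  have : ∀ k, SigmaFinite ((2 : ℝ≥0∞) • boxLaw k) := fun k => by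
    rw [two_smul_boxLaw]; infer_instance
  simp only [hbox]
  symm
  refine Measure.pi_eq fun s _ => ?_
  rw [Measure.smul_apply, Measure.pi_pi]
  simp [Finset.prod_mul_distrib]

/-- One summand of `leb_eq_sum`, with its factor 2ⁿ ≥ 1 dropped. It carries almost sure properties
and integrability from Lebesgue measure over to paths. -/
lemma pi_boxLaw_le_leb {n : ℕ} (κ : Fin n → ℕ) :
    (Measure.pi fun j => boxLaw (κ j)) ≤ leb n := by
  rw [leb_eq_sum]
  refine le_trans ?_ (Measure.le_sum _ κ)
  intro s
  rw [Measure.smul_apply, smul_eq_mul]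
  exact le_mul_of_one_le_left zero_le (one_le_pow₀ (by norm_num))

/-- Mixing Lebesgue variables with the coordinates of a path yields a measure dominated by
Lebesgue measure. -/
lemma map_mix_le_leb {n i : ℕ} {e : Fin n → Fin i ⊕ ℕ} (he : Function.Injective e)
    (hl : ∀ a, ∃ j, e j = Sum.inl a) :
    ((leb i).prod pathLaw).map (fun p => mix e p.1 p.2) ≤ leb n := by
  have hin : i ≤ n := by
    choose c hc using hl
    have : Function.Injective c := fun a b hab => by
      have h1 := hc a; rw [hab, hc b] at h1; exact (Sum.inl_injective h1).symm
    simpa using Fintype.card_le_of_injective c this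
  rw [leb_eq_sum i, Measure.prod_sum_left, Measure.map_sum (measurable_mix e).aemeasurable]
  have h1 : ∀ ζ : Fin i → ℕ,
      (((2 ^ i : ℝ≥0∞) • Measure.pi fun j => boxLaw (ζ j)).prod pathLaw).map
        (fun p => mix e p.1 p.2) ≤ (2 ^ n : ℝ≥0∞) • Measure.pi fun j => boxLaw (mixIdx e ζ j) := by
    intro ζ
    rw [Measure.prod_smul_left, Measure.map_smul, (measurePreserving_mix he ζ).map_eq]
    intro s
    simp only [Measure.smul_apply, smul_eq_mul]
    gcongr
    norm_num
  -- Every extra variable occurs among the mixed ones, so different boxes `ζ` land in different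
  -- boxes and the image is bounded by a subfamily of the sum for `leb n`.
  have hinj : Function.Injective (mixIdx e : (Fin i → ℕ) → (Fin n → ℕ)) := by
    intro ζ ζ' h
    funext a
    obtain ⟨j, hj⟩ := hl a
    have := congrFun h j
    simpa [mixIdx, hj] using this
  rw [leb_eq_sum n]
  refine Measure.le_iff.2 fun s hs => ?_
  rw [Measure.sum_apply _ hs, Measure.sum_apply _ hs]
  calc _ ≤ ∑' ζ, ((2 ^ n : ℝ≥0∞) • Measure.pi fun j => boxLaw (mixIdx e ζ j)) s :=
        ENNReal.tsum_le_tsum fun ζ => h1 ζ s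
    _ ≤ _ := ENNReal.tsum_comp_le_tsum_of_injective hinj
        (fun κ => ((2 ^ n : ℝ≥0∞) • Measure.pi fun j => boxLaw (κ j)) s)

lemma MemLp.comp_mix {n i : ℕ} {e : Fin n → Fin i ⊕ ℕ} (he : Function.Injective e)
    (hl : ∀ a, ∃ j, e j = Sum.inl a) {h : (Fin n → ℝ) → ℝ} {p : ℝ≥0∞} (hh : MemLp h p (leb n)) :
    MemLp (fun q : (Fin i → ℝ) × (ℕ → ℝ) => h (mix e q.1 q.2)) p ((leb i).prod pathLaw) :=
  (hh.mono_measure (map_mix_le_leb he hl)).comp_of_map (measurable_mix e).aemeasurable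

/-! ### Resampling and centring -/

/-- The conditional expectation of `F` given the coordinates outside of `A`. -/
def resample (A : Finset ℕ) (F : (ℕ → ℝ) → ℝ) (x : ℕ → ℝ) : ℝ :=
  ∫ y, F (A.piecewise y x) ∂pathLaw

/-- The conditional expectation of `F` given the coordinates other than `k` vanishes. -/
def IsCentered (k : ℕ) (F : (ℕ → ℝ) → ℝ) : Prop := resample {k} F =ᵐ[pathLaw] 0

/-- The part of `F` that is centered with respect to all the coordinates in `B`. -/
def centerPart (B : Finset ℕ) (F : (ℕ → ℝ) → ℝ) (x : ℕ → ℝ) : ℝ :=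
  ∑ A ∈ B.powerset, (-1 : ℝ) ^ A.card * resample A F x

lemma ae_ae_piecewise {p : (ℕ → ℝ) → Prop} (h : ∀ᵐ x ∂pathLaw, p x) (A : Finset ℕ) :
    ∀ᵐ x ∂pathLaw, ∀ᵐ y ∂pathLaw, p (A.piecewise y x) :=
  Measure.ae_ae_of_ae_prod ((measurePreserving_piecewise A).quasiMeasurePreserving.ae h)

lemma resample_congr {F G : (ℕ → ℝ) → ℝ} (h : F =ᵐ[pathLaw] G) (A : Finset ℕ) :
    resample A F =ᵐ[pathLaw] resample A G := by
  filter_upwards [ae_ae_piecewise h A] with x hx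
  exact integral_congr_ae hx

lemma resample_empty (F : (ℕ → ℝ) → ℝ) : resample ∅ F = F := by
  funext x; simp [resample]

lemma integrable_piecewise {F : (ℕ → ℝ) → ℝ} (hF : Integrable F pathLaw) (A : Finset ℕ) :
    Integrable (fun p : (ℕ → ℝ) × (ℕ → ℝ) => F (A.piecewise p.2 p.1))
      (pathLaw.prod pathLaw) :=
  (measurePreserving_piecewise A).integrable_comp_of_integrable hF

lemma ae_integrable_piecewise {F : (ℕ → ℝ) → ℝ} (hF : Integrable F pathLaw) (A : Finset ℕ) :
    ∀ᵐ x ∂pathLaw, Integrable (fun y => F (A.piecewise y x)) pathLaw :=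
  (integrable_piecewise hF A).prod_right_ae

lemma integral_piecewise {F : (ℕ → ℝ) → ℝ} (hF : Integrable F pathLaw) (A : Finset ℕ) :
    ∫ p, F (A.piecewise p.2 p.1) ∂(pathLaw.prod pathLaw) = ∫ x, F x ∂pathLaw := by
  have h := measurePreserving_piecewise A
  conv_rhs => rw [← h.map_eq]
  rw [integral_map h.measurable.aemeasurable]
  rw [h.map_eq]; exact hF.1

lemma integral_resample {F : (ℕ → ℝ) → ℝ} (hF : Integrable F pathLaw) (A : Finset ℕ) :
    ∫ x, resample A F x ∂pathLaw = ∫ x, F x ∂pathLaw := by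
  rw [← integral_piecewise hF A, integral_prod _ (integrable_piecewise hF A)]
  rfl

lemma integrable_resample {F : (ℕ → ℝ) → ℝ} (hF : Integrable F pathLaw) (A : Finset ℕ) :
    Integrable (resample A F) pathLaw :=
  (integrable_piecewise hF A).integral_prod_left

lemma resample_sub {F G : (ℕ → ℝ) → ℝ} (hF : Integrable F pathLaw) (hG : Integrable G pathLaw)
    (A : Finset ℕ) : resample A (F - G) =ᵐ[pathLaw] resample A F - resample A G := by
  filter_upwards [ae_integrable_piecewise hF A, ae_integrable_piecewise hG A] with x h1 h2
  exact integral_sub h1 h2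

/-- For fixed `x`, integrating over a path equals integrating over a path resampled on `B`. Applied
to the function of fresh values on `A ∪ B`, this yields the iterated integral. -/
lemma resample_resample {F : (ℕ → ℝ) → ℝ} (hF : Integrable F pathLaw) (A B : Finset ℕ) :
    resample A (resample B F) =ᵐ[pathLaw] resample (A ∪ B) F := by
  filter_upwards [ae_integrable_piecewise hF (A ∪ B)] with x hx
  have h1 : resample (A ∪ B) F x =
      ∫ y, resample B (fun w => F ((A ∪ B).piecewise w x)) y ∂pathLaw :=
    (integral_resample hx B).symm
  rw [h1]
  unfold resample
  refine integral_congr_ae (Eventually.of_forall fun y => ?_)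
  refine integral_congr_ae (Eventually.of_forall fun z => ?_)
  simp only
  congr 1
  funext k
  by_cases hA : k ∈ A <;> by_cases hB : k ∈ B <;> simp [Finset.piecewise, hA, hB]

/-- As `k ∈ A`, resampling `k` first does not change the result of resampling `A`, and it already
gives 0. -/
lemma resample_eq_zero {F : (ℕ → ℝ) → ℝ} (hF : Integrable F pathLaw) {k : ℕ}
    (hk : IsCentered k F) {A : Finset ℕ} (hA : k ∈ A) : resample A F =ᵐ[pathLaw] 0 := by
  have h1 := resample_resample hF A {k}
  have h2 : A ∪ {k} = A := by simpa using hA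
  rw [h2] at h1
  refine h1.symm.trans ((resample_congr hk A).trans ?_)
  refine Eventually.of_forall fun x => ?_
  simp [resample]

lemma dependsOn_resample_compl (F : (ℕ → ℝ) → ℝ) (A : Finset ℕ) :
    DependsOn (resample A F) (A : Set ℕ)ᶜ := by
  intro x x' h
  unfold resample
  congr 1
  funext y
  congr 1
  funext k
  by_cases hA : k ∈ A
  · simp [Finset.piecewise, hA]
  · simp only [Finset.piecewise, hA, if_false]; exact h k hA

lemma dependsOn_resample {F : (ℕ → ℝ) → ℝ} {C : Set ℕ} (hF : DependsOn F C) (A : Finset ℕ) :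
    DependsOn (resample A F) C := by
  intro x x' h
  unfold resample
  congr 1
  funext y
  refine hF fun k hk => ?_
  by_cases hA : k ∈ A
  · simp [Finset.piecewise, hA]
  · simp only [Finset.piecewise, hA, if_false]; exact h k hk

lemma dependsOn_centerPart {F : (ℕ → ℝ) → ℝ} {C : Set ℕ} (hF : DependsOn F C) (B : Finset ℕ) :
    DependsOn (centerPart B F) C := by
  intro x x' h
  unfold centerPart
  exact Finset.sum_congr rfl fun A _ => by rw [dependsOn_resample hF A h]

lemma dependsOn_mul {F G : (ℕ → ℝ) → ℝ} {C : Set ℕ} (hF : DependsOn F C) (hG : DependsOn G C) :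
    DependsOn (F * G) C := by
  intro x x' h
  simp only [Pi.mul_apply, hF h, hG h]

lemma integrable_centerPart {F : (ℕ → ℝ) → ℝ} (hF : Integrable F pathLaw) (B : Finset ℕ) :
    Integrable (centerPart B F) pathLaw := by
  unfold centerPart
  exact integrable_finsetSum _ fun A _ => (integrable_resample hF A).const_mul _

lemma centerPart_sub {F G : (ℕ → ℝ) → ℝ} (hF : Integrable F pathLaw) (hG : Integrable G pathLaw)
    (B : Finset ℕ) : centerPart B (F - G) =ᵐ[pathLaw] centerPart B F - centerPart B G := by
  have : ∀ᵐ x ∂pathLaw, ∀ A : Finset ℕ,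
      resample A (F - G) x = (resample A F - resample A G) x :=
    ae_all_iff.2 fun A => resample_sub hF hG A
  filter_upwards [this] with x hx
  simp only [centerPart, Pi.sub_apply, ← Finset.sum_sub_distrib, ← mul_sub, hx]

/-- Resampling `k` makes the terms of `A` and `insert k A` equal up to the sign, so they cancel in
pairs. -/
lemma isCentered_centerPart {F : (ℕ → ℝ) → ℝ} (hF : Integrable F pathLaw) {k : ℕ}
    {B : Finset ℕ} (hk : k ∈ B) : IsCentered k (centerPart B F) := by
  have h1 : ∀ᵐ x ∂pathLaw, ∀ A : Finset ℕ, resample {k} (resample A F) x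
      = resample ({k} ∪ A) F x := ae_all_iff.2 fun A => resample_resample hF {k} A
  have h2 : ∀ᵐ x ∂pathLaw, ∀ A : Finset ℕ,
      Integrable (fun y => resample A F (({k} : Finset ℕ).piecewise y x)) pathLaw :=
    ae_all_iff.2 fun A => ae_integrable_piecewise (integrable_resample hF A) {k}
  filter_upwards [h1, h2] with x hx1 hx2
  have h3 : resample {k} (centerPart B F) x =
      ∑ A ∈ B.powerset, (-1 : ℝ) ^ A.card * resample {k} (resample A F) x := by
    have e : resample {k} (centerPart B F) x = ∫ y, ∑ A ∈ B.powerset,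
        (-1 : ℝ) ^ A.card * resample A F (({k} : Finset ℕ).piecewise y x) ∂pathLaw := rfl
    rw [e, integral_finsetSum _ fun A _ => (hx2 A).const_mul _]
    refine Finset.sum_congr rfl fun A _ => ?_
    rw [integral_const_mul]
    rfl
  rw [h3]
  obtain ⟨C, hkC, rfl⟩ : ∃ C, k ∉ C ∧ insert k C = B :=
    ⟨B.erase k, Finset.notMem_erase _ _, Finset.insert_erase hk⟩
  rw [Finset.sum_powerset_insert hkC, ← Finset.sum_add_distrib]
  refine Finset.sum_eq_zero fun A hA => ?_
  have hkA : k ∉ A := fun h => hkC (Finset.mem_powerset.1 hA h)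
  rw [hx1, hx1, Finset.card_insert_of_notMem hkA]
  have : ({k} : Finset ℕ) ∪ insert k A = {k} ∪ A := by
    ext j; simp
  rw [this]; ring

/-- If `F` is centered with respect to all the coordinates in `B`, it is its own centered part. -/
lemma centerPart_eq_self {F : (ℕ → ℝ) → ℝ} (hF : Integrable F pathLaw) {B : Finset ℕ}
    (h : ∀ k ∈ B, IsCentered k F) : centerPart B F =ᵐ[pathLaw] F := by
  have h1 : ∀ᵐ x ∂pathLaw, ∀ A : Finset ℕ, A ∈ B.powerset → A ≠ ∅ → resample A F x = 0 := by
    refine ae_all_iff.2 fun A => ?_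
    by_cases hA : A ∈ B.powerset
    · by_cases hA' : A = ∅
      · exact Eventually.of_forall fun _ _ h => absurd hA' h
      · obtain ⟨k, hk⟩ := Finset.nonempty_iff_ne_empty.2 hA'
        filter_upwards [resample_eq_zero hF (h k (Finset.mem_powerset.1 hA hk)) hk] with x hx
        exact fun _ _ => hx
    · exact Eventually.of_forall fun _ h => absurd h hA
  filter_upwards [h1] with x hx
  unfold centerPart
  rw [Finset.sum_eq_single ∅]
  · simp [resample_empty]
  · intro A hA hne
    rw [hx A hA hne, mul_zero]
  · simp

/-- A variable centered with respect to `k` is orthogonal to those not depending on `k`. -/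
lemma integral_mul_eq_zero {F W : (ℕ → ℝ) → ℝ} {k : ℕ} (hF : IsCentered k F)
    (hW : DependsOn W {k}ᶜ) (hi : Integrable (F * W) pathLaw) : ∫ x, F x * W x ∂pathLaw = 0 := by
  have h1 := integral_resample hi {k}
  simp only [Pi.mul_apply] at h1
  rw [← h1]
  refine integral_eq_zero_of_ae ?_
  filter_upwards [hF] with x hx
  have h2 : resample {k} (F * W) x = resample {k} F x * W x := by
    unfold resample
    rw [← integral_mul_const]
    refine integral_congr_ae (Eventually.of_forall fun y => ?_)
    simp only [Pi.mul_apply]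
    congr 1
    refine hW fun j hj => ?_
    have : j ≠ k := by simpa using hj
    simp [Finset.piecewise, this]
  rw [h2, hx]
  simp

lemma enorm_integral_sq_le {α : Type*} [MeasurableSpace α] {μ : Measure α}
    [IsProbabilityMeasure μ] {g : α → ℝ} (hg : AEStronglyMeasurable g μ) :
    ‖∫ x, g x ∂μ‖ₑ ^ (2 : ℝ) ≤ ∫⁻ x, ‖g x‖ₑ ^ (2 : ℝ) ∂μ := by
  have h1 : ‖∫ x, g x ∂μ‖ₑ ≤ eLpNorm g 1 μ := by
    rw [eLpNorm_one_eq_lintegral_enorm]; exact enorm_integral_le_lintegral_enorm g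
  have h2 : eLpNorm g 1 μ ≤ eLpNorm g 2 μ :=
    eLpNorm_le_eLpNorm_of_exponent_le (by norm_num) hg
  have h3 := eLpNorm_nnreal_pow_eq_lintegral (f := g) (μ := μ) (p := 2) (by norm_num)
  simp only [NNReal.coe_ofNat] at h3
  rw [← h3]
  exact ENNReal.rpow_le_rpow (h1.trans h2) (by norm_num)

/-- Conditional expectation contracts L²: Jensen in the fresh path, then invariance of the law under
resampling. -/
lemma eLpNorm_resample_le {F : (ℕ → ℝ) → ℝ} (hF : AEStronglyMeasurable F pathLaw)
    (A : Finset ℕ) : eLpNorm (resample A F) 2 pathLaw ≤ eLpNorm F 2 pathLaw := by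
  have h := measurePreserving_piecewise A
  rw [← ENNReal.rpow_le_rpow_iff (z := 2) (by norm_num)]
  have e1 := eLpNorm_nnreal_pow_eq_lintegral (f := resample A F) (μ := pathLaw) (p := 2)
    (by norm_num)
  have e2 := eLpNorm_nnreal_pow_eq_lintegral (f := F) (μ := pathLaw) (p := 2) (by norm_num)
  simp only [NNReal.coe_ofNat, ENNReal.coe_ofNat] at e1 e2
  rw [e1, e2]
  have hc : AEStronglyMeasurable (fun p : (ℕ → ℝ) × (ℕ → ℝ) => F (A.piecewise p.2 p.1))
      (pathLaw.prod pathLaw) := hF.comp_measurePreserving h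
  have hF2 : AEMeasurable (fun x => ‖F x‖ₑ ^ (2 : ℝ)) pathLaw := hF.enorm.pow_const _
  calc ∫⁻ x, ‖resample A F x‖ₑ ^ (2 : ℝ) ∂pathLaw
      ≤ ∫⁻ x, ∫⁻ y, ‖F (A.piecewise y x)‖ₑ ^ (2 : ℝ) ∂pathLaw ∂pathLaw := by
        refine lintegral_mono_ae ?_
        filter_upwards [hc.prodMk_left] with x hx
        exact enorm_integral_sq_le hx
    _ = ∫⁻ p, ‖F (A.piecewise p.2 p.1)‖ₑ ^ (2 : ℝ) ∂(pathLaw.prod pathLaw) :=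
        (lintegral_prod _ (hc.enorm.pow_const _)).symm
    _ = ∫⁻ x, ‖F x‖ₑ ^ (2 : ℝ) ∂pathLaw := by
        conv_rhs => rw [← h.map_eq]
        rw [lintegral_map' (by rw [h.map_eq]; exact hF2) h.measurable.aemeasurable]

lemma memLp_resample {F : (ℕ → ℝ) → ℝ} (hF : MemLp F 2 pathLaw) (A : Finset ℕ) :
    MemLp (resample A F) 2 pathLaw :=
  ⟨(integrable_resample (hF.integrable (by norm_num)) A).1,
    (eLpNorm_resample_le hF.1 A).trans_lt hF.2⟩

lemma memLp_centerPart {F : (ℕ → ℝ) → ℝ} (hF : MemLp F 2 pathLaw) (B : Finset ℕ) :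
    MemLp (centerPart B F) 2 pathLaw := by
  unfold centerPart
  exact memLp_finsetSum _ fun A _ => (memLp_resample hF A).const_mul _

lemma eLpNorm_centerPart_le {F : (ℕ → ℝ) → ℝ} (hF : MemLp F 2 pathLaw) (B : Finset ℕ) :
    eLpNorm (centerPart B F) 2 pathLaw ≤ 2 ^ B.card * eLpNorm F 2 pathLaw := by
  have h0 : centerPart B F = ∑ A ∈ B.powerset, fun x => (-1 : ℝ) ^ A.card * resample A F x := by
    funext x; simp [centerPart]
  rw [h0]
  refine (eLpNorm_sum_le (fun A _ => ((memLp_resample hF A).const_mul _).1) (by norm_num)).trans ?_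
  calc _ ≤ ∑ A ∈ B.powerset, eLpNorm F 2 pathLaw := by
        refine Finset.sum_le_sum fun A _ => ?_
        have : (fun x => (-1 : ℝ) ^ A.card * resample A F x) =
            ((-1 : ℝ) ^ A.card) • resample A F := rfl
        rw [this, eLpNorm_const_smul]
        simpa using eLpNorm_resample_le hF.1 A
    _ = _ := by simp

lemma lintegral_enorm_resample_le {F : (ℕ → ℝ) → ℝ} (hF : AEStronglyMeasurable F pathLaw)
    (A : Finset ℕ) : ∫⁻ x, ‖resample A F x‖ₑ ∂pathLaw ≤ ∫⁻ x, ‖F x‖ₑ ∂pathLaw := by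
  have h := measurePreserving_piecewise A
  have hc : AEStronglyMeasurable (fun p : (ℕ → ℝ) × (ℕ → ℝ) => F (A.piecewise p.2 p.1))
      (pathLaw.prod pathLaw) := hF.comp_measurePreserving h
  calc ∫⁻ x, ‖resample A F x‖ₑ ∂pathLaw
      ≤ ∫⁻ x, ∫⁻ y, ‖F (A.piecewise y x)‖ₑ ∂pathLaw ∂pathLaw :=
        lintegral_mono fun x => enorm_integral_le_lintegral_enorm _
    _ = ∫⁻ p, ‖F (A.piecewise p.2 p.1)‖ₑ ∂(pathLaw.prod pathLaw) :=
        (lintegral_prod _ hc.enorm).symm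
    _ = ∫⁻ x, ‖F x‖ₑ ∂pathLaw := by
        conv_rhs => rw [← h.map_eq]
        rw [lintegral_map' (by rw [h.map_eq]; exact hF.enorm) h.measurable.aemeasurable]

/-! ### Test functions -/

/-- Bounded functions `ψ k` that are centered under the laws of the jump times. -/
structure IsTest (ψ : ℕ → ℝ → ℝ) : Prop where
  measurable : ∀ k, Measurable (ψ k)
  bounded : ∀ k t, |ψ k t| ≤ 1
  centered : ∀ k, ∫ t, ψ k t ∂boxLaw k = 0

/-- The product of the `ψ k` over `k ∈ S`. -/
def testFn (ψ : ℕ → ℝ → ℝ) (S : Finset ℕ) (x : ℕ → ℝ) : ℝ := ∏ k ∈ S, ψ k (x k)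

lemma dependsOn_testFn (ψ : ℕ → ℝ → ℝ) (S : Finset ℕ) : DependsOn (testFn ψ S) (S : Set ℕ) :=
  fun _ _ h => Finset.prod_congr rfl fun k hk => by rw [h k hk]

lemma IsTest.measurable_testFn {ψ : ℕ → ℝ → ℝ} (hψ : IsTest ψ) (S : Finset ℕ) :
    Measurable (testFn ψ S) :=
  Finset.measurable_prod _ fun k _ => (hψ.measurable k).comp (measurable_pi_apply k)

lemma IsTest.norm_testFn_le {ψ : ℕ → ℝ → ℝ} (hψ : IsTest ψ) (S : Finset ℕ) (x : ℕ → ℝ) :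
    ‖testFn ψ S x‖ ≤ 1 := by
  rw [testFn, Real.norm_eq_abs, Finset.abs_prod]
  exact Finset.prod_le_one (fun _ _ => abs_nonneg _) fun k _ => hψ.bounded k _

lemma IsTest.integrable_mul {ψ : ℕ → ℝ → ℝ} (hψ : IsTest ψ) (S : Finset ℕ) {F : (ℕ → ℝ) → ℝ}
    (hF : Integrable F pathLaw) : Integrable (fun x => F x * testFn ψ S x) pathLaw :=
  hF.mul_bdd (hψ.measurable_testFn S).aestronglyMeasurable
    (Eventually.of_forall (hψ.norm_testFn_le S))

lemma integral_eval_pathLaw {k : ℕ} {u : ℝ → ℝ} (hu : AEStronglyMeasurable u (boxLaw k)) :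
    ∫ x, u (x k) ∂pathLaw = ∫ t, u t ∂boxLaw k := by
  have h := measurePreserving_eval_infinitePi boxLaw k
  conv_rhs => rw [← h.map_eq]
  rw [integral_map h.measurable.aemeasurable (by rw [h.map_eq]; exact hu)]
  rfl

lemma IsTest.isCentered {ψ : ℕ → ℝ → ℝ} (hψ : IsTest ψ) {S : Finset ℕ} {k : ℕ} (hk : k ∈ S) :
    IsCentered k (testFn ψ S) := by
  refine Eventually.of_forall fun x => ?_
  have : ∀ y : ℕ → ℝ, testFn ψ S (({k} : Finset ℕ).piecewise y x) =
      ψ k (y k) * ∏ j ∈ S.erase k, ψ j (x j) := by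
    intro y
    rw [testFn, ← Finset.mul_prod_erase _ _ hk]
    congr 1
    · simp [Finset.piecewise]
    · refine Finset.prod_congr rfl fun j hj => ?_
      have : j ≠ k := Finset.ne_of_mem_erase hj
      simp [Finset.piecewise, this]
  simp only [resample, this, integral_mul_const, Pi.zero_apply]
  rw [integral_eval_pathLaw (hψ.measurable k).aestronglyMeasurable, hψ.centered, zero_mul]

/-- Products of centered functions of the coordinates are total. -/
lemma ae_eq_zero_of_testFn {D : (ℕ → ℝ) → ℝ} (hD : Integrable D pathLaw)
    (h : ∀ ψ, IsTest ψ → ∀ S, ∫ x, D x * testFn ψ S x ∂pathLaw = 0) : D =ᵐ[pathLaw] 0 := by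
  have hcyl : ∀ (S : Finset ℕ) (t : ℕ → Set ℝ), (∀ k, MeasurableSet (t k)) →
      ∫ x in (S : Set ℕ).pi t, D x ∂pathLaw = 0 := by
    intro S t ht
    -- Subtracting from each indicator its probability gives a test family `ψ`. The indicator of the
    -- cylinder is ∏ (ψ + c), which expands into test functions over subsets of `S`.
    set c : ℕ → ℝ := fun k => (boxLaw k).real (t k) with hc
    set ψ : ℕ → ℝ → ℝ := fun k s => (t k).indicator 1 s - c k with hψdef
    have hψ : IsTest ψ := by
      refine ⟨fun k => (measurable_one.indicator (ht k)).sub_const _, fun k s => ?_, fun k => ?_⟩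
      · have h1 : 0 ≤ c k := measureReal_nonneg
        have h2 : c k ≤ 1 := measureReal_le_one
        by_cases hs : s ∈ t k
        · simp only [hψdef, Set.indicator_of_mem hs, Pi.one_apply]
          rw [abs_le]; constructor <;> linarith
        · simp only [hψdef, Set.indicator_of_notMem hs]
          rw [abs_le]; constructor <;> linarith
      · have h1 : Integrable ((t k).indicator (1 : ℝ → ℝ)) (boxLaw k) :=
          (integrable_const (1 : ℝ)).indicator (ht k)
        simp only [hψdef]
        rw [integral_sub h1 (integrable_const _)]
        simp [integral_indicator_one (ht k), hc]
    have h1 : ∀ x : ℕ → ℝ, ((S : Set ℕ).pi t).indicator D x =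
        ∑ T ∈ S.powerset, (D x * testFn ψ T x) * ∏ k ∈ S \ T, c k := by
      intro x
      have e1 : ((S : Set ℕ).pi t).indicator D x = D x * ∏ k ∈ S, (ψ k (x k) + c k) := by
        simp only [hψdef, sub_add_cancel]
        by_cases hx : x ∈ (S : Set ℕ).pi t
        · rw [Set.indicator_of_mem hx, Finset.prod_eq_one, mul_one]
          intro k hk
          rw [Set.indicator_of_mem (hx k hk), Pi.one_apply]
        · rw [Set.indicator_of_notMem hx]
          simp only [Set.mem_pi, not_forall] at hx
          obtain ⟨k, hk, hkt⟩ := hx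
          rw [Finset.prod_eq_zero hk (Set.indicator_of_notMem hkt _), mul_zero]
      rw [e1, Finset.prod_add, Finset.mul_sum]
      exact Finset.sum_congr rfl fun T _ => by rw [testFn, mul_assoc]
    rw [← integral_indicator (MeasurableSet.pi S.countable_toSet fun i _ => ht i)]
    simp_rw [h1]
    rw [integral_finsetSum _ fun T _ => (hψ.integrable_mul T hD).mul_const _]
    refine Finset.sum_eq_zero fun T _ => ?_
    rw [integral_mul_const, h ψ hψ T, zero_mul]
  refine hD.ae_eq_zero_of_forall_setIntegral_eq_zero fun s hs _ => ?_
  induction s, hs using MeasurableSpace.induction_on_inter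
    (generateFrom_squareCylinders (α := fun _ : ℕ => ℝ)).symm
    (isPiSystem_squareCylinders (fun _ => MeasurableSpace.isPiSystem_measurableSet)
      (fun _ => by simp)) with
  | empty => simp
  | basic t ht =>
    obtain ⟨S, u, hu, rfl⟩ := ht
    exact hcyl S u fun k => hu k trivial
  | compl t htm ih =>
    -- The cylinder without constraints is the whole space.
    have h0 : ∫ x, D x ∂pathLaw = 0 := by
      simpa using hcyl ∅ (fun _ => Set.univ) fun _ => MeasurableSet.univ
    have := integral_add_compl htm hD
    rw [h0, ih (measure_lt_top _ _), zero_add] at this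
    exact this
  | iUnion u hd hm ih =>
    rw [integral_iUnion hm hd hD.integrableOn]
    simp [fun i => ih i (measure_lt_top _ _)]

/-! ### Sections of a kernel over sets of boxes -/

/-- The value of `h` at the coordinates in `B`, listed in increasing order. -/
def sect {n : ℕ} (h : (Fin n → ℝ) → ℝ) (B : Finset ℕ) (x : ℕ → ℝ) : ℝ :=
  if hB : B.card = n then h (fun j => x (B.orderEmbOfFin hB j)) else 0

lemma sect_of_card {n : ℕ} (h : (Fin n → ℝ) → ℝ) {B : Finset ℕ} (hB : B.card = n) :
    sect h B = fun x => h (fun j => x (B.orderEmbOfFin hB j)) := by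
  funext x; simp [sect, hB]

lemma sect_of_card_ne {n : ℕ} (h : (Fin n → ℝ) → ℝ) {B : Finset ℕ} (hB : B.card ≠ n) :
    sect h B = 0 := by
  funext x; simp [sect, hB]

lemma sect_sub {n : ℕ} (h h' : (Fin n → ℝ) → ℝ) (B : Finset ℕ) :
    sect (h - h') B = sect h B - sect h' B := by
  funext x
  by_cases hB : B.card = n <;> simp [sect, hB]

lemma dependsOn_sect {n : ℕ} (h : (Fin n → ℝ) → ℝ) (B : Finset ℕ) :
    DependsOn (sect h B) (B : Set ℕ) := by
  intro x x' hx
  unfold sect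
  split_ifs with hB
  · congr 1
    funext j
    exact hx _ (B.orderEmbOfFin_mem hB j)
  · rfl

lemma ae_comp_of_ae_leb {n : ℕ} {p : (Fin n → ℝ) → Prop} (h : ∀ᵐ x ∂leb n, p x)
    {κ : Fin n → ℕ} (hκ : Function.Injective κ) : ∀ᵐ x ∂pathLaw, p (fun j => x (κ j)) :=
  (measurePreserving_comp hκ).quasiMeasurePreserving.ae
    ((Measure.absolutelyContinuous_of_le (pi_boxLaw_le_leb κ)).ae_le h)

/-- The permutation sends `j` to the rank of `κ j` in the image of `κ`. -/
lemma exists_perm_orderEmbOfFin {n : ℕ} {κ : Fin n → ℕ} (hκ : Function.Injective κ) :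
    ∃ (hB : (Finset.univ.image κ).card = n) (σ : Equiv.Perm (Fin n)),
      ∀ j, (Finset.univ.image κ).orderEmbOfFin hB (σ j) = κ j := by
  set B := Finset.univ.image κ with hBdef
  have hB : B.card = n := by
    rw [hBdef, Finset.card_image_of_injective _ hκ, Finset.card_fin]
  have hmem : ∀ j, κ j ∈ B := fun j => Finset.mem_image_of_mem _ (Finset.mem_univ _)
  set σ0 : Fin n → Fin n := fun j => (B.orderIsoOfFin hB).symm ⟨κ j, hmem j⟩ with hσ0
  have hσ : Function.Injective σ0 := by
    intro a b hab
    have := (B.orderIsoOfFin hB).symm.injective hab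
    exact hκ (Subtype.ext_iff.1 this)
  refine ⟨hB, Equiv.ofBijective σ0 (Finite.injective_iff_bijective.1 hσ), fun j => ?_⟩
  have : (B.orderIsoOfFin hB (σ0 j) : ℕ) = κ j := by
    simp [hσ0]
  exact this

/-- By symmetry the order in which distinct coordinates are inserted is irrelevant, so only the set
of indices matters. -/
lemma comp_ae_eq_sect {n : ℕ} {h : (Fin n → ℝ) → ℝ}
    (hs : ∀ σ : Equiv.Perm (Fin n), ∀ᵐ x ∂leb n, h (fun j => x (σ j)) = h x)
    {κ : Fin n → ℕ} (hκ : Function.Injective κ) :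
    (fun x => h (fun j => x (κ j))) =ᵐ[pathLaw] sect h (Finset.univ.image κ) := by
  obtain ⟨hB, σ, hval⟩ := exists_perm_orderEmbOfFin hκ
  filter_upwards [ae_comp_of_ae_leb (hs σ)
    ((Finset.univ.image κ).orderEmbOfFin hB).injective] with x hx
  rw [sect_of_card h hB]
  simp only
  rw [← hx]
  simp only [hval]

lemma memLp_sect {n : ℕ} {h : (Fin n → ℝ) → ℝ} {p : ℝ≥0∞} (hh : MemLp h p (leb n))
    (B : Finset ℕ) : MemLp (sect h B) p pathLaw := by
  by_cases hB : B.card = n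
  · rw [sect_of_card h hB]
    exact (hh.mono_measure (pi_boxLaw_le_leb _)).comp_measurePreserving
      (measurePreserving_comp (B.orderEmbOfFin hB).injective)
  · rw [sect_of_card_ne h hB]; exact MemLp.zero'

/-- Distinct sets of `n` indices have distinct increasing enumerations, hence name different boxes.
The left side is thus part of the decomposition of the right side, without the factor 2ⁿ. -/
lemma tsum_lintegral_sect_le {n : ℕ} {h : (Fin n → ℝ) → ℝ} (hh : AEStronglyMeasurable h (leb n))
    {p : ℝ} (hp : 0 < p) :
    ∑' B : Finset ℕ, ∫⁻ x, ‖sect h B x‖ₑ ^ p ∂pathLaw ≤ ∫⁻ x, ‖h x‖ₑ ^ p ∂leb n := by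
  set S : Set (Finset ℕ) := {B | B.card = n} with hS
  have hsupp : (Function.support fun B : Finset ℕ => ∫⁻ x, ‖sect h B x‖ₑ ^ p ∂pathLaw) ⊆ S := by
    intro B hB
    by_contra hc
    refine hB ?_
    simp only [sect_of_card_ne h hc, Pi.zero_apply, enorm_zero, ENNReal.zero_rpow_of_pos hp,
      lintegral_zero]
  rw [← tsum_subtype_eq_of_support_subset hsupp]
  set en : S → (Fin n → ℕ) := fun B => B.1.orderEmbOfFin B.2 with hen
  have heninj : Function.Injective en := by
    intro B B' hBB
    have h1 : Set.range (B.1.orderEmbOfFin B.2) = Set.range (B'.1.orderEmbOfFin B'.2) := by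
      have : (⇑(B.1.orderEmbOfFin B.2) : Fin n → ℕ) = B'.1.orderEmbOfFin B'.2 := hBB
      rw [this]
    rw [Finset.range_orderEmbOfFin, Finset.range_orderEmbOfFin] at h1
    exact Subtype.ext (Finset.coe_injective h1)
  have hrw : ∫⁻ x, ‖h x‖ₑ ^ p ∂leb n = ∑' κ : Fin n → ℕ,
      ∫⁻ x, ‖h x‖ₑ ^ p ∂((2 ^ n : ℝ≥0∞) • Measure.pi fun j => boxLaw (κ j)) := by
    rw [leb_eq_sum, lintegral_sum_measure]
  rw [hrw]
  refine le_trans (ENNReal.tsum_le_tsum fun B => ?_) (ENNReal.tsum_comp_le_tsum_of_injective heninj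
    fun κ => ∫⁻ x, ‖h x‖ₑ ^ p ∂((2 ^ n : ℝ≥0∞) • Measure.pi fun j => boxLaw (κ j)))
  rw [sect_of_card h B.2]
  have hmp := measurePreserving_comp (B.1.orderEmbOfFin B.2).injective
  have hm : AEMeasurable (fun x => ‖h x‖ₑ ^ p) (Measure.pi fun j => boxLaw (en B j)) :=
    ((hh.mono_measure (pi_boxLaw_le_leb _)).enorm).pow_const _
  rw [lintegral_smul_measure, smul_eq_mul]
  refine le_trans (le_of_eq ?_) (le_mul_of_one_le_left zero_le (one_le_pow₀ (by norm_num)))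
  have : Measure.pi (fun j => boxLaw (en B j)) = pathLaw.map
      (fun (x : ℕ → ℝ) (j : Fin n) => x (B.1.orderEmbOfFin B.2 j)) := hmp.map_eq.symm
  rw [this] at hm ⊢
  rw [lintegral_map' hm hmp.measurable.aemeasurable]

/-! ### Box terms and their convergence in L² -/

/-- The contribution to the multiple integral of the boxes with indices in `B`. -/
def boxTerm {n : ℕ} (h : (Fin n → ℝ) → ℝ) (B : Finset ℕ) : (ℕ → ℝ) → ℝ :=
  centerPart B (sect h B)

/-- The multiple integral over the boxes with indices less than `M`. -/
def partialIntegral {n : ℕ} (M : ℕ) (h : (Fin n → ℝ) → ℝ) (x : ℕ → ℝ) : ℝ :=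
  (n ! : ℝ) * ∑ B ∈ (Finset.range M).powerset, boxTerm h B x

lemma boxTerm_of_card_ne {n : ℕ} (h : (Fin n → ℝ) → ℝ) {B : Finset ℕ} (hB : B.card ≠ n) :
    boxTerm h B = 0 := by
  funext x
  simp [boxTerm, sect_of_card_ne h hB, centerPart, resample]

lemma memLp_boxTerm {n : ℕ} {h : (Fin n → ℝ) → ℝ} (hh : MemLp h 2 (leb n)) (B : Finset ℕ) :
    MemLp (boxTerm h B) 2 pathLaw := memLp_centerPart (memLp_sect hh B) B

lemma memLp_partialIntegral {n : ℕ} {h : (Fin n → ℝ) → ℝ} (hh : MemLp h 2 (leb n)) (M : ℕ) :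
    MemLp (partialIntegral M h) 2 pathLaw :=
  (memLp_finsetSum _ fun B _ => memLp_boxTerm hh B).const_mul _

lemma dependsOn_boxTerm {n : ℕ} (h : (Fin n → ℝ) → ℝ) (B : Finset ℕ) :
    DependsOn (boxTerm h B) (B : Set ℕ) := dependsOn_centerPart (dependsOn_sect h B) B

lemma dependsOn_compl_singleton {F : (ℕ → ℝ) → ℝ} {B : Finset ℕ}
    (hF : DependsOn F (B : Set ℕ)) {k : ℕ} (hk : k ∉ B) : DependsOn F {k}ᶜ :=
  hF.mono fun j hj hjk => hk (by rw [← (show j = k from hjk)]; exact hj)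

/-- Two different sets of the same size each miss an element of the other: one term is centred in
that coordinate, the other does not depend on it. -/
lemma integral_boxTerm_mul {n : ℕ} {h : (Fin n → ℝ) → ℝ} (hh : MemLp h 2 (leb n))
    {B B' : Finset ℕ} (hne : B ≠ B') : ∫ x, boxTerm h B x * boxTerm h B' x ∂pathLaw = 0 := by
  by_cases hB : B.card = n
  swap
  · simp [boxTerm_of_card_ne h hB]
  by_cases hB' : B'.card = n
  swap
  · simp [boxTerm_of_card_ne h hB']
  obtain ⟨k, hk, hk'⟩ : ∃ k ∈ B, k ∉ B' := by
    by_contra hc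
    push Not at hc
    exact hne (Finset.eq_of_subset_of_card_le hc (by omega))
  exact integral_mul_eq_zero
    (isCentered_centerPart ((memLp_sect hh B).integrable (by norm_num)) hk)
    (dependsOn_compl_singleton (dependsOn_boxTerm h B') hk')
    ((memLp_boxTerm hh B).integrable_mul (memLp_boxTerm hh B'))

lemma eLpNorm_boxTerm_sq_le {n : ℕ} {h : (Fin n → ℝ) → ℝ} (hh : MemLp h 2 (leb n))
    (B : Finset ℕ) : eLpNorm (boxTerm h B) 2 pathLaw ^ (2 : ℝ) ≤
      ((2 : ℝ≥0∞) ^ n) ^ (2 : ℝ) * ∫⁻ x, ‖sect h B x‖ₑ ^ (2 : ℝ) ∂pathLaw := by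
  by_cases hB : B.card = n
  · have e2 := eLpNorm_nnreal_pow_eq_lintegral (f := sect h B) (μ := pathLaw) (p := 2)
      (by norm_num)
    simp only [NNReal.coe_ofNat, ENNReal.coe_ofNat] at e2
    rw [← e2, ← ENNReal.mul_rpow_of_nonneg _ _ (by norm_num)]
    refine ENNReal.rpow_le_rpow ?_ (by norm_num)
    have := eLpNorm_centerPart_le (memLp_sect hh B) B
    rwa [hB] at this
  · rw [boxTerm_of_card_ne h hB]; simp

/-- The factor 2ⁿ is the number of resampled terms in a centred part. It is not sharp, but only
continuity is needed. -/
lemma tsum_eLpNorm_boxTerm_le {n : ℕ} {h : (Fin n → ℝ) → ℝ} (hh : MemLp h 2 (leb n)) :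
    ∑' B, eLpNorm (boxTerm h B) 2 pathLaw ^ (2 : ℝ) ≤
      (2 ^ n * eLpNorm h 2 (leb n)) ^ (2 : ℝ) := by
  have e2 := eLpNorm_nnreal_pow_eq_lintegral (f := h) (μ := leb n) (p := 2) (by norm_num)
  simp only [NNReal.coe_ofNat, ENNReal.coe_ofNat] at e2
  calc _ ≤ ∑' B, ((2 : ℝ≥0∞) ^ n) ^ (2 : ℝ) * ∫⁻ x, ‖sect h B x‖ₑ ^ (2 : ℝ) ∂pathLaw :=
        ENNReal.tsum_le_tsum fun B => eLpNorm_boxTerm_sq_le hh B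
    _ ≤ ((2 : ℝ≥0∞) ^ n) ^ (2 : ℝ) * ∫⁻ x, ‖h x‖ₑ ^ (2 : ℝ) ∂leb n := by
        rw [ENNReal.tsum_mul_left]
        gcongr
        exact tsum_lintegral_sect_le hh.1 (by norm_num)
    _ = _ := by rw [← e2, ENNReal.mul_rpow_of_nonneg _ _ (by norm_num)]

/-- The family of the box terms in `L²`. -/
def boxVec {n : ℕ} {h : (Fin n → ℝ) → ℝ} (hh : MemLp h 2 (leb n)) (B : Finset ℕ) :
    Lp ℝ 2 pathLaw := (memLp_boxTerm hh B).toLp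

/-- Orthogonality is phrased for the lines spanned by the box terms, so that Pythagoras and the
square-summability criterion for orthogonal families apply. -/
lemma orthogonalFamily_boxVec {n : ℕ} {h : (Fin n → ℝ) → ℝ} (hh : MemLp h 2 (leb n)) :
    OrthogonalFamily ℝ (fun B => (ℝ ∙ boxVec hh B : Submodule ℝ (Lp ℝ 2 pathLaw)))
      (fun B => (ℝ ∙ boxVec hh B).subtypeₗᵢ) := by
  have key : ∀ B B', B ≠ B' → inner ℝ (boxVec hh B) (boxVec hh B') = 0 := by
    intro B B' hne
    rw [L2.inner_def, ← integral_boxTerm_mul hh hne]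
    refine integral_congr_ae ?_
    filter_upwards [(memLp_boxTerm hh B).coeFn_toLp, (memLp_boxTerm hh B').coeFn_toLp]
      with x h1 h2
    rw [boxVec, boxVec, h1, h2]
    simp [mul_comm]
  intro B B' hne v w
  obtain ⟨a, ha⟩ := Submodule.mem_span_singleton.1 v.2
  obtain ⟨b, hb⟩ := Submodule.mem_span_singleton.1 w.2
  change inner ℝ (v : Lp ℝ 2 pathLaw) (w : Lp ℝ 2 pathLaw) = 0
  rw [← ha, ← hb, inner_smul_left, inner_smul_right, key B B' hne, mul_zero, mul_zero]

/-- A box term as an element of the line that it spans. -/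
def boxLine {n : ℕ} {h : (Fin n → ℝ) → ℝ} (hh : MemLp h 2 (leb n)) (B : Finset ℕ) :
    (ℝ ∙ boxVec hh B : Submodule ℝ (Lp ℝ 2 pathLaw)) :=
  ⟨boxVec hh B, Submodule.mem_span_singleton_self _⟩

lemma toLp_sum_boxTerm {n : ℕ} {h : (Fin n → ℝ) → ℝ} (hh : MemLp h 2 (leb n))
    (s : Finset (Finset ℕ)) :
    (memLp_finsetSum s fun B _ => memLp_boxTerm hh B).toLp = ∑ B ∈ s, boxVec hh B := by
  classical
  have : ∀ s : Finset (Finset ℕ), ⇑(∑ B ∈ s, boxVec hh B) =ᵐ[pathLaw]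
      fun x => ∑ B ∈ s, boxTerm h B x := by
    intro s
    induction s using Finset.induction_on with
    | empty => simpa using! Lp.coeFn_zero ℝ 2 pathLaw
    | insert B s hB ih =>
      rw [Finset.sum_insert hB]
      filter_upwards [Lp.coeFn_add (boxVec hh B) (∑ B ∈ s, boxVec hh B), ih,
        (memLp_boxTerm hh B).coeFn_toLp] with x h1 h2 h3
      rw [h1, Pi.add_apply, h2, boxVec, h3, Finset.sum_insert hB]
  exact Lp.ext ((MemLp.coeFn_toLp _).trans (this s).symm)

lemma eLpNorm_sum_boxTerm_sq {n : ℕ} {h : (Fin n → ℝ) → ℝ} (hh : MemLp h 2 (leb n))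
    (s : Finset (Finset ℕ)) :
    eLpNorm (fun x => ∑ B ∈ s, boxTerm h B x) 2 pathLaw ^ (2 : ℝ) =
      ∑ B ∈ s, eLpNorm (boxTerm h B) 2 pathLaw ^ (2 : ℝ) := by
  have h1 := (orthogonalFamily_boxVec hh).norm_sum (boxLine hh) s
  have h2 : ∀ B, ((ℝ ∙ boxVec hh B : Submodule ℝ (Lp ℝ 2 pathLaw)).subtypeₗᵢ) (boxLine hh B) =
    boxVec hh B := fun B => rfl
  have h3 : ∀ B, ‖boxLine hh B‖ = ‖boxVec hh B‖ := fun B => rfl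
  simp only [h2, h3] at h1
  have h4 := congrArg ENNReal.ofReal h1
  rw [ENNReal.ofReal_sum_of_nonneg fun _ _ => by positivity] at h4
  simp only [ENNReal.ofReal_pow (norm_nonneg _), ofReal_norm] at h4
  rw [← toLp_sum_boxTerm] at h4
  simp only [boxVec, Lp.enorm_toLp] at h4
  simpa only [ENNReal.rpow_ofNat] using h4

/-- The bound is uniform in `M`; this is the L²-continuity of the multiple integral before passing
to the limit. -/
lemma eLpNorm_partialIntegral_le {n : ℕ} {h : (Fin n → ℝ) → ℝ} (hh : MemLp h 2 (leb n))
    (M : ℕ) : eLpNorm (partialIntegral M h) 2 pathLaw ≤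
      (n ! : ℝ≥0∞) * (2 ^ n * eLpNorm h 2 (leb n)) := by
  have e : partialIntegral M h = (n ! : ℝ) • fun x => ∑ B ∈ (Finset.range M).powerset,
    boxTerm h B x := rfl
  rw [e, eLpNorm_const_smul]
  have : ‖(n ! : ℝ)‖ₑ = (n ! : ℝ≥0∞) := by
    rw [← ofReal_norm, Real.norm_natCast, ENNReal.ofReal_natCast]
  rw [this]
  gcongr
  rw [← ENNReal.rpow_le_rpow_iff (z := 2) (by norm_num), eLpNorm_sum_boxTerm_sq hh]
  exact (ENNReal.sum_le_tsum _).trans (tsum_eLpNorm_boxTerm_le hh)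

lemma tendsto_powerset_range :
    Tendsto (fun M => (Finset.range M).powerset) atTop atTop := by
  refine tendsto_atTop_finset_of_monotone ?_ fun B => ?_
  · intro M M' hM
    exact Finset.powerset_mono.2 (Finset.range_mono hM)
  · obtain ⟨N, hN⟩ := B.exists_nat_subset_range
    exact ⟨N, Finset.mem_powerset.2 hN⟩

/-- The box terms are orthogonal with summable squared norms, so they are summable in L², and the
index sets of the partial integrals exhaust all finite sets. -/
lemma exists_tendsto_partialIntegral {n : ℕ} {h : (Fin n → ℝ) → ℝ} (hh : MemLp h 2 (leb n)) :
    ∃ Z, MemLp Z 2 pathLaw ∧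
      Tendsto (fun M => eLpNorm (partialIntegral M h - Z) 2 pathLaw) atTop (𝓝 0) := by
  have hsum : Summable (fun B => boxVec hh B) := by
    refine ((orthogonalFamily_boxVec hh).summable_iff_norm_sq_summable (boxLine hh)).2 ?_
    have hfin : ∑' B, eLpNorm (boxTerm h B) 2 pathLaw ^ (2 : ℝ) ≠ ⊤ := by
      refine ne_top_of_le_ne_top ?_ (tsum_eLpNorm_boxTerm_le hh)
      exact ENNReal.rpow_ne_top_of_nonneg (by norm_num)
        (ENNReal.mul_ne_top (by finiteness) hh.2.ne)
    refine (ENNReal.summable_toReal hfin).congr fun B => ?_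
    have : ‖boxLine hh B‖ = (eLpNorm (boxTerm h B) 2 pathLaw).toReal :=
      Lp.norm_toLp _ (memLp_boxTerm hh B)
    rw [this, ← ENNReal.toReal_rpow, Real.rpow_two]
  set W : Lp ℝ 2 pathLaw := (n ! : ℝ) • ∑' B, boxVec hh B with hW
  refine ⟨W, Lp.memLp W, ?_⟩
  have h1 : Tendsto (fun M => (n ! : ℝ) • ∑ B ∈ (Finset.range M).powerset, boxVec hh B)
      atTop (𝓝 W) := (hsum.hasSum.comp tendsto_powerset_range).const_smul _
  rw [Lp.tendsto_Lp_iff_tendsto_eLpNorm'] at h1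
  refine h1.congr fun M => eLpNorm_congr_ae ?_
  rw [← toLp_sum_boxTerm]
  filter_upwards [Lp.coeFn_smul (n ! : ℝ)
    ((memLp_finsetSum (Finset.range M).powerset fun B _ => memLp_boxTerm hh B).toLp),
    (memLp_finsetSum (Finset.range M).powerset fun B _ => memLp_boxTerm hh B).coeFn_toLp]
    with x h1 h2
  rw [Pi.sub_apply, Pi.sub_apply, h1, Pi.smul_apply, h2]
  rfl

lemma partialIntegral_sub {n : ℕ} {h h' : (Fin n → ℝ) → ℝ} (hh : MemLp h 2 (leb n))
    (hh' : MemLp h' 2 (leb n)) (M : ℕ) :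
    partialIntegral M (h - h') =ᵐ[pathLaw] partialIntegral M h - partialIntegral M h' := by
  have : ∀ᵐ x ∂pathLaw, ∀ B, boxTerm (h - h') B x = (boxTerm h B - boxTerm h' B) x :=
    ae_all_iff.2 fun B => by
      unfold boxTerm
      rw [sect_sub]
      exact centerPart_sub ((memLp_sect hh B).integrable (by norm_num))
        ((memLp_sect hh' B).integrable (by norm_num)) B
  filter_upwards [this] with x hx
  simp only [partialIntegral, hx, Pi.sub_apply, Finset.sum_sub_distrib, mul_sub]

/-! ### From sums over tuples to sums over finite sets -/

lemma image_orderEmbOfFin_perm {a : ℕ} {A : Finset ℕ} (hA : A.card = a)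
    (σ : Equiv.Perm (Fin a)) :
    Finset.univ.image (fun j => A.orderEmbOfFin hA (σ j)) = A := by
  ext k
  simp only [Finset.mem_image, Finset.mem_univ, true_and]
  constructor
  · rintro ⟨j, rfl⟩; exact A.orderEmbOfFin_mem hA _
  · intro hk
    have : k ∈ Set.range (A.orderEmbOfFin hA) := by rw [A.range_orderEmbOfFin hA]; exact hk
    obtain ⟨j, hj⟩ := this
    exact ⟨σ.symm j, by simpa using hj⟩

/-- An injective tuple amounts to its image together with an ordering of the image. -/
def embeddingEquiv (a : ℕ) :
    {A : Finset ℕ // A.card = a} × Equiv.Perm (Fin a) ≃ (Fin a ↪ ℕ) :=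
  Equiv.ofBijective
    (fun q => ⟨fun j => q.1.1.orderEmbOfFin q.1.2 (q.2 j),
      (q.1.1.orderEmbOfFin q.1.2).injective.comp q.2.injective⟩) <| by
    constructor
    · rintro ⟨⟨A, hA⟩, σ⟩ ⟨⟨A', hA'⟩, σ'⟩ h
      have hf := fun j => DFunLike.congr_fun h j
      simp only [Function.Embedding.coeFn_mk] at hf
      have hAA : A = A' := by
        rw [← image_orderEmbOfFin_perm hA σ, ← image_orderEmbOfFin_perm hA' σ']
        simp only [hf]
      subst hAA
      have : σ = σ' := Equiv.ext fun j => (A.orderEmbOfFin hA).injective (hf j)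
      rw [this]
    · intro κ
      obtain ⟨hB, σ, hval⟩ := exists_perm_orderEmbOfFin κ.injective
      exact ⟨⟨⟨_, hB⟩, σ⟩, Function.Embedding.ext hval⟩

/-- Each set of size `a` is the image of exactly `a !` injective tuples. -/
lemma tsum_embedding {a : ℕ} {G : Finset ℕ → ℝ}
    (hG : Summable fun A : Finset ℕ => if A.card = a then G A else 0) :
    ∑' κ : Fin a ↪ ℕ, G (Finset.univ.image κ) =
      a ! * ∑' A : Finset ℕ, if A.card = a then G A else 0 := by
  have hsub : Summable fun A : {A : Finset ℕ // A.card = a} => G A := by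
    refine (hG.comp_injective Subtype.val_injective).congr fun A => ?_
    simp [A.2]
  have e1 : ∀ q : {A : Finset ℕ // A.card = a} × Equiv.Perm (Fin a),
      G (Finset.univ.image (embeddingEquiv a q)) = G q.1 := fun q => by
    congr 1
    exact image_orderEmbOfFin_perm q.1.2 q.2
  have hprod : Summable fun q : {A : Finset ℕ // A.card = a} × Equiv.Perm (Fin a) => G q.1 := by
    have h1 : Summable fun _ : Equiv.Perm (Fin a) => ‖(1 : ℝ)‖ :=
      Summable.of_finite
    refine (summable_mul_of_summable_norm hsub.norm h1).congr fun q => by simp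
  rw [← (embeddingEquiv a).tsum_eq]
  simp only [e1]
  rw [hprod.tsum_prod]
  simp only [tsum_fintype, Finset.sum_const, Finset.card_univ, Fintype.card_perm,
    Fintype.card_fin, nsmul_eq_mul]
  rw [tsum_mul_left]
  congr 1
  rw [show (fun A : {A : Finset ℕ // A.card = a} => G A) =
    fun A : ({A : Finset ℕ | A.card = a} : Set (Finset ℕ)) => G A from rfl]
  refine (tsum_subtype {A : Finset ℕ | A.card = a} G).trans (tsum_congr fun A => ?_)
  simp [Set.indicator_apply]

/-- A tuple with repetitions has an image of fewer than `a` elements, where `G` vanishes. -/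
lemma tsum_tuple {a : ℕ} {G : Finset ℕ → ℝ}
    (hG : Summable fun A : Finset ℕ => if A.card = a then G A else 0)
    (h0 : ∀ A : Finset ℕ, A.card < a → G A = 0) :
    ∑' κ : Fin a → ℕ, G (Finset.univ.image κ) =
      a ! * ∑' A : Finset ℕ, if A.card = a then G A else 0 := by
  rw [← tsum_embedding hG]
  refine (Function.Injective.tsum_eq (g := fun κ : Fin a ↪ ℕ => (κ : Fin a → ℕ))
    DFunLike.coe_injective (f := fun κ : Fin a → ℕ => G (Finset.univ.image κ)) ?_).symm
  intro κ hκ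
  by_contra hc
  refine hκ (h0 _ ?_)
  refine lt_of_le_of_ne (Finset.card_image_le.trans (by simp)) fun hcard => hc ?_
  have : Function.Injective κ := by
    rw [← Set.injOn_univ, ← Finset.coe_univ]
    exact Finset.card_image_iff.1 (by rw [hcard]; simp)
  exact ⟨⟨κ, this⟩, rfl⟩

/-! ### The explicit formula sorted by occupied boxes -/

lemma card_image_eq_iff {n : ℕ} (κ : Fin n → ℕ) :
    (Finset.univ.image κ).card = n ↔ Function.Injective κ := by
  rw [← Set.injOn_univ, ← Finset.coe_univ, ← Finset.card_image_iff]
  simp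

/-- Almost every point of a box lies in no other box, so a box with a repeated index meets `offDiag
n` in a null set. -/
lemma ae_eq_zero_of_not_injective {n : ℕ} {h : (Fin n → ℝ) → ℝ}
    (hv : ∀ᵐ x ∂leb n, x ∉ offDiag n → h x = 0) {κ : Fin n → ℕ} (hκ : ¬ Function.Injective κ) :
    ∀ᵐ x ∂(Measure.pi fun j => boxLaw (κ j)), h x = 0 := by
  have hle := (Measure.absolutelyContinuous_of_le (pi_boxLaw_le_leb κ)).ae_le
  have hbox : ∀ᵐ x ∂(Measure.pi fun j => boxLaw (κ j)), ∀ j,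
      x j ∈ Set.Icc (2 * (κ j : ℝ)) (2 * (κ j : ℝ) + 2) := by
    refine ae_all_iff.2 fun j => ?_
    refine (Measure.tendsto_eval_ae_ae (μ := fun j => boxLaw (κ j)) (i := j)).eventually ?_
    rw [boxLaw]
    exact Measure.ae_smul_measure (ae_restrict_mem measurableSet_Icc) _
  filter_upwards [hle hv, hle (ae_leb_nonneg_not_even n), hbox] with x h1 h2 h3
  refine h1 ?_
  rintro ⟨κ', hinj, h4⟩
  refine hκ ?_
  have : κ = κ' := by
    funext j
    have a1 := h3 j
    have a2 := h4 j
    have b1 := (h2 j).2 (κ j)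
    have b2 := (h2 j).2 (κ' j)
    have b3 := (h2 j).2 (κ j + 1)
    have b4 := (h2 j).2 (κ' j + 1)
    push_cast at b3 b4
    rw [mul_add, mul_one] at b3 b4
    have c1 := lt_of_le_of_ne a1.1 (Ne.symm b1)
    have c2 := lt_of_le_of_ne a1.2 b3
    have c3 := lt_of_le_of_ne a2.1 (Ne.symm b2)
    have c4 := lt_of_le_of_ne a2.2 b4
    have d1 : (κ j : ℝ) < κ' j + 1 := by linarith
    have d2 : (κ' j : ℝ) < κ j + 1 := by linarith
    norm_cast at d1 d2
    omega
  rw [this]; exact hinj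

lemma image_mixIdx {n i : ℕ} {e : Fin n → Fin i ⊕ ℕ} (ζ : Fin i → ℕ)
    (hl : ∀ a, ∃ j, e j = Sum.inl a) (D : Finset ℕ)
    (hD : ∀ b, (∃ j, e j = Sum.inr b) ↔ b ∈ D) :
    Finset.univ.image (mixIdx e ζ) = D ∪ Finset.univ.image ζ := by
  ext k
  simp only [Finset.mem_image, Finset.mem_univ, true_and, Finset.mem_union, mixIdx]
  constructor
  · rintro ⟨j, rfl⟩
    rcases hj : e j with a | b
    · exact Or.inr ⟨a, by simp⟩
    · exact Or.inl (by simpa using (hD b).1 ⟨j, hj⟩)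
  · rintro (hk | ⟨a, rfl⟩)
    · obtain ⟨j, hj⟩ := (hD k).2 hk
      exact ⟨j, by simp [hj]⟩
    · obtain ⟨j, hj⟩ := hl a
      exact ⟨j, by simp [hj]⟩

/-- As the occupied boxes are distinct, no path coordinate read by `e` lies in the image of `ζ`.
Extra variables taken from a second path therefore amount to resampling. -/
lemma mix_eq_piecewise {n i : ℕ} {e : Fin n → Fin i ⊕ ℕ} {ζ : Fin i → ℕ}
    (hl : ∀ a, ∃ j, e j = Sum.inl a)
    (hK : Function.Injective (mixIdx e ζ)) (x y : ℕ → ℝ) :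
    mix e (fun a => y (ζ a)) x =
      fun j => (Finset.univ.image ζ).piecewise y x (mixIdx e ζ j) := by
  funext j
  rcases hj : e j with a | b
  · simp [mix, mixIdx, hj, Finset.piecewise]
  · have : b ∉ Finset.univ.image ζ := by
      intro hb
      obtain ⟨a, -, ha⟩ := Finset.mem_image.1 hb
      obtain ⟨j', hj'⟩ := hl a
      have : j' = j := hK (by simp [mixIdx, hj, hj', ha])
      rw [this, hj] at hj'
      cases hj'
    simp only [mix, mixIdx, hj, Finset.piecewise, Sum.elim_inr, id]
    rw [if_neg this]

lemma injective_of_mixIdx {n i : ℕ} {e : Fin n → Fin i ⊕ ℕ} {ζ : Fin i → ℕ}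
    (hl : ∀ a, ∃ j, e j = Sum.inl a)
    (hK : Function.Injective (mixIdx e ζ)) : Function.Injective ζ := by
  intro a a' haa
  obtain ⟨j, hj⟩ := hl a
  obtain ⟨j', hj'⟩ := hl a'
  have : j = j' := hK (by simp [mixIdx, hj, hj', haa])
  rw [this, hj'] at hj
  exact (Sum.inl_injective hj).symm

/-- Averaging `h` over a box in some variables, the other variables being coordinates of the
path. -/
lemma integral_mix_box {n i : ℕ} {h : (Fin n → ℝ) → ℝ} (hh : MemHatL2 n h)
    {e : Fin n → Fin i ⊕ ℕ} (he : Function.Injective e)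
    (hl : ∀ a, ∃ j, e j = Sum.inl a) (D : Finset ℕ)
    (hD : ∀ b, (∃ j, e j = Sum.inr b) ↔ b ∈ D) (ζ : Fin i → ℕ) :
    ∀ᵐ x ∂pathLaw, ∫ z, h (mix e z x) ∂(Measure.pi fun a => boxLaw (ζ a)) =
      resample (Finset.univ.image ζ) (sect h (D ∪ Finset.univ.image ζ)) x := by
  have him := image_mixIdx ζ hl D hD
  have hmp := measurePreserving_mix he ζ
  by_cases hK : Function.Injective (mixIdx e ζ)
  · have hζ := injective_of_mixIdx hl hK
    have h1 := comp_ae_eq_sect hh.symmetric hK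
    rw [him] at h1
    have hm : ∀ᵐ x ∂pathLaw, AEStronglyMeasurable (fun z => h (mix e z x))
        (Measure.pi fun a => boxLaw (ζ a)) := by
      have hm0 : AEStronglyMeasurable (fun q : (Fin i → ℝ) × (ℕ → ℝ) => h (mix e q.1 q.2))
          ((Measure.pi fun a => boxLaw (ζ a)).prod pathLaw) :=
        (hh.memLp.1.mono_measure (pi_boxLaw_le_leb _)).comp_measurePreserving hmp
      exact hm0.prod_swap.prodMk_left
    filter_upwards [hm, resample_congr h1 (Finset.univ.image ζ)] with x hx1 hx2
    rw [← hx2]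
    have hmp2 := measurePreserving_comp hζ
    rw [← hmp2.map_eq] at hx1 ⊢
    rw [integral_map hmp2.measurable.aemeasurable hx1]
    unfold resample
    refine integral_congr_ae (Eventually.of_forall fun y => ?_)
    simp only [mix_eq_piecewise hl hK]
  -- With a repeated box both sides vanish: the left because `h` vanishes off `offDiag n`, the right
  -- because too few boxes are occupied for `sect` to be nonzero.
  · have h0 := hmp.quasiMeasurePreserving.ae (ae_eq_zero_of_not_injective hh.vanish hK)
    have h1 : ∀ᵐ x ∂pathLaw, ∀ᵐ z ∂(Measure.pi fun a => boxLaw (ζ a)), h (mix e z x) = 0 :=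
      Measure.ae_ae_of_ae_prod
        ((Measure.measurePreserving_swap (μ := pathLaw)
          (ν := Measure.pi fun a => boxLaw (ζ a))).quasiMeasurePreserving.ae h0)
    have hc : (D ∪ Finset.univ.image ζ).card ≠ n := by
      rw [← him, Ne, card_image_eq_iff]; exact hK
    filter_upwards [h1] with x hx
    rw [integral_eq_zero_of_ae hx, sect_of_card_ne h hc]
    simp [resample]

/-- The explicit multiple integral as a function of the sequence of jump times. -/
def pathIntegral (n : ℕ) (f : (Fin n → ℝ) → ℝ) (x : ℕ → ℝ) : ℝ :=
  ∑ r ∈ Finset.range (n + 1),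
    (-1 : ℝ) ^ (n - r) / 2 ^ (n - r) * (n.choose r : ℝ) *
      ∑' κ : Fin r ↪ ℕ, ∫ y : Fin (n - r) → ℝ,
        f (fun j : Fin n =>
          if h : (j : ℕ) < r then x (κ ⟨j, h⟩)
          else y ⟨(j : ℕ) - r, by omega⟩) ∂leb (n - r)

/-- Resampling contracts L¹ and a set of size `n` has 2ⁿ subsets, so the expected sum of absolute
values is at most 2ⁿ times the L¹ norm of `h`. This justifies every rearrangement of the explicit
formula. -/
lemma ae_summable_resample {n : ℕ} {h : (Fin n → ℝ) → ℝ} (hh : Integrable h (leb n)) :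
    ∀ᵐ x ∂pathLaw, Summable fun q : Finset ℕ × Finset ℕ =>
      if q.2 ⊆ q.1 then resample q.2 (sect h q.1) x else 0 := by
  have hs : ∀ B, Integrable (sect h B) pathLaw := fun B =>
    memLp_one_iff_integrable.1 (memLp_sect (memLp_one_iff_integrable.2 hh) B)
  set F : Finset ℕ × Finset ℕ → (ℕ → ℝ) → ℝ := fun q x =>
    if q.2 ⊆ q.1 then resample q.2 (sect h q.1) x else 0 with hF
  have hFm : ∀ q, AEStronglyMeasurable (F q) pathLaw := fun q => by
    by_cases hq : q.2 ⊆ q.1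
    · simpa only [hF, hq, if_true] using (integrable_resample (hs q.1) q.2).1
    · simpa only [hF, hq, if_false] using aestronglyMeasurable_const
  have hle : ∀ B C : Finset ℕ, ∫⁻ x, ‖F (B, C) x‖ₑ ∂pathLaw ≤
      if C ⊆ B then ∫⁻ x, ‖sect h B x‖ₑ ∂pathLaw else 0 := by
    intro B C
    by_cases hq : C ⊆ B
    · simpa only [hF, hq, if_true] using lintegral_enorm_resample_le (hs B).1 C
    · simp [hF, hq]
  have hB : ∀ B : Finset ℕ, ∑' C : Finset ℕ, (if C ⊆ B then ∫⁻ x, ‖sect h B x‖ₑ ∂pathLaw else 0)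
      ≤ 2 ^ n * ∫⁻ x, ‖sect h B x‖ₑ ^ (1 : ℝ) ∂pathLaw := by
    intro B
    simp only [ENNReal.rpow_one]
    by_cases hc : B.card = n
    · rw [tsum_eq_sum (s := B.powerset) fun C hC => by
        rw [if_neg (fun h => hC (Finset.mem_powerset.2 h))]]
      rw [Finset.sum_congr rfl fun C hC => if_pos (Finset.mem_powerset.1 hC)]
      simp [hc]
    · simp [sect_of_card_ne h hc]
  have htop : ∫⁻ x, ∑' q, ‖F q x‖ₑ ∂pathLaw ≠ ⊤ := by
    rw [lintegral_tsum fun q => (hFm q).enorm, ENNReal.tsum_prod']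
    refine ne_top_of_le_ne_top ?_ (ENNReal.tsum_le_tsum fun B =>
      (ENNReal.tsum_le_tsum fun C => hle B C).trans (hB B))
    rw [ENNReal.tsum_mul_left]
    refine ENNReal.mul_ne_top (by finiteness) (ne_top_of_le_ne_top ?_
      (tsum_lintegral_sect_le hh.1 one_pos))
    simpa using hh.2.ne
  have hmeas : AEMeasurable (fun x => ∑' q, ‖F q x‖ₑ) pathLaw :=
    AEMeasurable.tsum fun q => (hFm q).enorm
  filter_upwards [ae_lt_top' hmeas htop] with x hx
  refine Summable.of_nnnorm (ENNReal.tsum_coe_ne_top_iff_summable.1 ?_)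
  exact hx.ne

lemma integral_mix_leb {n i : ℕ} {h : (Fin n → ℝ) → ℝ} (hh : MemHatL2 n h)
    (hi : Integrable h (leb n))
    {e : Fin n → Fin i ⊕ ℕ} (he : Function.Injective e)
    (hl : ∀ a, ∃ j, e j = Sum.inl a) (D : Finset ℕ)
    (hD : ∀ b, (∃ j, e j = Sum.inr b) ↔ b ∈ D) :
    ∀ᵐ x ∂pathLaw, ∫ z, h (mix e z x) ∂leb i =
      2 ^ i * ∑' ζ : Fin i → ℕ,
        resample (Finset.univ.image ζ) (sect h (D ∪ Finset.univ.image ζ)) x := by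
  have h1 : ∀ᵐ x ∂pathLaw, Integrable (fun z => h (mix e z x)) (leb i) :=
    (memLp_one_iff_integrable.1 (MemLp.comp_mix he hl (memLp_one_iff_integrable.2 hi))).prod_left_ae
  filter_upwards [h1, ae_all_iff.2 fun ζ => integral_mix_box hh he hl D hD ζ] with x hx1 hx2
  rw [leb_eq_sum] at hx1 ⊢
  rw [integral_sum_measure hx1, ← tsum_mul_left]
  refine tsum_congr fun ζ => ?_
  rw [integral_smul_measure, hx2 ζ]
  simp

/-- The summands of order `r` of the multiple integral, collected by the occupied boxes. -/
lemma tsum_integral_eq {n r : ℕ} (hr : r ≤ n) {h : (Fin n → ℝ) → ℝ} (hh : MemHatL2 n h)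
    (hi : Integrable h (leb n)) :
    ∀ᵐ x ∂pathLaw, HasSum (fun B : Finset ℕ =>
        (2 ^ (n - r) * ((n - r)! * r ! : ℝ)) *
          ∑ C ∈ B.powersetCard (n - r), resample C (sect h B) x)
      (∑' κ : Fin r ↪ ℕ, ∫ y : Fin (n - r) → ℝ,
        h (fun j : Fin n =>
          if h : (j : ℕ) < r then x (κ ⟨j, h⟩)
          else y ⟨(j : ℕ) - r, by omega⟩) ∂leb (n - r)) := by
  -- The first `r` slots read the path along `κ`, the others the integration variables.
  set e : (Fin r ↪ ℕ) → Fin n → Fin (n - r) ⊕ ℕ := fun κ j =>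
    if h : (j : ℕ) < r then Sum.inr (κ ⟨j, h⟩) else Sum.inl ⟨(j : ℕ) - r, by omega⟩ with he
  have hinj : ∀ κ, Function.Injective (e κ) := by
    intro κ a b hab
    simp only [he] at hab
    split_ifs at hab with h1 h2 h2
    · simpa [Fin.ext_iff] using hab
    · simp [Fin.ext_iff] at hab
      ext; omega
  have hl : ∀ κ a, ∃ j, e κ j = Sum.inl a := by
    intro κ a
    refine ⟨⟨a + r, by omega⟩, ?_⟩
    simp [he]
  have hD : ∀ κ : Fin r ↪ ℕ, ∀ b, (∃ j, e κ j = Sum.inr b) ↔ b ∈ Finset.univ.image κ := by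
    intro κ b
    simp only [Finset.mem_image, Finset.mem_univ, true_and]
    constructor
    · rintro ⟨j, hj⟩
      simp only [he] at hj
      split_ifs at hj with h1
      exact ⟨_, Sum.inr_injective hj⟩
    · rintro ⟨j, rfl⟩
      exact ⟨⟨j, by omega⟩, by simp [he]⟩
  have hmix : ∀ κ (x : ℕ → ℝ) (y : Fin (n - r) → ℝ), (fun j : Fin n =>
          if h : (j : ℕ) < r then x (κ ⟨j, h⟩)
          else y ⟨(j : ℕ) - r, by omega⟩) = mix (e κ) y x := by
    intro κ x y
    funext j
    simp only [mix, he]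
    split_ifs <;> rfl
  simp only [hmix]
  have : Countable (Fin r ↪ ℕ) := DFunLike.coe_injective.countable
  filter_upwards [ae_summable_resample hi,
    ae_all_iff.2 fun κ => integral_mix_leb hh hi (hinj κ) (hl κ) _ (hD κ)] with x hx1 hx2
  simp only [hx2]
  set G : Finset ℕ → Finset ℕ → ℝ := fun D C => resample C (sect h (D ∪ C)) x with hG
  set u : Finset ℕ × Finset ℕ → ℝ := fun q =>
    if q.1.card = r ∧ q.2.card = n - r then G q.1 q.2 else 0 with hu
  set v : Finset ℕ × Finset ℕ → ℝ := fun q =>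
    if q.2 ⊆ q.1 ∧ q.2.card = n - r then resample q.2 (sect h q.1) x else 0 with hv
  have hzero : ∀ B C, B.card ≠ n → resample C (sect h B) x = 0 := fun B C hB => by
    rw [sect_of_card_ne h hB]; simp [resample]
  have hvs : Summable v := by
    refine (hx1.indicator {q | q.2.card = n - r}).congr fun q => ?_
    simp only [Set.indicator_apply, Set.mem_ofPred_eq, hv, ite_and]
    split_ifs <;> rfl
  -- The involution (D, C) ↦ (D ∆ C, C) matches disjoint pairs (boxes of the jump times, boxes of
  -- the integration variables) with pairs C ⊆ B, B being all occupied boxes. Using the symmetric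
  -- difference gives a bijection on all pairs; overlapping pairs contribute zero on both sides.
  let sw : Finset ℕ × Finset ℕ ≃ Finset ℕ × Finset ℕ :=
    ⟨fun q => (symmDiff q.1 q.2, q.2), fun q => (symmDiff q.1 q.2, q.2),
      fun q => by simp, fun q => by simp⟩
  have huv : ∀ q, u q = v (sw q) := by
    rintro ⟨D, C⟩
    change (if D.card = r ∧ C.card = n - r then G D C else 0) =
      if C ⊆ symmDiff D C ∧ C.card = n - r then resample C (sect h (symmDiff D C)) x else 0
    by_cases hdis : Disjoint D C
    · have e1 : symmDiff D C = D ∪ C := by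
        rw [hdis.symmDiff_eq_sup]; rfl
      rw [e1]
      simp only [Finset.subset_union_right, true_and, hG]
      by_cases hC : C.card = n - r
      · by_cases hDr : D.card = r
        · simp [hC, hDr]
        · rw [hzero]
          · simp
          · rw [Finset.card_union_of_disjoint hdis]; omega
      · simp [hC]
    · have h2 : ¬ C ⊆ symmDiff D C := by
        intro hsub
        refine hdis (Finset.disjoint_left.2 fun k hkD hkC => ?_)
        have := hsub hkC
        rw [Finset.mem_symmDiff] at this
        tauto
      rw [if_neg (c := C ⊆ symmDiff D C ∧ C.card = n - r) (fun h => h2 h.1)]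
      split_ifs with hc
      · refine hzero _ _ ?_
        have := Finset.card_union_add_card_inter D C
        have h3 : 0 < (D ∩ C).card := by
          rw [Finset.card_pos]
          exact Finset.not_disjoint_iff_nonempty_inter.1 hdis
        omega
      · rfl
  have hus : Summable u := by
    refine (sw.summable_iff.2 hvs).congr fun q => ?_
    exact (huv q).symm
  have hsD : ∀ D : Finset ℕ, D.card = r →
      Summable fun C : Finset ℕ => if C.card = n - r then G D C else 0 := by
    intro D hDr
    refine (hus.prod_factor D).congr fun C => ?_
    simp [hu, hDr]
  have step1 : ∀ κ : Fin r ↪ ℕ, ∑' ζ : Fin (n - r) → ℕ, G (Finset.univ.image κ)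
      (Finset.univ.image ζ) = (n - r)! * ∑' C : Finset ℕ,
        if C.card = n - r then G (Finset.univ.image κ) C else 0 := by
    intro κ
    have hc : (Finset.univ.image κ).card = r := by
      rw [card_image_eq_iff]; exact κ.injective
    refine tsum_tuple (hsD _ hc) fun A hA => hzero _ _ ?_
    have := Finset.card_union_le (Finset.univ.image κ) A
    omega
  have hfib : Summable fun D : Finset ℕ =>
      if D.card = r then ∑' C : Finset ℕ, (if C.card = n - r then G D C else 0) else 0 := by
    refine hus.prod.congr fun D => ?_
    by_cases hDr : D.card = r <;> simp [hu, hDr]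
  have step2 : ∑' κ : Fin r ↪ ℕ, ∑' C : Finset ℕ,
      (if C.card = n - r then G (Finset.univ.image κ) C else 0) = r ! * ∑' q, u q := by
    rw [tsum_embedding (G := fun D => ∑' C : Finset ℕ, if C.card = n - r then G D C else 0) hfib,
      hus.tsum_prod]
    congr 1
    refine tsum_congr fun D => ?_
    by_cases hDr : D.card = r <;> simp [hu, hDr]
  have step3 : HasSum (fun B : Finset ℕ => ∑ C ∈ B.powersetCard (n - r), resample C (sect h B) x)
      (∑' q, u q) := by
    have h1 : ∑' q, u q = ∑' q, v q := by
      rw [← sw.tsum_eq v]; exact tsum_congr huv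
    rw [h1]
    refine hvs.hasSum.prod_fiberwise fun B => ?_
    have : ∑ C ∈ B.powersetCard (n - r), resample C (sect h B) x =
        ∑ C ∈ B.powersetCard (n - r), v (B, C) := by
      refine Finset.sum_congr rfl fun C hC => ?_
      simp [hv, Finset.mem_powersetCard.1 hC]
    rw [this]
    refine hasSum_sum_of_ne_finset_zero fun C hC => ?_
    simp only [hv]
    rw [if_neg]
    exact fun h => hC (Finset.mem_powersetCard.2 h)
  have hval : ∑' κ : Fin r ↪ ℕ, 2 ^ (n - r) * ∑' ζ : Fin (n - r) → ℕ,
      resample (Finset.univ.image ζ) (sect h (Finset.univ.image κ ∪ Finset.univ.image ζ)) x =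
      (2 ^ (n - r) * ((n - r)! * r ! : ℝ)) * ∑' q, u q := by
    rw [tsum_mul_left]
    have : ∀ κ : Fin r ↪ ℕ, ∑' ζ : Fin (n - r) → ℕ,
      resample (Finset.univ.image ζ) (sect h (Finset.univ.image κ ∪ Finset.univ.image ζ)) x =
        (n - r)! * ∑' C : Finset ℕ,
        if C.card = n - r then G (Finset.univ.image κ) C else 0 := step1
    simp only [this]
    rw [tsum_mul_left, step2]
    ring
  rw [hval]
  exact step3.mul_left _

/-- The powers of 2 cancel and C(n,r) r! (n−r)! = n!, which leaves n! times the sum of (−1)^|C|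
`resample C (sect h B)` over C ⊆ B, sorted by |C| = n − r. -/
lemma hasSum_pathIntegral {n : ℕ} {h : (Fin n → ℝ) → ℝ} (hh : MemHatL2 n h)
    (hi : Integrable h (leb n)) :
    ∀ᵐ x ∂pathLaw, HasSum (fun B : Finset ℕ => (n ! : ℝ) * boxTerm h B x)
      (pathIntegral n h x) := by
  have h1 : ∀ r : ℕ, ∀ᵐ x ∂pathLaw, r ∈ Finset.range (n + 1) → HasSum (fun B : Finset ℕ =>
        (2 ^ (n - r) * ((n - r)! * r ! : ℝ)) *
          ∑ C ∈ B.powersetCard (n - r), resample C (sect h B) x)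
      (∑' κ : Fin r ↪ ℕ, ∫ y : Fin (n - r) → ℝ,
        h (fun j : Fin n =>
          if h : (j : ℕ) < r then x (κ ⟨j, h⟩)
          else y ⟨(j : ℕ) - r, by omega⟩) ∂leb (n - r)) := by
    intro r
    by_cases hr : r ∈ Finset.range (n + 1)
    · filter_upwards [tsum_integral_eq (Nat.lt_succ_iff.1 (Finset.mem_range.1 hr)) hh hi]
        with x hx
      exact fun _ => hx
    · exact Eventually.of_forall fun _ h => absurd h hr
  filter_upwards [ae_all_iff.2 h1] with x hx
  have h2 := hasSum_sum fun r (hr : r ∈ Finset.range (n + 1)) =>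
    (hx r hr).mul_left ((-1 : ℝ) ^ (n - r) / 2 ^ (n - r) * (n.choose r : ℝ))
  refine h2.congr_fun fun B => ?_
  by_cases hB : B.card = n
  swap
  · simp [boxTerm_of_card_ne h hB, sect_of_card_ne h hB, resample]
  rw [boxTerm, centerPart, Finset.sum_powerset, hB, ← Finset.sum_range_reflect, Finset.mul_sum]
  refine Finset.sum_congr rfl fun r hr => ?_
  have hrn : r ≤ n := Nat.lt_succ_iff.1 (Finset.mem_range.1 hr)
  have e0 : n + 1 - 1 - r = n - r := by omega
  rw [e0, Finset.mul_sum, Finset.mul_sum, Finset.mul_sum]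
  refine Finset.sum_congr rfl fun C hC => ?_
  rw [(Finset.mem_powersetCard.1 hC).2]
  have e1 : (n.choose r : ℝ) * r ! * (n - r)! = n ! := by
    exact_mod_cast Nat.choose_mul_factorial_mul_factorial hrn
  rw [← e1]
  field_simp

lemma tendsto_partialIntegral_ae {n : ℕ} {h : (Fin n → ℝ) → ℝ} (hh : MemHatL2 n h)
    (hi : Integrable h (leb n)) :
    ∀ᵐ x ∂pathLaw, Tendsto (fun M => partialIntegral M h x) atTop (𝓝 (pathIntegral n h x)) := by
  filter_upwards [hasSum_pathIntegral hh hi] with x hx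
  refine (hx.comp tendsto_powerset_range).congr fun M => ?_
  rw [partialIntegral, Finset.mul_sum]
  rfl

lemma aestronglyMeasurable_pathIntegral {n : ℕ} {h : (Fin n → ℝ) → ℝ} (hh : MemHatL2 n h)
    (hi : Integrable h (leb n)) : AEStronglyMeasurable (pathIntegral n h) pathLaw :=
  aestronglyMeasurable_of_tendsto_ae atTop (fun M => (memLp_partialIntegral hh.memLp M).1)
    (tendsto_partialIntegral_ae hh hi)

/-! ### L²-limits and extension by continuity -/

/-- `Z` is the limit in `L²` of the integrals of `f` over bounded regions. -/
structure IsPathLimit {n : ℕ} (f : (Fin n → ℝ) → ℝ) (Z : (ℕ → ℝ) → ℝ) : Prop where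
  memLp : MemLp Z 2 pathLaw
  tendsto : Tendsto (fun M => eLpNorm (partialIntegral M f - Z) 2 pathLaw) atTop (𝓝 0)

/-- Fatou: along a subsequence the partial integrals of `f` converge almost surely to `Z`, those of
`h` to the explicit integral, and their differences obey the uniform bound. -/
lemma eLpNorm_pathIntegral_sub_le {n : ℕ} {f h : (Fin n → ℝ) → ℝ} {Z : (ℕ → ℝ) → ℝ}
    (hf : MemLp f 2 (leb n)) (hZ : IsPathLimit f Z) (hh : MemHatL2 n h)
    (hi : Integrable h (leb n)) :
    eLpNorm (pathIntegral n h - Z) 2 pathLaw ≤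
      ((n ! : ℝ≥0∞) * 2 ^ n) * eLpNorm (h - f) 2 (leb n) := by
  obtain ⟨ns, hns, hlim⟩ := (tendstoInMeasure_of_tendsto_eLpNorm (by norm_num)
    (fun M => (memLp_partialIntegral hf M).1) hZ.memLp.1 hZ.tendsto).exists_seq_tendsto_ae
  have hlim2 : ∀ᵐ x ∂pathLaw, Tendsto
      (fun k => (partialIntegral (ns k) h - partialIntegral (ns k) f) x) atTop
      (𝓝 ((pathIntegral n h - Z) x)) := by
    filter_upwards [hlim, tendsto_partialIntegral_ae hh hi] with x h1 h2
    exact (h2.comp hns.tendsto_atTop).sub h1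
  refine (Lp.eLpNorm_lim_le_liminf_eLpNorm (fun k => ((memLp_partialIntegral hh.memLp _).sub
    (memLp_partialIntegral hf _)).1) _ hlim2).trans ?_
  refine liminf_le_of_le (by isBoundedDefault) fun b hb => ?_
  obtain ⟨k, hk⟩ := hb.exists
  refine hk.trans ?_
  rw [eLpNorm_congr_ae (partialIntegral_sub hh.memLp hf (ns k)).symm, mul_assoc]
  exact eLpNorm_partialIntegral_le (hh.memLp.sub hf) _

/-- Square integrable functions can be approximated by integrable ones inside `L̂²`. -/
lemma exists_integrable_approx {n : ℕ} {f : (Fin n → ℝ) → ℝ} (hf : MemHatL2 n f) {δ : ℝ≥0∞}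
    (hδ : 0 < δ) : ∃ h, MemHatL2 n h ∧ Integrable h (leb n) ∧
      eLpNorm (h - f) 2 (leb n) ≤ δ := by
  -- Small values of `f` are cut off. Where |f| ≥ c one has |f| ≤ f²/c, which gives integrability;
  -- acting on the values alone preserves symmetry and vanishing off `offDiag n`.
  set c : ℕ → ℝ := fun k => 1 / ((k : ℝ) + 1) with hc
  have hcpos : ∀ k, 0 < c k := fun k => by positivity
  set g : ℕ → ℝ → ℝ := fun k t => if c k ≤ |t| then t else 0 with hg
  have hgm : ∀ k, Measurable (g k) := fun k =>
    Measurable.ite (measurableSet_le measurable_const measurable_id.abs) measurable_id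
      measurable_const
  have hgle : ∀ k t, ‖g k t‖ ≤ ‖t‖ := fun k t => by
    simp only [hg]; split_ifs <;> simp
  have hgsub : ∀ k t, ‖g k t - t‖ ≤ ‖t‖ := fun k t => by
    simp only [hg]; split_ifs <;> simp
  have hm : ∀ k, AEStronglyMeasurable (fun x => g k (f x)) (leb n) := fun k =>
    ((hgm k).comp_aemeasurable hf.memLp.1.aemeasurable).aestronglyMeasurable
  have hLp : ∀ k, MemLp (fun x => g k (f x)) 2 (leb n) := fun k =>
    hf.memLp.of_le (hm k) (Eventually.of_forall fun x => hgle k _)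
  have hhat : ∀ k, MemHatL2 n (fun x => g k (f x)) := fun k => by
    refine ⟨hLp k, fun σ => ?_, ?_⟩
    · filter_upwards [hf.symmetric σ] with x hx
      rw [hx]
    · filter_upwards [hf.vanish] with x hx hx'
      rw [hx hx']
      simp [hg]
  have hint : ∀ k, Integrable (fun x => g k (f x)) (leb n) := fun k => by
    refine (hf.memLp.integrable_sq.const_mul (c k)⁻¹).mono' (hm k) (Eventually.of_forall fun x => ?_)
    simp only [hg]
    split_ifs with h1
    · rw [Real.norm_eq_abs, ← sq_abs, inv_mul_eq_div, le_div_iff₀ (hcpos k)]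
      nlinarith [abs_nonneg (f x)]
    · have := hcpos k
      simp only [norm_zero]; positivity
  have hlim : Tendsto (fun k => ∫⁻ x, ‖g k (f x) - f x‖ₑ ^ (2 : ℝ) ∂leb n) atTop (𝓝 0) := by
    have hfin : ∫⁻ x, ‖f x‖ₑ ^ (2 : ℝ) ∂leb n ≠ ⊤ := by
      have e2 := eLpNorm_nnreal_pow_eq_lintegral (f := f) (μ := leb n) (p := 2) (by norm_num)
      simp only [NNReal.coe_ofNat, ENNReal.coe_ofNat] at e2
      rw [← e2]
      exact ENNReal.rpow_ne_top_of_nonneg (by norm_num) hf.memLp.2.ne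
    have h0 : (0 : ℝ≥0∞) = ∫⁻ _ : Fin n → ℝ, (0 : ℝ≥0∞) ∂leb n := by simp
    rw [h0]
    refine tendsto_lintegral_of_dominated_convergence' (fun x => ‖f x‖ₑ ^ (2 : ℝ))
      (fun k => (((hm k).sub hf.memLp.1).enorm).pow_const _)
      (fun k => Eventually.of_forall fun x => ?_) hfin (Eventually.of_forall fun x => ?_)
    · refine ENNReal.rpow_le_rpow ?_ (by norm_num)
      rw [enorm_le_iff_norm_le]; exact hgsub k _
    · refine tendsto_const_nhds.congr' ?_
      by_cases hx : f x = 0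
      · exact Eventually.of_forall fun k => by simp [hg, hx]
      · have : Tendsto c atTop (𝓝 0) := tendsto_one_div_add_atTop_nhds_zero_nat
        filter_upwards [this.eventually (ge_mem_nhds (abs_pos.2 hx))] with k hk
        simp [hg, hk]
  have hδ2 : 0 < δ ^ (2 : ℝ) := ENNReal.rpow_pos_of_nonneg hδ (by norm_num)
  obtain ⟨k, hk⟩ := (hlim.eventually (ge_mem_nhds hδ2)).exists
  refine ⟨_, hhat k, hint k, ?_⟩
  rw [← ENNReal.rpow_le_rpow_iff (z := 2) (by norm_num)]
  have e2 := eLpNorm_nnreal_pow_eq_lintegral (f := (fun x => g k (f x)) - f) (μ := leb n) (p := 2)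
    (by norm_num)
  simp only [NNReal.coe_ofNat, ENNReal.coe_ofNat] at e2
  rw [e2]
  exact hk

/-! ### Transfer to the original probability space -/

section Probability

variable {Ω : Type*} [MeasurableSpace Ω] {P : Measure Ω} [IsProbabilityMeasure P]
  {U : ℕ → Ω → ℝ}

lemma isMultipleIntegral_of_isPathLimit (hU : IsIIDUniform P U) {n : ℕ} {f : (Fin n → ℝ) → ℝ}
    (hf : MemHatL2 n f) {Z : (ℕ → ℝ) → ℝ} (hZ : IsPathLimit f Z) :
    IsMultipleIntegral P U n f (fun ω => Z (fun k => jumpTime U k ω)) := by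
  have hX := measurePreserving_jumpTime hU
  refine ⟨hZ.memLp.comp_measurePreserving hX, fun δ hδ => exists_integrable_approx hf hδ,
    fun ε hε => ?_⟩
  have hC : ((n ! : ℝ≥0∞) * 2 ^ n) ≠ ⊤ := by finiteness
  refine ⟨ε / ((n ! : ℝ≥0∞) * 2 ^ n), ENNReal.div_pos hε.ne' hC, fun h hh hi hle => ?_⟩
  have e1 : elemIntegral U n h - (fun ω => Z (fun k => jumpTime U k ω)) =
      (pathIntegral n h - Z) ∘ (fun ω k => jumpTime U k ω) := rfl
  rw [e1, eLpNorm_comp_measurePreserving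
    ((aestronglyMeasurable_pathIntegral hh hi).sub hZ.memLp.1) hX]
  calc _ ≤ _ := eLpNorm_pathIntegral_sub_le hf.memLp hZ hh hi
    _ ≤ ((n ! : ℝ≥0∞) * 2 ^ n) * (ε / ((n ! : ℝ≥0∞) * 2 ^ n)) := by gcongr
    _ ≤ ε := ENNReal.mul_div_le

/-- A single approximant close enough to `f` for both candidates puts them within 2ε of each other.
-/
lemma IsMultipleIntegral.ae_eq (hU : IsIIDUniform P U) {n : ℕ} {f : (Fin n → ℝ) → ℝ}
    {Z Z' : Ω → ℝ} (hZ : IsMultipleIntegral P U n f Z) (hZ' : IsMultipleIntegral P U n f Z') :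
    Z =ᵐ[P] Z' := by
  have hX := measurePreserving_jumpTime hU
  have key : ∀ ε : ℝ≥0∞, 0 < ε → eLpNorm (Z - Z') 2 P ≤ ε + ε := by
    intro ε hε
    obtain ⟨δ, hδ, h1⟩ := hZ.tendsto ε hε
    obtain ⟨δ', hδ', h2⟩ := hZ'.tendsto ε hε
    obtain ⟨h, hh, hi, hle⟩ := hZ.approx (min δ δ') (lt_min hδ hδ')
    have hm : AEStronglyMeasurable (elemIntegral U n h) P := by
      have e0 : elemIntegral U n h = pathIntegral n h ∘ fun ω k => jumpTime U k ω := rfl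
      rw [e0]
      exact (aestronglyMeasurable_pathIntegral hh hi).comp_measurePreserving hX
    have b1 := h1 h hh hi (hle.trans (min_le_left _ _))
    have b2 := h2 h hh hi (hle.trans (min_le_right _ _))
    generalize elemIntegral U n h = E at hm b1 b2
    have e : Z - Z' = (E - Z') - (E - Z) := by abel
    rw [e]
    exact (eLpNorm_sub_le (hm.sub hZ'.memLp.1) (hm.sub hZ.memLp.1) (by norm_num)).trans
      (add_le_add b2 b1)
  have hzero : eLpNorm (Z - Z') 2 P = 0 := by
    by_contra hne
    have hpos : 0 < eLpNorm (Z - Z') 2 P := pos_iff_ne_zero.2 hne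
    have hfin : eLpNorm (Z - Z') 2 P ≠ ⊤ := (hZ.memLp.sub hZ'.memLp).2.ne
    -- A quarter of the distance as ε would bound the distance by half of itself.
    have h3 := key (eLpNorm (Z - Z') 2 P / 4) (ENNReal.div_pos hne (by norm_num))
    have h4 : (eLpNorm (Z - Z') 2 P).toReal ≤
        (eLpNorm (Z - Z') 2 P / 4 + eLpNorm (Z - Z') 2 P / 4).toReal :=
      ENNReal.toReal_mono (by finiteness) h3
    have h5 : 0 < (eLpNorm (Z - Z') 2 P).toReal := ENNReal.toReal_pos hne hfin
    rw [ENNReal.toReal_add (by finiteness) (by finiteness), ENNReal.toReal_div] at h4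
    norm_num at h4
    linarith
  have := (eLpNorm_eq_zero_iff (hZ.memLp.sub hZ'.memLp).1 (by norm_num)).1 hzero
  filter_upwards [this] with ω hω
  exact sub_eq_zero.1 hω

lemma exists_isPathLimit {n : ℕ} {f : (Fin n → ℝ) → ℝ} (hf : MemLp f 2 (leb n)) :
    ∃ Z, IsPathLimit f Z := by
  obtain ⟨Z, h1, h2⟩ := exists_tendsto_partialIntegral hf
  exact ⟨Z, h1, h2⟩

lemma isMultipleIntegral_multipleIntegral (hU : IsIIDUniform P U) {n : ℕ}
    {f : (Fin n → ℝ) → ℝ} (hf : MemHatL2 n f) :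
    IsMultipleIntegral P U n f (multipleIntegral P U n f) := by
  obtain ⟨Z, hZ⟩ := exists_isPathLimit hf.memLp
  have h : ∃ Z, IsMultipleIntegral P U n f Z := ⟨_, isMultipleIntegral_of_isPathLimit hU hf hZ⟩
  rw [multipleIntegral, dif_pos h]
  exact h.choose_spec

lemma multipleIntegral_ae_eq (hU : IsIIDUniform P U) {n : ℕ}
    {f : (Fin n → ℝ) → ℝ} (hf : MemHatL2 n f) {Z : (ℕ → ℝ) → ℝ} (hZ : IsPathLimit f Z) :
    multipleIntegral P U n f =ᵐ[P] fun ω => Z (fun k => jumpTime U k ω) :=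
  (isMultipleIntegral_multipleIntegral hU hf).ae_eq hU (isMultipleIntegral_of_isPathLimit hU hf hZ)

end Probability

/-! ### Pairing with test functions -/

/-- Multiplication by the bounded `w` is continuous on L², and the integral is the inner product of
`a M` with `b M * w`. -/
lemma tendsto_integral_mul_mul {a b : ℕ → (ℕ → ℝ) → ℝ} {a' b' w : (ℕ → ℝ) → ℝ}
    (ha : ∀ M, MemLp (a M) 2 pathLaw) (hb : ∀ M, MemLp (b M) 2 pathLaw)
    (ha' : MemLp a' 2 pathLaw) (hb' : MemLp b' 2 pathLaw)
    (hw : AEStronglyMeasurable w pathLaw) (hw1 : ∀ x, ‖w x‖ ≤ 1)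
    (hla : Tendsto (fun M => eLpNorm (a M - a') 2 pathLaw) atTop (𝓝 0))
    (hlb : Tendsto (fun M => eLpNorm (b M - b') 2 pathLaw) atTop (𝓝 0)) :
    Tendsto (fun M => ∫ x, a M x * b M x * w x ∂pathLaw) atTop
      (𝓝 (∫ x, a' x * b' x * w x ∂pathLaw)) := by
  have hbw : ∀ {u : (ℕ → ℝ) → ℝ}, MemLp u 2 pathLaw → MemLp (u * w) 2 pathLaw := fun {u} hu =>
    hu.of_le (hu.1.mul hw) (Eventually.of_forall fun x => by
      rw [Pi.mul_apply, norm_mul]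
      exact mul_le_of_le_one_right (norm_nonneg _) (hw1 x))
  have h1 := (Lp.tendsto_Lp_iff_tendsto_eLpNorm'' a ha a' ha').2 hla
  have h2 := (Lp.tendsto_Lp_iff_tendsto_eLpNorm'' (fun M => b M * w) (fun M => hbw (hb M)) (b' * w)
    (hbw hb')).2 (by
      refine tendsto_of_tendsto_of_tendsto_of_le_of_le tendsto_const_nhds hlb
        (fun _ => zero_le) fun M => ?_
      refine eLpNorm_mono fun x => ?_
      rw [Pi.sub_apply, Pi.mul_apply, Pi.mul_apply, ← sub_mul, norm_mul]
      exact mul_le_of_le_one_right (norm_nonneg _) (hw1 x))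
  have hin : ∀ {u v : (ℕ → ℝ) → ℝ} (hu : MemLp u 2 pathLaw) (hv : MemLp v 2 pathLaw),
      inner ℝ hu.toLp (hbw hv).toLp = ∫ x, u x * v x * w x ∂pathLaw := by
    intro u v hu hv
    rw [L2.inner_def]
    refine integral_congr_ae ?_
    filter_upwards [hu.coeFn_toLp, (hbw hv).coeFn_toLp] with x e1 e2
    rw [e1, e2]
    simp; ring
  have h3 := h1.inner h2 (𝕜 := ℝ)
  rw [hin ha' hb'] at h3
  exact h3.congr fun M => hin (ha M) (hb M)

/-- If `B ≠ S`, a coordinate in only one of them kills the pairing. If `B = S`, every term resampled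
over a nonempty `A` is independent of some coordinate in which the test function is centred, so only
`A = ∅` is left. -/
lemma integral_boxTerm_mul_testFn {n : ℕ} {f : (Fin n → ℝ) → ℝ} (hf : MemLp f 2 (leb n))
    {ψ : ℕ → ℝ → ℝ} (hψ : IsTest ψ) (B S : Finset ℕ) :
    ∫ x, boxTerm f B x * testFn ψ S x ∂pathLaw =
      if B = S then ∫ x, sect f S x * testFn ψ S x ∂pathLaw else 0 := by
  have hsi : Integrable (sect f B) pathLaw := (memLp_sect hf B).integrable (by norm_num)
  have hbi : Integrable (boxTerm f B) pathLaw := integrable_centerPart hsi B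
  by_cases hBS : B = S
  · subst hBS
    rw [if_pos rfl]
    have e1 : ∀ x, boxTerm f B x * testFn ψ B x =
        ∑ A ∈ B.powerset, (-1 : ℝ) ^ A.card * (resample A (sect f B) x * testFn ψ B x) := by
      intro x
      rw [boxTerm, centerPart, Finset.sum_mul]
      exact Finset.sum_congr rfl fun A _ => by ring
    simp_rw [e1]
    rw [integral_finsetSum _ fun A _ =>
      (hψ.integrable_mul B (integrable_resample hsi A)).const_mul _]
    rw [Finset.sum_eq_single ∅]
    · simp [resample_empty]
    · intro A hA hne
      obtain ⟨k, hk⟩ := Finset.nonempty_iff_ne_empty.2 hne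
      rw [integral_const_mul]
      simp_rw [mul_comm (resample A (sect f B) _)]
      rw [integral_mul_eq_zero (hψ.isCentered (Finset.mem_powerset.1 hA hk))
        ((dependsOn_resample_compl _ A).mono fun j hj => ?_), mul_zero]
      · have := hψ.integrable_mul B (integrable_resample hsi A)
        exact this.congr (Eventually.of_forall fun x => mul_comm _ _)
      · rintro rfl; exact hj hk
    · simp
  · rw [if_neg hBS]
    have hcase : (∃ k ∈ B, k ∉ S) ∨ (∃ k ∈ S, k ∉ B) := by
      by_contra hc
      push Not at hc
      exact hBS (Finset.Subset.antisymm hc.1 hc.2)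
    rcases hcase with ⟨k, hk, hk'⟩ | ⟨k, hk, hk'⟩
    · exact integral_mul_eq_zero (isCentered_centerPart hsi hk)
        (dependsOn_compl_singleton (dependsOn_testFn ψ S) hk') (hψ.integrable_mul S hbi)
    · simp_rw [mul_comm (boxTerm f B _)]
      refine integral_mul_eq_zero (hψ.isCentered hk)
        (dependsOn_compl_singleton (dependsOn_boxTerm f B) hk') ?_
      exact (hψ.integrable_mul S hbi).congr (Eventually.of_forall fun x => mul_comm _ _)

/-- Once `S ⊆ range M`, the pairings of the partial integrals no longer depend on `M`: only the box
term of `S` contributes. -/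
lemma IsPathLimit.integral_mul_testFn {n : ℕ} {f : (Fin n → ℝ) → ℝ} (hf : MemLp f 2 (leb n))
    {Z : (ℕ → ℝ) → ℝ} (hZ : IsPathLimit f Z) {ψ : ℕ → ℝ → ℝ} (hψ : IsTest ψ) (S : Finset ℕ) :
    ∫ x, Z x * testFn ψ S x ∂pathLaw = n ! * ∫ x, sect f S x * testFn ψ S x ∂pathLaw := by
  have h1 := tendsto_integral_mul_mul (a := fun M => partialIntegral M f) (b := fun _ _ => 1)
    (b' := fun _ => 1)
    (memLp_partialIntegral hf) (fun _ => memLp_const 1) hZ.memLp (memLp_const 1)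
    (hψ.measurable_testFn S).aestronglyMeasurable (hψ.norm_testFn_le S) hZ.tendsto (by simp)
  simp only [mul_one] at h1
  refine tendsto_nhds_unique h1 (tendsto_const_nhds.congr' ?_)
  obtain ⟨N, hN⟩ := S.exists_nat_subset_range
  filter_upwards [eventually_ge_atTop N] with M hM
  have hS : S ∈ (Finset.range M).powerset :=
    Finset.mem_powerset.2 (hN.trans (Finset.range_mono hM))
  have e1 : ∀ x, partialIntegral M f x * testFn ψ S x =
      ∑ B ∈ (Finset.range M).powerset, (n ! : ℝ) * (boxTerm f B x * testFn ψ S x) := by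
    intro x
    rw [partialIntegral, mul_assoc, Finset.sum_mul, Finset.mul_sum]
  simp_rw [e1]
  rw [integral_finsetSum _ fun B _ => (hψ.integrable_mul S
    ((memLp_boxTerm hf B).integrable (by norm_num))).const_mul _]
  simp_rw [integral_const_mul, integral_boxTerm_mul_testFn hf hψ]
  simp [hS]

/-- Canonicity concerns the first variable; by symmetry the coordinate `k` may be placed there, and
resampling it is averaging over its box. -/
lemma isCentered_sect {n : ℕ} {f : (Fin n → ℝ) → ℝ} (hf : MemHatL2 n f) (hfc : IsCanonical n f)
    {k : ℕ} {B : Finset ℕ} (hk : k ∈ B) : IsCentered k (sect f B) := by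
  by_cases hB : B.card = n
  swap
  · rw [sect_of_card_ne f hB]
    exact Eventually.of_forall fun x => by simp [resample]
  obtain _ | m := n
  · rw [Finset.card_eq_zero] at hB
    simp [hB] at hk
  have hD : (B.erase k).card = m := by rw [Finset.card_erase_of_mem hk, hB]; simp
  set κ : Fin m → ℕ := fun j => (B.erase k).orderEmbOfFin hD j with hκ
  have hκinj : Function.Injective κ := ((B.erase k).orderEmbOfFin hD).injective
  set e : Fin (m + 1) → Fin 1 ⊕ ℕ := Fin.cons (Sum.inl 0) fun j => Sum.inr (κ j) with he
  have heinj : Function.Injective e := by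
    refine Fin.cons_injective_iff.2 ⟨by simp, Sum.inr_injective.comp hκinj⟩
  have hl : ∀ a, ∃ j, e j = Sum.inl a := fun a => ⟨0, by
    rw [Subsingleton.elim a 0]; simp [he]⟩
  have hDe : ∀ b, (∃ j, e j = Sum.inr b) ↔ b ∈ B.erase k := by
    intro b
    have hr : b ∈ B.erase k ↔ b ∈ Set.range κ := by
      rw [hκ]; exact (Set.ext_iff.1 ((B.erase k).range_orderEmbOfFin hD) b).symm
    rw [hr, Fin.exists_fin_succ]
    simp [he]
  have hbox := integral_mix_box hf heinj hl _ hDe (fun _ => k)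
  have him : Finset.univ.image (fun _ : Fin 1 => k) = {k} := by simp
  have hun : B.erase k ∪ {k} = B := by
    rw [Finset.union_comm, ← Finset.insert_eq, Finset.insert_erase hk]
  rw [him, hun] at hbox
  filter_upwards [hbox, ae_comp_of_ae_leb (hfc k) hκinj] with x hx1 hx2
  rw [← hx1]
  have hmix : ∀ z : Fin 1 → ℝ, f (mix e z x) =
      (fun t => f (Fin.cons t (fun j => x (κ j)) : Fin (m + 1) → ℝ))
        (MeasurableEquiv.funUnique (Fin 1) ℝ z) := by
    intro z
    simp only
    congr 1
    funext j
    refine Fin.cases ?_ (fun j => ?_) j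
    · simp [mix, he]
    · simp [mix, he]
  simp_rw [hmix]
  have key : ∫ z : Fin 1 → ℝ, f (Fin.cons (MeasurableEquiv.funUnique (Fin 1) ℝ z)
        (fun j => x (κ j)) : Fin (m + 1) → ℝ) ∂(Measure.pi fun _ => boxLaw k) =
      ∫ t, f (Fin.cons t (fun j => x (κ j)) : Fin (m + 1) → ℝ) ∂boxLaw k := by
    convert (measurePreserving_funUnique (boxLaw k) (Fin 1)).integral_comp'
      (g := fun t => f (Fin.cons t (fun j => x (κ j)) : Fin (m + 1) → ℝ))
  rw [key, boxLaw, integral_smul_measure, integral_Icc_eq_integral_Ioc,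
    ← intervalIntegral.integral_of_le (by linarith), hx2]
  simp

lemma boxTerm_ae_eq_sect {n : ℕ} {f : (Fin n → ℝ) → ℝ} (hf : MemHatL2 n f)
    (hfc : IsCanonical n f) (B : Finset ℕ) : boxTerm f B =ᵐ[pathLaw] sect f B :=
  centerPart_eq_self ((memLp_sect hf.memLp B).integrable (by norm_num))
    fun _ hk => isCentered_sect hf hfc hk

/-! ### Pairing products of sections with test functions -/

section Pairing

variable {n m : ℕ} (f : (Fin n → ℝ) → ℝ) (g : (Fin m → ℝ) → ℝ) (ψ : ℕ → ℝ → ℝ) (S : Finset ℕ)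

/-- The pairing of the product of two sections with a test function. -/
def pairing (A B : Finset ℕ) : ℝ := ∫ x, sect f A x * sect g B x * testFn ψ S x ∂pathLaw

/-- The pairing when the two sections share the coordinates in `Z`, outside of `S`. -/
def sharedPairing (V W Z : Finset ℕ) : ℝ :=
  if Disjoint Z S then pairing f g ψ S (Z ∪ V) (Z ∪ W) else 0

/-- The sum of the pairings over all sets of shared coordinates outside of `S`. -/
def totalPairing (V W : Finset ℕ) : ℝ := ∑' Z, sharedPairing f g ψ S V W Z

variable {f g ψ S}

lemma pairing_of_card_ne_left {A B : Finset ℕ} (hA : A.card ≠ n) : pairing f g ψ S A B = 0 := by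
  simp [pairing, sect_of_card_ne f hA]

lemma pairing_of_card_ne_right {A B : Finset ℕ} (hB : B.card ≠ m) : pairing f g ψ S A B = 0 := by
  simp [pairing, sect_of_card_ne g hB]

lemma integrable_sect_mul_sect (hf : MemLp f 2 (leb n)) (hg : MemLp g 2 (leb m))
    (A B : Finset ℕ) : Integrable (fun x => sect f A x * sect g B x) pathLaw :=
  (memLp_sect hf A).integrable_mul (memLp_sect hg B)

/-- Each of the three factors is centred in its own coordinates. A coordinate occurring in exactly
one of them makes the expectation zero. -/
lemma pairing_eq_zero (hf : MemHatL2 n f) (hfc : IsCanonical n f) (hg : MemHatL2 m g)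
    (hgc : IsCanonical m g) (hψ : IsTest ψ) {A B : Finset ℕ}
    (h : ¬ (A \ B ⊆ S ∧ B \ A ⊆ S ∧ S ⊆ A ∪ B)) : pairing f g ψ S A B = 0 := by
  have hint := hψ.integrable_mul S (integrable_sect_mul_sect hf.memLp hg.memLp A B)
  have hcase : (∃ k ∈ A, k ∉ B ∧ k ∉ S) ∨ (∃ k ∈ B, k ∉ A ∧ k ∉ S) ∨
      (∃ k ∈ S, k ∉ A ∧ k ∉ B) := by
    by_contra hc
    push Not at hc
    obtain ⟨h1, h2, h3⟩ := hc
    refine h ⟨fun k hk => ?_, fun k hk => ?_, fun k hk => ?_⟩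
    · rw [Finset.mem_sdiff] at hk; exact h1 k hk.1 hk.2
    · rw [Finset.mem_sdiff] at hk; exact h2 k hk.1 hk.2
    · rw [Finset.mem_union]
      by_contra hc
      push Not at hc
      exact hc.2 (h3 k hk hc.1)
  unfold pairing
  rcases hcase with ⟨k, hk, h1, h2⟩ | ⟨k, hk, h1, h2⟩ | ⟨k, hk, h1, h2⟩
  · have e : ∀ x, sect f A x * sect g B x * testFn ψ S x =
        sect f A x * (sect g B * testFn ψ S) x := fun x => by rw [Pi.mul_apply, mul_assoc]
    simp_rw [e] at hint ⊢
    exact integral_mul_eq_zero (isCentered_sect hf hfc hk)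
      (dependsOn_mul (dependsOn_compl_singleton (dependsOn_sect g B) h1)
        (dependsOn_compl_singleton (dependsOn_testFn ψ S) h2)) hint
  · have e : ∀ x, sect f A x * sect g B x * testFn ψ S x =
        sect g B x * (sect f A * testFn ψ S) x := fun x => by rw [Pi.mul_apply]; ring
    simp_rw [e] at hint ⊢
    exact integral_mul_eq_zero (isCentered_sect hg hgc hk)
      (dependsOn_mul (dependsOn_compl_singleton (dependsOn_sect f A) h1)
        (dependsOn_compl_singleton (dependsOn_testFn ψ S) h2)) hint
  · have e : ∀ x, sect f A x * sect g B x * testFn ψ S x =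
        testFn ψ S x * (sect f A * sect g B) x := fun x => by rw [Pi.mul_apply]; ring
    simp_rw [e] at hint ⊢
    exact integral_mul_eq_zero (hψ.isCentered hk)
      (dependsOn_mul (dependsOn_compl_singleton (dependsOn_sect f A) h1)
        (dependsOn_compl_singleton (dependsOn_sect g B) h2)) hint

lemma summable_integral_sect_sq (hf : MemLp f 2 (leb n)) :
    Summable fun A => ∫ x, sect f A x ^ 2 ∂pathLaw := by
  have hfin : ∑' A, ∫⁻ x, ‖sect f A x‖ₑ ^ (2 : ℝ) ∂pathLaw ≠ ⊤ := by
    refine ne_top_of_le_ne_top ?_ (tsum_lintegral_sect_le hf.1 (by norm_num))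
    have e2 := eLpNorm_nnreal_pow_eq_lintegral (f := f) (μ := leb n) (p := 2) (by norm_num)
    simp only [NNReal.coe_ofNat, ENNReal.coe_ofNat] at e2
    rw [← e2]
    exact ENNReal.rpow_ne_top_of_nonneg (by norm_num) hf.2.ne
  refine (ENNReal.summable_toReal hfin).congr fun A => ?_
  rw [integral_eq_lintegral_of_nonneg_ae (Eventually.of_forall fun x => sq_nonneg _)
    ((memLp_sect hf A).1.pow 2)]
  congr 1
  refine lintegral_congr fun x => ?_
  rw [← ofReal_norm, ENNReal.rpow_ofNat, ← ENNReal.ofReal_pow (norm_nonneg _), Real.norm_eq_abs,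
    sq_abs]

lemma abs_pairing_le (hf : MemLp f 2 (leb n)) (hg : MemLp g 2 (leb m)) (hψ : IsTest ψ)
    (A B : Finset ℕ) : |pairing f g ψ S A B| ≤
      ∫ x, sect f A x ^ 2 ∂pathLaw + ∫ x, sect g B x ^ 2 ∂pathLaw := by
  have hfi := (memLp_sect hf A).integrable_sq
  have hgi := (memLp_sect hg B).integrable_sq
  rw [← integral_add hfi hgi, ← Real.norm_eq_abs]
  refine norm_integral_le_of_norm_le (hfi.add hgi) (Eventually.of_forall fun x => ?_)
  rw [norm_mul]
  refine (mul_le_of_le_one_right (norm_nonneg _) (hψ.norm_testFn_le S x)).trans ?_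
  rw [Real.norm_eq_abs, abs_le]
  constructor <;> nlinarith [sq_nonneg (sect f A x + sect g B x),
    sq_nonneg (sect f A x - sect g B x), sq_nonneg (sect f A x), sq_nonneg (sect g B x)]

lemma symmDiff_eq_union {Z V : Finset ℕ} (h : Disjoint Z V) : symmDiff Z V = Z ∪ V := by
  rw [h.symmDiff_eq_sup]; rfl

lemma summable_sharedPairing (hf : MemLp f 2 (leb n)) (hg : MemLp g 2 (leb m)) (hψ : IsTest ψ)
    {V W : Finset ℕ} (hV : V ⊆ S) (hW : W ⊆ S) : Summable (sharedPairing f g ψ S V W) := by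
  -- For `Z` disjoint from `S` the union with `V` is the symmetric difference, which unlike the
  -- union is injective in `Z` without restriction.
  have hinj : ∀ V : Finset ℕ, Function.Injective fun Z => symmDiff Z V := fun V =>
    symmDiff_left_injective V
  have h1 := (summable_integral_sect_sq hf).comp_injective (hinj V)
  have h2 := (summable_integral_sect_sq hg).comp_injective (hinj W)
  refine Summable.of_norm_bounded (h1.add h2) fun Z => ?_
  unfold sharedPairing
  split_ifs with hZ
  · simp only [Function.comp_apply]
    rw [symmDiff_eq_union (hZ.mono_right hV), symmDiff_eq_union (hZ.mono_right hW)]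
    exact abs_pairing_le hf hg hψ _ _
  · rw [norm_zero]
    exact add_nonneg (integral_nonneg fun x => sq_nonneg _) (integral_nonneg fun x => sq_nonneg _)

lemma union_inter_eq_right {Z V S : Finset ℕ} (hZ : Disjoint Z S) (hV : V ⊆ S) :
    (Z ∪ V) ∩ S = V := by
  rw [Finset.union_inter_distrib_right, Finset.disjoint_iff_inter_eq_empty.1 hZ,
    Finset.inter_eq_left.2 hV, Finset.empty_union]

lemma union_sdiff_eq_left {Z V S : Finset ℕ} (hZ : Disjoint Z S) (hV : V ⊆ S) :
    (Z ∪ V) \ S = Z := by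
  rw [Finset.union_sdiff_distrib, Finset.sdiff_eq_self_of_disjoint hZ,
    Finset.sdiff_eq_empty_iff_subset.2 hV, Finset.union_empty]

/-- For a nonvanishing pair, `A` and `B` agree outside `S`, so `(A, B)` is recovered from `A ∩ S`,
`B ∩ S` and the common part `A \ S`. -/
lemma sum_pairing_eq (hf : MemHatL2 n f) (hfc : IsCanonical n f) (hg : MemHatL2 m g)
    (hgc : IsCanonical m g) (hψ : IsTest ψ) {M : ℕ} (hM : S ⊆ Finset.range M) :
    ∑ q ∈ (Finset.range M).powerset ×ˢ (Finset.range M).powerset, pairing f g ψ S q.1 q.2 =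
      ∑ q ∈ S.powerset ×ˢ S.powerset, ∑ Z ∈ (Finset.range M).powerset,
        sharedPairing f g ψ S q.1 q.2 Z := by
  rw [← Finset.sum_product']
  have hfil : ∀ q ∈ (S.powerset ×ˢ S.powerset) ×ˢ (Finset.range M).powerset,
      q ∉ ((S.powerset ×ˢ S.powerset) ×ˢ (Finset.range M).powerset).filter
        (fun q => Disjoint q.2 S) → sharedPairing f g ψ S q.1.1 q.1.2 q.2 = 0 := by
    intro q hq hq'
    rw [sharedPairing, if_neg fun h => hq' (Finset.mem_filter.2 ⟨hq, h⟩)]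
  rw [← Finset.sum_subset (Finset.filter_subset _ _) hfil]
  symm
  refine Finset.sum_of_injOn (fun q => (q.2 ∪ q.1.1, q.2 ∪ q.1.2)) ?_ ?_ ?_ ?_
  · rintro ⟨⟨V, W⟩, Z⟩ hq ⟨⟨V', W'⟩, Z'⟩ hq' heq
    simp only [Finset.coe_filter, Finset.mem_product, Finset.mem_powerset, Set.mem_ofPred_eq]
      at hq hq'
    simp only [Prod.mk.injEq] at heq
    have e1 : V = V' := by
      rw [← union_inter_eq_right hq.2 hq.1.1.1, ← union_inter_eq_right hq'.2 hq'.1.1.1, heq.1]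
    have e2 : W = W' := by
      rw [← union_inter_eq_right hq.2 hq.1.1.2, ← union_inter_eq_right hq'.2 hq'.1.1.2, heq.2]
    have e3 : Z = Z' := by
      rw [← union_sdiff_eq_left hq.2 hq.1.1.1, ← union_sdiff_eq_left hq'.2 hq'.1.1.1, heq.1]
    rw [e1, e2, e3]
  · rintro ⟨⟨V, W⟩, Z⟩ hq
    simp only [Finset.coe_filter, Finset.mem_product, Finset.mem_powerset, Set.mem_ofPred_eq]
      at hq
    simp only [Finset.coe_product, Set.mem_prod, Finset.mem_coe, Finset.mem_powerset]
    exact ⟨Finset.union_subset hq.1.2 (hq.1.1.1.trans hM),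
      Finset.union_subset hq.1.2 (hq.1.1.2.trans hM)⟩
  · rintro ⟨A, B⟩ hq hq'
    refine pairing_eq_zero hf hfc hg hgc hψ fun hgood => hq' ?_
    simp only [Finset.mem_product, Finset.mem_powerset] at hq
    refine ⟨((A ∩ S, B ∩ S), A \ S), ?_, ?_⟩
    · simp only [Finset.coe_filter, Finset.mem_product, Finset.mem_powerset, Set.mem_ofPred_eq]
      exact ⟨⟨⟨Finset.inter_subset_right, Finset.inter_subset_right⟩,
        Finset.sdiff_subset.trans hq.1⟩, Finset.sdiff_disjoint⟩
    · simp only [Prod.mk.injEq]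
      constructor
      · ext k; simp only [Finset.mem_union, Finset.mem_sdiff, Finset.mem_inter]; tauto
      · ext k
        have a1 := @hgood.1 k
        have a2 := @hgood.2.1 k
        simp only [Finset.mem_union, Finset.mem_sdiff, Finset.mem_inter] at a1 a2 ⊢
        tauto
  · rintro ⟨⟨V, W⟩, Z⟩ hq
    rw [sharedPairing, if_pos (Finset.mem_filter.1 hq).2]

/-- The pairing of the product of the multiple integrals of canonical functions with a test
function. -/
lemma integral_mul_mul_testFn (hf : MemHatL2 n f) (hfc : IsCanonical n f) (hg : MemHatL2 m g)
    (hgc : IsCanonical m g) (hψ : IsTest ψ) (S : Finset ℕ) {Y Z : (ℕ → ℝ) → ℝ}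
    (hY : IsPathLimit f Y)
    (hZ : IsPathLimit g Z) : ∫ x, Y x * Z x * testFn ψ S x ∂pathLaw =
      (n ! * m ! : ℝ) * ∑ q ∈ S.powerset ×ˢ S.powerset, totalPairing f g ψ S q.1 q.2 := by
  have h1 := tendsto_integral_mul_mul (memLp_partialIntegral hf.memLp)
    (memLp_partialIntegral hg.memLp) hY.memLp hZ.memLp
    (hψ.measurable_testFn S).aestronglyMeasurable (hψ.norm_testFn_le S) hY.tendsto hZ.tendsto
  refine tendsto_nhds_unique h1 ?_
  have h2 : Tendsto (fun M => (n ! * m ! : ℝ) * ∑ q ∈ S.powerset ×ˢ S.powerset,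
      ∑ Z ∈ (Finset.range M).powerset, sharedPairing f g ψ S q.1 q.2 Z) atTop
      (𝓝 ((n ! * m ! : ℝ) * ∑ q ∈ S.powerset ×ˢ S.powerset, totalPairing f g ψ S q.1 q.2)) := by
    refine (tendsto_finsetSum _ fun q hq => ?_).const_mul _
    rw [Finset.mem_product, Finset.mem_powerset, Finset.mem_powerset] at hq
    exact (summable_sharedPairing hf.memLp hg.memLp hψ hq.1 hq.2).hasSum.comp tendsto_powerset_range
  refine h2.congr' ?_
  obtain ⟨N, hN⟩ := S.exists_nat_subset_range
  filter_upwards [eventually_ge_atTop N] with M hM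
  rw [← sum_pairing_eq hf hfc hg hgc hψ (hN.trans (Finset.range_mono hM))]
  have e1 : ∀ᵐ x ∂pathLaw, partialIntegral M f x * partialIntegral M g x * testFn ψ S x =
      (n ! * m ! : ℝ) * ∑ q ∈ (Finset.range M).powerset ×ˢ (Finset.range M).powerset,
        sect f q.1 x * sect g q.2 x * testFn ψ S x := by
    filter_upwards [ae_all_iff.2 fun B => boxTerm_ae_eq_sect hf hfc B,
      ae_all_iff.2 fun B => boxTerm_ae_eq_sect hg hgc B] with x hx1 hx2
    simp only [partialIntegral, hx1, hx2]
    rw [← Finset.sum_mul, Finset.sum_product]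
    simp only
    rw [← Finset.sum_mul_sum]
    ring
  rw [integral_congr_ae e1, integral_const_mul, integral_finsetSum _ fun q _ =>
    hψ.integrable_mul S (integrable_sect_mul_sect hf.memLp hg.memLp q.1 q.2)]
  rfl

end Pairing

/-! ### Counting permutations that carry one pair of sets to another -/

section Counting

variable {α : Type*} [DecidableEq α]

/-- The membership pattern of a point with respect to two sets. -/
def pattern (V W : Finset α) (a : α) : Bool × Bool := (decide (a ∈ V), decide (a ∈ W))

lemma map_eq_iff_pattern {V W D E : Finset α} (σ : Equiv.Perm α) :
    (D.map σ.toEmbedding = V ∧ E.map σ.toEmbedding = W) ↔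
      pattern V W ∘ σ = pattern D E := by
  have key : ∀ A B : Finset α, A.map σ.toEmbedding = B ↔ ∀ a, σ a ∈ B ↔ a ∈ A := by
    intro A B
    constructor
    · rintro rfl a; simp
    · intro h
      ext b
      rw [Finset.mem_map_equiv, ← h, Equiv.apply_symm_apply]
  rw [key, key, funext_iff]
  simp only [Function.comp_apply, pattern, Prod.mk.injEq, decide_eq_decide]
  exact ⟨fun h a => ⟨h.1 a, h.2 a⟩, fun h => ⟨fun a => (h a).1, fun a => (h a).2⟩⟩

variable [Fintype α]

lemma card_pattern {V W : Finset α} (h : V ∪ W = Finset.univ) (b : Bool × Bool) :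
    Fintype.card {a // pattern V W a = b} =
      if b.1 then (if b.2 then (V ∩ W).card else (V \ W).card)
      else (if b.2 then (W \ V).card else 0) := by
  have hu : ∀ a, a ∈ V ∨ a ∈ W := fun a => by
    have : a ∈ V ∪ W := h ▸ Finset.mem_univ a
    simpa using this
  rw [Fintype.card_subtype]
  obtain ⟨b1, b2⟩ := b
  cases b1 <;> cases b2 <;> simp only [pattern, Prod.mk.injEq, decide_eq_true_eq,
    decide_eq_false_iff_not, if_true, Bool.false_eq_true, if_false]
  · rw [Finset.card_eq_zero, Finset.filter_eq_empty_iff]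
    intro a _ ha
    exact (hu a).elim ha.1 ha.2
  · congr 1; ext a; simp [and_comm]
  · congr 1; ext a; simp
  · congr 1; ext a; simp

lemma card_parts {V W D E : Finset α} (h : V ∪ W = Finset.univ) (hDE : D ∪ E = Finset.univ)
    (hV : V.card = D.card) (hW : W.card = E.card) :
    (V ∩ W).card = (D ∩ E).card ∧ (V \ W).card = (D \ E).card ∧
      (W \ V).card = (E \ D).card := by
  have h1 := Finset.card_union_add_card_inter V W
  have h2 := Finset.card_union_add_card_inter D E
  rw [h] at h1
  rw [hDE] at h2
  have h3 := Finset.card_sdiff_add_card_inter V W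
  have h4 := Finset.card_sdiff_add_card_inter D E
  have h5 := Finset.card_sdiff_add_card_inter W V
  have h6 := Finset.card_sdiff_add_card_inter E D
  rw [Finset.inter_comm] at h5 h6
  omega

/-- The permutations in question form a coset of the stabiliser of the membership pattern, and a
stabiliser permutes each fibre of the pattern freely. -/
lemma card_perm_map_eq {V W D E : Finset α} (h : V ∪ W = Finset.univ)
    (hDE : D ∪ E = Finset.univ) (hV : V.card = D.card) (hW : W.card = E.card) :
    (Finset.univ.filter fun σ : Equiv.Perm α =>
      D.map σ.toEmbedding = V ∧ E.map σ.toEmbedding = W).card =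
      (D ∩ E).card ! * (D \ E).card ! * (E \ D).card ! := by
  obtain ⟨c1, c2, c3⟩ := card_parts h hDE hV hW
  have hc : ∀ b, Fintype.card {a // pattern D E a = b} =
      Fintype.card {a // pattern V W a = b} := by
    intro b
    rw [card_pattern h, card_pattern hDE, c1, c2, c3]
  let σ₀ : Equiv.Perm α := Equiv.ofFiberEquiv fun b => Fintype.equivOfCardEq (hc b)
  have hσ₀ : pattern V W ∘ σ₀ = pattern D E := by
    funext a; exact Equiv.ofFiberEquiv_map _ a
  simp only [map_eq_iff_pattern]
  rw [← Fintype.card_subtype]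
  have e : {σ : Equiv.Perm α // pattern V W ∘ σ = pattern D E} ≃
      {σ : Equiv.Perm α // pattern D E ∘ σ = pattern D E} := by
    refine Equiv.subtypeEquiv (Equiv.mulLeft σ₀⁻¹) fun σ => ?_
    have : pattern D E ∘ ⇑(σ₀⁻¹ * σ) = pattern V W ∘ ⇑σ := by
      rw [← hσ₀]
      funext a
      simp
    rw [Equiv.coe_mulLeft, this]
  rw [Fintype.card_congr e, DomMulAct.stabilizer_card, Fintype.prod_prod_type]
  simp only [Fintype.prod_bool, card_pattern hDE]
  simp

/-- Every covering pair with the sizes of `D` and `E` is the image of `(D, E)` under the same number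
of permutations. -/
lemma sum_perm_map (D E : Finset α) (hDE : D ∪ E = Finset.univ) (H : Finset α → Finset α → ℝ) :
    ∑ σ : Equiv.Perm α, H (D.map σ.toEmbedding) (E.map σ.toEmbedding) =
      ((D ∩ E).card ! * (D \ E).card ! * (E \ D).card ! : ℕ) *
        ∑ q : Finset α × Finset α,
          if q.1.card = D.card ∧ q.2.card = E.card ∧ q.1 ∪ q.2 = Finset.univ then H q.1 q.2
          else 0 := by
  rw [← Finset.sum_filter]
  set T : Finset (Finset α × Finset α) := Finset.univ.filter fun q =>
    q.1.card = D.card ∧ q.2.card = E.card ∧ q.1 ∪ q.2 = Finset.univ with hT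
  have hmaps : ∀ σ ∈ (Finset.univ : Finset (Equiv.Perm α)),
      (D.map σ.toEmbedding, E.map σ.toEmbedding) ∈ T := by
    intro σ _
    simp only [hT, Finset.mem_filter, Finset.mem_univ, true_and, Finset.card_map]
    rw [← Finset.map_union, hDE, Finset.map_univ_equiv]
  rw [← Finset.sum_fiberwise_of_maps_to hmaps, Finset.mul_sum]
  refine Finset.sum_congr rfl fun q hq => ?_
  simp only [hT, Finset.mem_filter, Finset.mem_univ, true_and] at hq
  rw [← card_perm_map_eq hq.2.2 hDE hq.1 hq.2.1, ← nsmul_eq_mul, ← Finset.sum_const]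
  simp only [Prod.ext_iff]
  refine Finset.sum_congr rfl fun σ hσ => ?_
  obtain ⟨h1, h2⟩ := (Finset.mem_filter.1 hσ).2
  rw [h1, h2]

end Counting

/-- Sums over pairs of subsets of `S`, through an enumeration of `S`. -/
lemma sum_map_orderEmbOfFin {p : ℕ} {S : Finset ℕ} (hS : S.card = p)
    (H : Finset ℕ → Finset ℕ → ℝ) (a b : ℕ) :
    (∑ q : Finset (Fin p) × Finset (Fin p),
      if q.1.card = a ∧ q.2.card = b ∧ q.1 ∪ q.2 = Finset.univ then
        H (q.1.map (S.orderEmbOfFin hS).toEmbedding) (q.2.map (S.orderEmbOfFin hS).toEmbedding)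
      else 0) =
    ∑ q ∈ S.powerset ×ˢ S.powerset,
      if q.1.card = a ∧ q.2.card = b ∧ q.1 ∪ q.2 = S then H q.1 q.2 else 0 := by
  set ι := (S.orderEmbOfFin hS).toEmbedding with hι
  have hun : Finset.univ.map ι = S := Finset.map_orderEmbOfFin_univ S hS
  refine Finset.sum_bij (fun q _ => (q.1.map ι, q.2.map ι)) ?_ ?_ ?_ ?_
  · intro q _
    simp only [Finset.mem_product, Finset.mem_powerset]
    constructor <;> conv_rhs => rw [← hun]
    · exact Finset.map_subset_map.2 (Finset.subset_univ _)
    · exact Finset.map_subset_map.2 (Finset.subset_univ _)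
  · intro q _ q' _ h
    simp only [Prod.mk.injEq, Finset.map_inj] at h
    exact Prod.ext h.1 h.2
  · rintro ⟨V, W⟩ h
    simp only [Finset.mem_product, Finset.mem_powerset] at h
    rw [← hun] at h
    obtain ⟨V', -, hV'⟩ := Finset.subset_map_iff.1 h.1
    obtain ⟨W', -, hW'⟩ := Finset.subset_map_iff.1 h.2
    exact ⟨(V', W'), Finset.mem_univ _, by rw [hV', hW']⟩
  · intro q _
    have : (q.1.map ι ∪ q.2.map ι = S) ↔ q.1 ∪ q.2 = Finset.univ := by
      rw [← Finset.map_union]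
      conv_lhs => rw [← hun]
      exact Finset.map_inj
    simp only [Finset.card_map, this]

/-- The combinatorial core of the multiplication formula: pairs of subsets of `S` are sorted
according to the numbers of common and of eliminated coordinates. -/
lemma sum_sorted_pairs {n m : ℕ} {S : Finset ℕ} {Θ : Finset ℕ → Finset ℕ → ℝ}
    (h1 : ∀ V W, V ⊆ S → W ⊆ S → Θ V W ≠ 0 → V ∪ W = S)
    (h2 : ∀ V W, V ⊆ S → W ⊆ S → Θ V W ≠ 0 → ∃ i, V.card + i = n ∧ W.card + i = m) :
    (n ! * m ! : ℝ) * ∑ q ∈ S.powerset ×ˢ S.powerset, Θ q.1 q.2 =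
      ∑ k ∈ Finset.range (min m n + 1), (k ! : ℝ) * (m.choose k : ℝ) * (n.choose k : ℝ) *
        ∑ i ∈ Finset.range (k + 1), (k.choose i : ℝ) *
          (if S.card = m + n - k - i then
            (i ! * ((k - i)! * (n - k)! * (m - k)! : ℕ) : ℝ) *
              ∑ q ∈ S.powerset ×ˢ S.powerset,
                if q.1.card = n - i ∧ q.2.card = m - i ∧ q.1 ∪ q.2 = S then Θ q.1 q.2 else 0
          else 0) := by
  have hcoef : ∀ k ∈ Finset.range (min m n + 1), ∀ i ∈ Finset.range (k + 1),
      (k ! : ℝ) * (m.choose k : ℝ) * (n.choose k : ℝ) * ((k.choose i : ℝ) *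
        (i ! * ((k - i)! * (n - k)! * (m - k)! : ℕ) : ℝ)) = n ! * m ! := by
    intro k hk i hi
    rw [Finset.mem_range] at hk hi
    have a1 : k.choose i * i ! * (k - i)! = k ! :=
      Nat.choose_mul_factorial_mul_factorial (by omega)
    have a2 : m.choose k * k ! * (m - k)! = m ! :=
      Nat.choose_mul_factorial_mul_factorial (by omega)
    have a3 : n.choose k * k ! * (n - k)! = n ! :=
      Nat.choose_mul_factorial_mul_factorial (by omega)
    have a4 : k ! * m.choose k * n.choose k * (k.choose i * (i ! * ((k - i)! * (n - k)! * (m - k)!)))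
        = n ! * m ! := by
      rw [← a2, ← a3]
      calc _ = (k.choose i * i ! * (k - i)!) * (m.choose k * k ! * (m - k)!) *
            (n.choose k * (n - k)!) := by ring
        _ = _ := by rw [a1]; ring
    exact_mod_cast a4
  have hr : ∀ k ∈ Finset.range (min m n + 1), (k ! : ℝ) * (m.choose k : ℝ) * (n.choose k : ℝ) *
        ∑ i ∈ Finset.range (k + 1), (k.choose i : ℝ) *
          (if S.card = m + n - k - i then
            (i ! * ((k - i)! * (n - k)! * (m - k)! : ℕ) : ℝ) *
              ∑ q ∈ S.powerset ×ˢ S.powerset,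
                if q.1.card = n - i ∧ q.2.card = m - i ∧ q.1 ∪ q.2 = S then Θ q.1 q.2 else 0
          else 0) = (n ! * m ! : ℝ) * ∑ i ∈ Finset.range (k + 1),
            ∑ q ∈ S.powerset ×ˢ S.powerset,
              if S.card = m + n - k - i ∧ q.1.card = n - i ∧ q.2.card = m - i ∧ q.1 ∪ q.2 = S
              then Θ q.1 q.2 else 0 := by
    intro k hk
    rw [Finset.mul_sum, Finset.mul_sum]
    refine Finset.sum_congr rfl fun i hi => ?_
    rw [← hcoef k hk i hi]
    by_cases hS : S.card = m + n - k - i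
    · simp only [hS, if_true, true_and]
      ring
    · simp [hS]
  rw [Finset.sum_congr rfl hr, ← Finset.mul_sum]
  congr 1
  have hswap : ∀ k, ∑ i ∈ Finset.range (k + 1), ∑ q ∈ S.powerset ×ˢ S.powerset,
      (if S.card = m + n - k - i ∧ q.1.card = n - i ∧ q.2.card = m - i ∧ q.1 ∪ q.2 = S
        then Θ q.1 q.2 else 0) = ∑ q ∈ S.powerset ×ˢ S.powerset, ∑ i ∈ Finset.range (k + 1),
      (if S.card = m + n - k - i ∧ q.1.card = n - i ∧ q.2.card = m - i ∧ q.1 ∪ q.2 = S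
        then Θ q.1 q.2 else 0) := fun k => Finset.sum_comm
  simp_rw [hswap]
  rw [Finset.sum_comm]
  refine Finset.sum_congr rfl fun q hq => ?_
  rw [Finset.mem_product, Finset.mem_powerset, Finset.mem_powerset] at hq
  by_cases hΘ : Θ q.1 q.2 = 0
  · simp [hΘ]
  have hU := h1 _ _ hq.1 hq.2 hΘ
  obtain ⟨i, hVi, hWi⟩ := h2 _ _ hq.1 hq.2 hΘ
  have hV := Finset.card_le_card hq.1
  have hW := Finset.card_le_card hq.2
  have hle := Finset.card_union_le q.1 q.2
  rw [hU] at hle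
  -- The order |S| = m + n − k − i together with |V| = n − i leaves a single pair (k, i) for each
  -- `(V, W)`.
  rw [Finset.sum_eq_single (m + n - i - S.card), Finset.sum_eq_single i, if_pos]
  · exact ⟨by omega, by omega, by omega, hU⟩
  · intro j hj hji
    rw [if_neg]
    rw [Finset.mem_range] at hj
    omega
  · intro hi
    rw [Finset.mem_range] at hi
    omega
  · intro k hk hne
    refine Finset.sum_eq_zero fun j hj => if_neg ?_
    rw [Finset.mem_range] at hk hj
    omega
  · intro hk
    rw [Finset.mem_range] at hk
    omega

/-! ### Integrating out the shared variables of a contraction -/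

section MixedPairing

variable {n m i : ℕ} {f : (Fin n → ℝ) → ℝ} {g : (Fin m → ℝ) → ℝ} {ψ : ℕ → ℝ → ℝ}
  {S V W : Finset ℕ} {e : Fin n → Fin i ⊕ ℕ} {e' : Fin m → Fin i ⊕ ℕ}

lemma disjoint_of_mixIdx (hl : ∀ a, ∃ j, e j = Sum.inl a)
    (hV : ∀ b, (∃ j, e j = Sum.inr b) ↔ b ∈ V) {ζ : Fin i → ℕ}
    (hK : Function.Injective (mixIdx e ζ)) : Disjoint (Finset.univ.image ζ) V := by
  rw [Finset.disjoint_left]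
  intro b hb hbV
  obtain ⟨a, -, rfl⟩ := Finset.mem_image.1 hb
  obtain ⟨j, hj⟩ := hl a
  obtain ⟨j', hj'⟩ := (hV _).2 hbV
  have : j = j' := hK (by simp [mixIdx, hj, hj'])
  rw [this, hj'] at hj
  cases hj

lemma memLp_mix_box (hf : MemLp f 2 (leb n)) (he : Function.Injective e) (ζ : Fin i → ℕ) :
    MemLp (fun q : (Fin i → ℝ) × (ℕ → ℝ) => f (mix e q.1 q.2)) 2
      ((Measure.pi fun a => boxLaw (ζ a)).prod pathLaw) :=
  (hf.mono_measure (pi_boxLaw_le_leb _)).comp_measurePreserving (measurePreserving_mix he ζ)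

lemma IsTest.integrable_mul_snd (hψ : IsTest ψ) (S : Finset ℕ) {μ : Measure (Fin i → ℝ)}
    {H : (Fin i → ℝ) × (ℕ → ℝ) → ℝ} (hH : Integrable H (μ.prod pathLaw)) :
    Integrable (fun q => H q * testFn ψ S q.2) (μ.prod pathLaw) :=
  hH.mul_bdd ((hψ.measurable_testFn S).comp measurable_snd).aestronglyMeasurable
    (Eventually.of_forall fun q => hψ.norm_testFn_le S q.2)

/-- The variables `z`, shared by `f` and `g`, act as path coordinates with indices `ζ`. If a box
repeats in either factor both sides vanish; otherwise the image of `ζ` avoids `S`, and integrating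
over `z` is a resampling that leaves the test function alone. -/
lemma integral_mix_mul_mix_box (hf : MemHatL2 n f) (hg : MemHatL2 m g) (hψ : IsTest ψ)
    (he : Function.Injective e) (he' : Function.Injective e')
    (hl : ∀ a, ∃ j, e j = Sum.inl a) (hl' : ∀ a, ∃ j, e' j = Sum.inl a)
    (hV : ∀ b, (∃ j, e j = Sum.inr b) ↔ b ∈ V) (hW : ∀ b, (∃ j, e' j = Sum.inr b) ↔ b ∈ W)
    (hS : V ∪ W = S) (ζ : Fin i → ℕ) :
    ∫ q, f (mix e q.1 q.2) * g (mix e' q.1 q.2) * testFn ψ S q.2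
      ∂((Measure.pi fun a => boxLaw (ζ a)).prod pathLaw) =
      sharedPairing f g ψ S V W (Finset.univ.image ζ) := by
  have him := image_mixIdx ζ hl V hV
  have him' := image_mixIdx ζ hl' W hW
  have hint := hψ.integrable_mul_snd S
    ((memLp_mix_box hf.memLp he ζ).integrable_mul (memLp_mix_box hg.memLp he' ζ))
  simp only [Pi.mul_apply] at hint
  by_cases hK : Function.Injective (mixIdx e ζ)
  swap
  · have h0 := (measurePreserving_mix he ζ).quasiMeasurePreserving.ae
      (ae_eq_zero_of_not_injective hf.vanish hK)
    rw [integral_eq_zero_of_ae (by filter_upwards [h0] with q hq; simp [hq]), sharedPairing]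
    split_ifs
    · rw [Finset.union_comm _ V, pairing_of_card_ne_left]
      rw [← him, Ne, card_image_eq_iff]; exact hK
    · rfl
  by_cases hK' : Function.Injective (mixIdx e' ζ)
  swap
  · have h0 := (measurePreserving_mix he' ζ).quasiMeasurePreserving.ae
      (ae_eq_zero_of_not_injective hg.vanish hK')
    rw [integral_eq_zero_of_ae (by filter_upwards [h0] with q hq; simp [hq]), sharedPairing]
    split_ifs
    · rw [Finset.union_comm _ W, pairing_of_card_ne_right]
      rw [← him', Ne, card_image_eq_iff]; exact hK'
    · rfl
  set C := Finset.univ.image ζ with hC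
  have hdis : Disjoint C S := by
    rw [← hS, Finset.disjoint_union_right]
    exact ⟨disjoint_of_mixIdx hl hV hK, disjoint_of_mixIdx hl' hW hK'⟩
  have hmp := measurePreserving_comp (injective_of_mixIdx hl hK)
  rw [sharedPairing, if_pos hdis, integral_prod_symm _ hint]
  set Φ : (ℕ → ℝ) → ℝ := fun w => f (fun j => w (mixIdx e ζ j)) * g (fun j => w (mixIdx e' ζ j)) *
    testFn ψ S w with hΦ
  have hΦeq : Φ =ᵐ[pathLaw] fun x => sect f (C ∪ V) x * sect g (C ∪ W) x * testFn ψ S x := by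
    have h1 := comp_ae_eq_sect hf.symmetric hK
    have h2 := comp_ae_eq_sect hg.symmetric hK'
    rw [him, Finset.union_comm] at h1
    rw [him', Finset.union_comm] at h2
    filter_upwards [h1, h2] with x hx1 hx2
    simp only [hΦ, hx1, hx2]
  have hΦi : Integrable Φ pathLaw := (hψ.integrable_mul S
    (integrable_sect_mul_sect hf.memLp hg.memLp (C ∪ V) (C ∪ W))).congr hΦeq.symm
  rw [pairing, ← integral_congr_ae hΦeq, ← integral_resample hΦi C]
  refine integral_congr_ae ?_
  filter_upwards [hint.prod_left_ae] with x hx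
  have hx1 := hx.1
  rw [← hmp.map_eq] at hx1 ⊢
  rw [integral_map hmp.measurable.aemeasurable hx1]
  unfold resample
  refine integral_congr_ae (Eventually.of_forall fun y => ?_)
  have ht : testFn ψ S (C.piecewise y x) = testFn ψ S x := by
    refine dependsOn_testFn ψ S fun k hk => ?_
    have : k ∉ C := fun h => Finset.disjoint_left.1 hdis h hk
    simp [Finset.piecewise, this]
  simp only [hΦ, mix_eq_piecewise hl hK, mix_eq_piecewise hl' hK', ht]
  rfl

lemma sharedPairing_of_card_ne (hVS : V ⊆ S) {Z : Finset ℕ} (hZ : V.card + Z.card ≠ n) :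
    sharedPairing f g ψ S V W Z = 0 := by
  rw [sharedPairing]
  split_ifs with hd
  · refine pairing_of_card_ne_left ?_
    rw [Finset.card_union_of_disjoint (hd.mono_right hVS)]
    omega
  · rfl

/-- Lebesgue measure contributes 2ⁱ and a sum over tuples of boxes. Each `Z` of size `i` comes from
`i !` tuples, and by cardinality no other `Z` contributes. -/
lemma integral_mix_mul_mix (hf : MemHatL2 n f) (hg : MemHatL2 m g) (hψ : IsTest ψ)
    (he : Function.Injective e) (he' : Function.Injective e')
    (hl : ∀ a, ∃ j, e j = Sum.inl a) (hl' : ∀ a, ∃ j, e' j = Sum.inl a)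
    (hV : ∀ b, (∃ j, e j = Sum.inr b) ↔ b ∈ V) (hW : ∀ b, (∃ j, e' j = Sum.inr b) ↔ b ∈ W)
    (hS : V ∪ W = S) (hcard : V.card + i = n) :
    ∫ x, (∫ z, f (mix e z x) * g (mix e' z x) ∂leb i) * testFn ψ S x ∂pathLaw =
      2 ^ i * (i ! * totalPairing f g ψ S V W) := by
  have hVS : V ⊆ S := hS ▸ Finset.subset_union_left
  have hWS : W ⊆ S := hS ▸ Finset.subset_union_right
  have hint := hψ.integrable_mul_snd S
    ((MemLp.comp_mix he hl hf.memLp).integrable_mul (MemLp.comp_mix he' hl' hg.memLp))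
  simp only [Pi.mul_apply] at hint
  simp_rw [← integral_mul_const]
  have hsum := summable_sharedPairing (V := V) (W := W) hf.memLp hg.memLp hψ hVS hWS
  have hone : ∀ Z, (if Z.card = i then sharedPairing f g ψ S V W Z else 0) =
      sharedPairing f g ψ S V W Z := by
    intro Z
    split_ifs with hZ
    · rfl
    · exact (sharedPairing_of_card_ne hVS (by omega)).symm
  have htuple := tsum_tuple (a := i) (G := sharedPairing f g ψ S V W)
    (by simp_rw [hone]; exact hsum) fun A hA => sharedPairing_of_card_ne hVS (by omega)
  simp_rw [hone] at htuple
  rw [totalPairing, ← htuple, ← integral_prod_symm _ hint]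
  have hm : (leb i).prod pathLaw = Measure.sum fun ζ : Fin i → ℕ =>
      (2 ^ i : ℝ≥0∞) • ((Measure.pi fun a => boxLaw (ζ a)).prod pathLaw) := by
    rw [leb_eq_sum, Measure.prod_sum_left]
    simp_rw [Measure.prod_smul_left]
  rw [hm] at hint ⊢
  rw [integral_sum_measure hint, ← tsum_mul_left]
  refine tsum_congr fun ζ => ?_
  rw [integral_smul_measure, integral_mix_mul_mix_box hf hg hψ he he' hl hl' hV hW hS]
  simp

end MixedPairing

lemma totalPairing_ne_zero {n m : ℕ} {f : (Fin n → ℝ) → ℝ} {g : (Fin m → ℝ) → ℝ}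
    {ψ : ℕ → ℝ → ℝ} {S V W : Finset ℕ} (hf : MemHatL2 n f) (hfc : IsCanonical n f)
    (hg : MemHatL2 m g)
    (hgc : IsCanonical m g) (hψ : IsTest ψ) (hV : V ⊆ S) (hW : W ⊆ S)
    (h : totalPairing f g ψ S V W ≠ 0) :
    V ∪ W = S ∧ ∃ i, V.card + i = n ∧ W.card + i = m := by
  obtain ⟨Z, hZ⟩ : ∃ Z, sharedPairing f g ψ S V W Z ≠ 0 := by
    by_contra hc
    push Not at hc
    exact h (by simp [totalPairing, hc])
  rw [sharedPairing] at hZ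
  split_ifs at hZ with hd
  swap
  · exact absurd rfl hZ
  constructor
  · refine Finset.Subset.antisymm (Finset.union_subset hV hW) fun k hk => ?_
    have hgood := not_imp_comm.1 (pairing_eq_zero hf hfc hg hgc hψ) hZ
    have h1 := hgood.2.2 hk
    have h2 : k ∉ Z := fun hkZ => Finset.disjoint_left.1 hd hkZ hk
    simp only [Finset.mem_union] at h1 ⊢
    tauto
  · refine ⟨Z.card, ?_, ?_⟩
    · have := not_imp_comm.1 (pairing_of_card_ne_left (f := f)) hZ
      rw [Finset.card_union_of_disjoint (hd.mono_right hV)] at this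
      omega
    · have := not_imp_comm.1 (pairing_of_card_ne_right (g := g)) hZ
      rw [Finset.card_union_of_disjoint (hd.mono_right hW)] at this
      omega

/-- The pairing of a contraction with a test function. -/
lemma integral_contraction_mul_testFn {n m k i : ℕ} (hik : i ≤ k) (hk : k ≤ min m n)
    {f : (Fin n → ℝ) → ℝ} {g : (Fin m → ℝ) → ℝ}
    (hf : MemHatL2 n f) (hg : MemHatL2 m g) {ψ : ℕ → ℝ → ℝ} (hψ : IsTest ψ)
    {ρ : Fin (m + n - k - i) → ℕ} (hρ : Function.Injective ρ) :
    ∫ x, contraction n m k i f g (fun j => x (ρ j)) *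
        testFn ψ (Finset.univ.image ρ) x ∂pathLaw =
      i ! * totalPairing f g ψ (Finset.univ.image ρ)
        ((Finset.univ.filter fun j : Fin (m + n - k - i) => (j : ℕ) < n - i).image ρ)
        ((Finset.univ.filter fun j : Fin (m + n - k - i) =>
          (j : ℕ) < k - i ∨ n - i ≤ (j : ℕ)).image ρ) := by
  -- The slots of (γ, t, s) read by `f` are those below n − i; `g` reads the γ slots, below k − i,
  -- and the s slots, from n − i on.
  set e : Fin n → Fin i ⊕ ℕ := fun j =>
    if h : (j : ℕ) < i then Sum.inl ⟨j, h⟩ else Sum.inr (ρ ⟨j - i, by omega⟩) with he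
  set e' : Fin m → Fin i ⊕ ℕ := fun j =>
    if h : (j : ℕ) < i then Sum.inl ⟨j, h⟩
    else if h2 : (j : ℕ) < k then Sum.inr (ρ ⟨j - i, by omega⟩)
    else Sum.inr (ρ ⟨(n - i) + (j - k), by omega⟩) with he'
  have hinj : Function.Injective e := by
    intro a b hab
    simp only [he] at hab
    split_ifs at hab with h1 h2 h2
    · simpa [Fin.ext_iff] using hab
    · have := hρ (Sum.inr_injective hab)
      simp only [Fin.mk.injEq] at this
      ext; omega
  have hinj' : Function.Injective e' := by
    intro a b hab
    simp only [he'] at hab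
    split_ifs at hab
    · simpa [Fin.ext_iff] using hab
    all_goals
      have := hρ (Sum.inr_injective hab)
      simp only [Fin.mk.injEq] at this
      ext; omega
  have hl : ∀ a, ∃ j, e j = Sum.inl a := fun a => ⟨⟨a, by omega⟩, by simp [he]⟩
  have hl' : ∀ a, ∃ j, e' j = Sum.inl a := fun a => ⟨⟨a, by omega⟩, by simp [he']⟩
  set D := Finset.univ.filter fun j : Fin (m + n - k - i) => (j : ℕ) < n - i with hD
  set E := Finset.univ.filter fun j : Fin (m + n - k - i) =>
    (j : ℕ) < k - i ∨ n - i ≤ (j : ℕ) with hE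
  have hV : ∀ b, (∃ j, e j = Sum.inr b) ↔ b ∈ D.image ρ := by
    intro b
    simp only [hD, Finset.mem_image, Finset.mem_filter, Finset.mem_univ, true_and]
    constructor
    · rintro ⟨j, hj⟩
      simp only [he] at hj
      split_ifs at hj with h1
      exact ⟨_, by simp only; omega, Sum.inr_injective hj⟩
    · rintro ⟨l, hl1, rfl⟩
      refine ⟨⟨l + i, by omega⟩, ?_⟩
      simp [he]
  have hW : ∀ b, (∃ j, e' j = Sum.inr b) ↔ b ∈ E.image ρ := by
    intro b
    simp only [hE, Finset.mem_image, Finset.mem_filter, Finset.mem_univ, true_and]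
    constructor
    · rintro ⟨j, hj⟩
      simp only [he'] at hj
      split_ifs at hj with h1 h2
      · exact ⟨_, by simp only; omega, Sum.inr_injective hj⟩
      · exact ⟨_, by simp only; omega, Sum.inr_injective hj⟩
    · rintro ⟨l, hl1 | hl1, rfl⟩
      · refine ⟨⟨l + i, by omega⟩, ?_⟩
        have : (l : ℕ) + i < k := by omega
        simp [he', this]
      · refine ⟨⟨l - (n - i) + k, by omega⟩, ?_⟩
        have h1 : ¬ ((l : ℕ) - (n - i) + k < i) := by omega
        have h2 : n - i + ((l : ℕ) - (n - i)) = l := by omega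
        simp [he', h1, h2]
  have hS : D.image ρ ∪ E.image ρ = Finset.univ.image ρ := by
    rw [← Finset.image_union]
    congr 1
    ext j
    simp only [hD, hE, Finset.mem_union, Finset.mem_filter, Finset.mem_univ, true_and, iff_true]
    omega
  have hcard : (D.image ρ).card + i = n := by
    rw [Finset.card_image_of_injective _ hρ, hD, Fin.card_filter_val_lt]
    omega
  have hcon : ∀ x : ℕ → ℝ, contraction n m k i f g (fun j => x (ρ j)) =
      1 / 2 ^ i * ∫ z, f (mix e z x) * g (mix e' z x) ∂leb i := by
    intro x
    unfold contraction
    congr 1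
    refine integral_congr_ae (Eventually.of_forall fun z => ?_)
    simp only
    congr 2
    · funext j
      simp only [mix, he]
      split_ifs with h1
      · simp [coord, h1]
      · have : (j : ℕ) - i < m + n - k - i := by omega
        simp [coord, this]
    · funext j
      simp only [mix, he']
      split_ifs with h1 h2
      · simp [coord, h1]
      · have : (j : ℕ) - i < m + n - k - i := by omega
        simp [coord, this]
      · have : n - i + ((j : ℕ) - k) < m + n - k - i := by omega
        simp [coord, this]
  simp_rw [hcon, mul_assoc]
  rw [integral_const_mul, integral_mix_mul_mix hf hg hψ hinj hinj' hl hl' hV hW hS hcard]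
  field_simp

/-! ### The kernels of the multiplication formula -/

lemma measurePreserving_perm {p : ℕ} (σ : Equiv.Perm (Fin p)) :
    MeasurePreserving (fun (x : Fin p → ℝ) j => x (σ j)) (leb p) (leb p) := by
  refine ⟨by fun_prop, ?_⟩
  refine (Measure.pi_eq fun s hs => ?_).symm
  rw [Measure.map_apply (by fun_prop) (MeasurableSet.univ_pi hs)]
  have : (fun (x : Fin p → ℝ) j => x (σ j)) ⁻¹' Set.univ.pi s =
      Set.univ.pi fun j => s (σ.symm j) := by
    ext x
    simp only [Set.mem_preimage, Set.mem_pi, Set.mem_univ, true_imp_iff]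
    exact ⟨fun h j => by simpa using h (σ.symm j), fun h j => by simpa using h (σ j)⟩
  rw [this, leb, Measure.pi_pi]
  exact Equiv.prod_comp σ.symm fun j => ((volume : Measure ℝ).restrict (Set.Ici 0)) (s j)

lemma measurableSet_offDiag (p : ℕ) : MeasurableSet (offDiag p) := by
  have : offDiag p = ⋃ κ ∈ {κ : Fin p → ℕ | Function.Injective κ},
      Set.univ.pi fun j => Set.Icc (2 * (κ j : ℝ)) (2 * (κ j : ℝ) + 2) := by
    ext x
    simp only [offDiag, Set.mem_iUnion, Set.mem_pi, Set.mem_univ, true_imp_iff, exists_prop,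
      Set.mem_ofPred_eq]
  rw [this]
  exact MeasurableSet.biUnion (Set.to_countable _) fun κ _ =>
    MeasurableSet.univ_pi fun j => measurableSet_Icc

lemma mem_offDiag_perm {p : ℕ} (σ : Equiv.Perm (Fin p)) {x : Fin p → ℝ} :
    (fun j => x (σ j)) ∈ offDiag p ↔ x ∈ offDiag p := by
  have key : ∀ (σ : Equiv.Perm (Fin p)) (x : Fin p → ℝ), x ∈ offDiag p →
      (fun j => x (σ j)) ∈ offDiag p := by
    rintro σ x ⟨κ, hκ, h⟩
    exact ⟨fun j => κ (σ j), hκ.comp σ.injective, fun j => h (σ j)⟩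
  refine ⟨fun h => ?_, key σ x⟩
  simpa using key σ.symm _ h

lemma symmetrisation_perm {p : ℕ} (h : (Fin p → ℝ) → ℝ) (τ : Equiv.Perm (Fin p))
    (x : Fin p → ℝ) : symmetrisation p h (fun j => x (τ j)) = symmetrisation p h x := by
  unfold symmetrisation
  congr 1
  exact Fintype.sum_equiv (Equiv.mulLeft τ) _ _ fun σ => by simp

lemma memHatL2_indicator_symmetrisation {p : ℕ} {h : (Fin p → ℝ) → ℝ}
    (hh : MemLp h 2 (leb p)) : MemHatL2 p ((offDiag p).indicator (symmetrisation p h)) := by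
  refine ⟨?_, fun τ => Eventually.of_forall fun x => ?_, Eventually.of_forall fun x hx => ?_⟩
  · refine MemLp.indicator (measurableSet_offDiag p) ?_
    exact (memLp_finsetSum _ fun σ _ =>
      hh.comp_measurePreserving (measurePreserving_perm σ)).const_mul _
  · by_cases hx : x ∈ offDiag p
    · rw [Set.indicator_of_mem hx, Set.indicator_of_mem ((mem_offDiag_perm τ).2 hx),
        symmetrisation_perm]
    · rw [Set.indicator_of_notMem hx,
        Set.indicator_of_notMem (fun h => hx ((mem_offDiag_perm τ).1 h))]
  · exact Set.indicator_of_notMem hx _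

lemma ae_mem_box : ∀ᵐ x ∂pathLaw, ∀ k : ℕ,
    x k ∈ Set.Icc (2 * (k : ℝ)) (2 * (k : ℝ) + 2) := by
  refine ae_all_iff.2 fun k => ?_
  refine (measurePreserving_eval_infinitePi boxLaw k).quasiMeasurePreserving.ae ?_
  rw [boxLaw]
  exact Measure.ae_smul_measure (ae_restrict_mem measurableSet_Icc) _

/-- Path coordinates with distinct indices almost surely lie in `offDiag p`, so the indicator has no
effect; the factor `p !` undoes the averaging. -/
lemma integral_sect_symmetrisation {p : ℕ} {h : (Fin p → ℝ) → ℝ} (hh : MemLp h 2 (leb p))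
    {ψ : ℕ → ℝ → ℝ} (hψ : IsTest ψ) {S : Finset ℕ} (hS : S.card = p) :
    p ! * ∫ x, sect ((offDiag p).indicator (symmetrisation p h)) S x * testFn ψ S x ∂pathLaw =
      ∑ σ : Equiv.Perm (Fin p),
        ∫ x, h (fun j => x (S.orderEmbOfFin hS (σ j))) * testFn ψ S x ∂pathLaw := by
  have hinj : ∀ σ : Equiv.Perm (Fin p), Function.Injective fun j => S.orderEmbOfFin hS (σ j) :=
    fun σ => (S.orderEmbOfFin hS).injective.comp σ.injective
  have hi : ∀ σ : Equiv.Perm (Fin p),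
      Integrable (fun x : ℕ → ℝ => h (fun j => x (S.orderEmbOfFin hS (σ j)))) pathLaw := fun σ =>
    ((hh.mono_measure (pi_boxLaw_le_leb _)).comp_measurePreserving
      (measurePreserving_comp (hinj σ))).integrable (by norm_num)
  have e1 : ∀ᵐ x ∂pathLaw, sect ((offDiag p).indicator (symmetrisation p h)) S x * testFn ψ S x =
      1 / (p ! : ℝ) * ∑ σ : Equiv.Perm (Fin p),
        h (fun j => x (S.orderEmbOfFin hS (σ j))) * testFn ψ S x := by
    filter_upwards [ae_mem_box] with x hx
    rw [sect_of_card _ hS]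
    simp only
    have hmem : (fun j => x (S.orderEmbOfFin hS j)) ∈ offDiag p :=
      ⟨_, (S.orderEmbOfFin hS).injective, fun j => hx _⟩
    rw [Set.indicator_of_mem hmem, symmetrisation,
      mul_assoc, Finset.sum_mul]
  rw [integral_congr_ae e1, integral_const_mul,
    integral_finsetSum _ fun σ _ => hψ.integrable_mul S (hi σ)]
  have : (p ! : ℝ) ≠ 0 := by positivity
  field_simp

/-! ### The multiplication formula -/

section Formula

variable {n m : ℕ} {f : (Fin n → ℝ) → ℝ} {g : (Fin m → ℝ) → ℝ}

/-- The slots used by `f` and by `g` form a fixed covering pair `(D, E)`. Permuting the variables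
moves it over all covering pairs of `S` with those sizes, each equally often. -/
lemma integral_mul_testFn_of_isPathLimit_productKernel {k i : ℕ} (hik : i ≤ k)
    (hk : k ≤ min m n) (hf : MemHatL2 n f) (hg : MemHatL2 m g)
    (hC : MemLp (contraction n m k i f g) 2 (leb (m + n - k - i)))
    {Z : (ℕ → ℝ) → ℝ} (hZ : IsPathLimit (productKernel n m k i f g) Z)
    {ψ : ℕ → ℝ → ℝ} (hψ : IsTest ψ) (S : Finset ℕ) :
    ∫ x, Z x * testFn ψ S x ∂pathLaw =
      if S.card = m + n - k - i then
        (i ! * ((k - i)! * (n - k)! * (m - k)! : ℕ) : ℝ) *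
          ∑ q ∈ S.powerset ×ˢ S.powerset,
            if q.1.card = n - i ∧ q.2.card = m - i ∧ q.1 ∪ q.2 = S then
              totalPairing f g ψ S q.1 q.2 else 0
      else 0 := by
  have hkn : k ≤ n := hk.trans (min_le_right _ _)
  have hkm : k ≤ m := hk.trans (min_le_left _ _)
  rw [hZ.integral_mul_testFn (memHatL2_indicator_symmetrisation hC).memLp hψ S]
  split_ifs with hS
  · refine (integral_sect_symmetrisation hC hψ hS).trans ?_
    set D := Finset.univ.filter fun j : Fin (m + n - k - i) => (j : ℕ) < n - i with hD
    set E := Finset.univ.filter fun j : Fin (m + n - k - i) =>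
      (j : ℕ) < k - i ∨ n - i ≤ (j : ℕ) with hE
    have hDE : D ∪ E = Finset.univ := by
      ext j
      simp only [hD, hE, Finset.mem_union, Finset.mem_filter, Finset.mem_univ, true_and, iff_true]
      omega
    have cD : D.card = n - i := by
      rw [hD, Fin.card_filter_val_lt]; omega
    have cI : (D ∩ E).card = k - i := by
      have : D ∩ E = Finset.univ.filter fun j : Fin (m + n - k - i) => (j : ℕ) < k - i := by
        ext j
        simp only [hD, hE, Finset.mem_inter, Finset.mem_filter, Finset.mem_univ, true_and]
        omega
      rw [this, Fin.card_filter_val_lt]; omega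
    have h1 := Finset.card_union_add_card_inter D E
    rw [hDE, Finset.card_univ, Fintype.card_fin] at h1
    have h2 := Finset.card_sdiff_add_card_inter D E
    have h3 := Finset.card_sdiff_add_card_inter E D
    rw [Finset.inter_comm] at h3
    have cE : E.card = m - i := by omega
    have cDE : (D \ E).card = n - k := by omega
    have cED : (E \ D).card = m - k := by omega
    set ι := (S.orderEmbOfFin hS).toEmbedding with hι
    have hσ : ∀ σ : Equiv.Perm (Fin (m + n - k - i)),
        ∫ x, contraction n m k i f g (fun j => x (S.orderEmbOfFin hS (σ j))) *
          testFn ψ S x ∂pathLaw =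
        i ! * totalPairing f g ψ S ((D.map σ.toEmbedding).map ι) ((E.map σ.toEmbedding).map ι) := by
      intro σ
      have := integral_contraction_mul_testFn hik hk hf hg hψ
        ((S.orderEmbOfFin hS).injective.comp σ.injective)
      simp only [Function.comp_def, image_orderEmbOfFin_perm] at this
      rw [this, Finset.map_map, Finset.map_map, Finset.map_eq_image, Finset.map_eq_image]
      rfl
    simp_rw [hσ]
    rw [← Finset.mul_sum,
      sum_perm_map D E hDE fun V W => totalPairing f g ψ S (V.map ι) (W.map ι),
      cD, cE, cI, cDE, cED, ← mul_assoc]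
    congr 1
    exact sum_map_orderEmbOfFin hS (totalPairing f g ψ S) (n - i) (m - i)
  · simp [sect_of_card_ne _ hS]

/-- Both sides are integrable, so it is enough that they pair equally with all test functions; that
equality is the combinatorial identity `sum_sorted_pairs`. -/
lemma ae_mul_eq_of_isPathLimit (hf : MemHatL2 n f) (hfc : IsCanonical n f) (hg : MemHatL2 m g)
    (hgc : IsCanonical m g)
    (hfg : ∀ k i : ℕ, i ≤ k → k ≤ min m n →
      MemLp (contraction n m k i f g) 2 (leb (m + n - k - i)))
    {Y Y' : (ℕ → ℝ) → ℝ} (hY : IsPathLimit f Y) (hY' : IsPathLimit g Y')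
    {Z : ℕ → ℕ → (ℕ → ℝ) → ℝ}
    (hZ : ∀ k i : ℕ, i ≤ k → k ≤ min m n → IsPathLimit (productKernel n m k i f g) (Z k i)) :
    ∀ᵐ x ∂pathLaw, Y x * Y' x = ∑ k ∈ Finset.range (min m n + 1),
      (k ! : ℝ) * (m.choose k : ℝ) * (n.choose k : ℝ) *
        ∑ i ∈ Finset.range (k + 1), (k.choose i : ℝ) * Z k i x := by
  have hik : ∀ {k i : ℕ}, i ∈ Finset.range (k + 1) → i ≤ k := fun h =>
    Nat.lt_succ_iff.1 (Finset.mem_range.1 h)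
  have hI : ∀ k ∈ Finset.range (min m n + 1), ∀ i ∈ Finset.range (k + 1),
      Integrable (Z k i) pathLaw := fun k hk i hi =>
    (hZ k i (hik hi) (hik hk)).memLp.integrable (by norm_num)
  have hp : Integrable (fun x => Y x * Y' x) pathLaw := hY.memLp.integrable_mul hY'.memLp
  have hs : Integrable (fun x => ∑ k ∈ Finset.range (min m n + 1),
      (k ! : ℝ) * (m.choose k : ℝ) * (n.choose k : ℝ) *
        ∑ i ∈ Finset.range (k + 1), (k.choose i : ℝ) * Z k i x) pathLaw :=
    integrable_finsetSum _ fun k hk => (integrable_finsetSum _ fun i hi =>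
      (hI k hk i hi).const_mul _).const_mul _
  have h0 := ae_eq_zero_of_testFn (hp.sub hs) fun ψ hψ S => ?_
  · filter_upwards [h0] with x hx
    exact sub_eq_zero.1 hx
  simp only [Pi.sub_apply, sub_mul]
  rw [integral_sub (hψ.integrable_mul S hp) (hψ.integrable_mul S hs), sub_eq_zero,
    integral_mul_mul_testFn hf hfc hg hgc hψ S hY hY',
    sum_sorted_pairs (fun V W hV hW h => (totalPairing_ne_zero hf hfc hg hgc hψ hV hW h).1)
      (fun V W hV hW h => (totalPairing_ne_zero hf hfc hg hgc hψ hV hW h).2)]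
  simp only [Finset.sum_mul, Finset.mul_sum, mul_assoc]
  rw [integral_finsetSum _ fun k hk => integrable_finsetSum _ fun i hi =>
    ((((hψ.integrable_mul S (hI k hk i hi)).const_mul _).const_mul _).const_mul _).const_mul _]
  refine Finset.sum_congr rfl fun k hk => ?_
  rw [integral_finsetSum _ fun i hi =>
    ((((hψ.integrable_mul S (hI k hk i hi)).const_mul _).const_mul _).const_mul _).const_mul _]
  refine Finset.sum_congr rfl fun i hi => ?_
  simp only [integral_const_mul]
  rw [integral_mul_testFn_of_isPathLimit_productKernel (hik hi) (hik hk) hf hg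
    (hfg k i (hik hi) (hik hk)) (hZ k i (hik hi) (hik hk)) hψ S]
  simp only [Finset.mul_sum, mul_assoc]

end Formula

end UniformChaos

end

theorem theorem6p1 {Ω : Type*} [MeasurableSpace Ω] (P : Measure Ω) [IsProbabilityMeasure P]
    (U : ℕ → Ω → ℝ) (hU : UniformChaos.IsIIDUniform P U)
    (n m : ℕ) (f : (Fin n → ℝ) → ℝ) (g : (Fin m → ℝ) → ℝ)
    (hf : UniformChaos.MemHatL2 n f) (hg : UniformChaos.MemHatL2 m g)
    (hfc : UniformChaos.IsCanonical n f) (hgc : UniformChaos.IsCanonical m g)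
    (hfg : ∀ k i : ℕ, i ≤ k → k ≤ min m n →
      MemLp (UniformChaos.contraction n m k i f g) 2 (UniformChaos.leb (m + n - k - i))) :
    -- all the multiple integrals involved are well defined
    UniformChaos.IsMultipleIntegral P U n f (UniformChaos.multipleIntegral P U n f) ∧
    UniformChaos.IsMultipleIntegral P U m g (UniformChaos.multipleIntegral P U m g) ∧
    (∀ k i : ℕ, i ≤ k → k ≤ min m n →
      UniformChaos.IsMultipleIntegral P U (m + n - k - i)
        (UniformChaos.productKernel n m k i f g)
        (UniformChaos.multipleIntegral P U (m + n - k - i)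
          (UniformChaos.productKernel n m k i f g))) ∧
    -- the multiplication formula
    ∀ᵐ ω ∂P,
      UniformChaos.multipleIntegral P U n f ω * UniformChaos.multipleIntegral P U m g ω =
        ∑ k ∈ Finset.range (min m n + 1),
          (k ! : ℝ) * (m.choose k : ℝ) * (n.choose k : ℝ) *
            ∑ i ∈ Finset.range (k + 1), (k.choose i : ℝ) *
              UniformChaos.multipleIntegral P U (m + n - k - i)
                (UniformChaos.productKernel n m k i f g) ω := by
  have hK : ∀ k i : ℕ, i ≤ k → k ≤ min m n →
      UniformChaos.MemHatL2 (m + n - k - i) (UniformChaos.productKernel n m k i f g) :=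
    fun k i hi hk => UniformChaos.memHatL2_indicator_symmetrisation (hfg k i hi hk)
  refine ⟨UniformChaos.isMultipleIntegral_multipleIntegral hU hf,
    UniformChaos.isMultipleIntegral_multipleIntegral hU hg,
    fun k i hi hk => UniformChaos.isMultipleIntegral_multipleIntegral hU (hK k i hi hk), ?_⟩
  obtain ⟨Y, hY⟩ := UniformChaos.exists_isPathLimit hf.memLp
  obtain ⟨Y', hY'⟩ := UniformChaos.exists_isPathLimit hg.memLp
  have hex : ∀ k i : ℕ, ∃ Z : (ℕ → ℝ) → ℝ, i ≤ k → k ≤ min m n →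
      UniformChaos.IsPathLimit (UniformChaos.productKernel n m k i f g) Z := by
    intro k i
    by_cases h : i ≤ k ∧ k ≤ min m n
    · obtain ⟨Z, hZ⟩ := UniformChaos.exists_isPathLimit (hK k i h.1 h.2).memLp
      exact ⟨Z, fun _ _ => hZ⟩
    · exact ⟨0, fun h1 h2 => absurd ⟨h1, h2⟩ h⟩
  choose Z hZ using hex
  have hZae : ∀ᵐ ω ∂P, ∀ k i : ℕ, i ≤ k → k ≤ min m n →
      UniformChaos.multipleIntegral P U (m + n - k - i)
        (UniformChaos.productKernel n m k i f g) ω =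
        Z k i (fun l => UniformChaos.jumpTime U l ω) := by
    refine ae_all_iff.2 fun k => ae_all_iff.2 fun i => ?_
    by_cases h : i ≤ k ∧ k ≤ min m n
    · filter_upwards [UniformChaos.multipleIntegral_ae_eq hU (hK k i h.1 h.2)
        (hZ k i h.1 h.2)] with ω hω _ _ using hω
    · exact Eventually.of_forall fun ω h1 h2 => absurd ⟨h1, h2⟩ h
  filter_upwards [UniformChaos.multipleIntegral_ae_eq hU hf hY,
    UniformChaos.multipleIntegral_ae_eq hU hg hY', hZae,
    (UniformChaos.measurePreserving_jumpTime hU).quasiMeasurePreserving.ae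
      (UniformChaos.ae_mul_eq_of_isPathLimit hf hfc hg hgc hfg hY hY' hZ)] with ω h1 h2 h3 h4
  rw [h1, h2, h4]
  refine Finset.sum_congr rfl fun k hk => ?_
  congr 1
  refine Finset.sum_congr rfl fun i hi => ?_
  rw [h3 k i (Nat.lt_succ_iff.1 (Finset.mem_range.1 hi))
    (Nat.lt_succ_iff.1 (Finset.mem_range.1 hk))]
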